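/- **Setting.** Let $B$ be a single-qubit Pauli operator ($X$, $Y$ or $Z$ on one of $n$ qubits). For an initial state $\rho_0$ and $n$-qubit unitaries $U=U_{1:i}(\boldsymbol x,\boldsymbol\theta)$, $U'=U_{1:i}(\boldsymbol x',\boldsymbol\theta)$ (the parts of the circuit up to the gate of the $i$-th parameter, whose generator is $B$), put $\tilde B=U^\dagger BU$, $\tilde B'=U'^\dagger BU'$ and $k=\tfrac12\mathrm{Tr}[\rho_0\{\tilde B,\tilde B'\}]$. This is the $i$-th term of the quantum Fisher kernel based on the anti-symmetric logarithmic derivative, with the Fisher matrix replaced by the identity and the mean term dropped. A random unitary $W$ is a $t$-design if $\mathbb E[W^{\otimes t}X(W^\dagger)^{\otimes t}]=\int V^{\otimes t}X(V^\dagger)^{\otimes t}\,d\mu_{\mathrm{Haar}}(V)$ for every operator $X$. **(1) Circuits on all qubits.** Let $\rho_0$ be a pure state and let $U,U'$ be independent random $n$-qubit unitaries, $n\ge1$. If $U$ or $U'$ is a 1-design, then $\mathbb E[k]=0$. If both are 2-designs, then $\mathbb E[k]=0$ and $$\mathrm{Var}[k]=\frac{2^n}{2(2^{2n}-1)}\left(1+\frac{2^n-2}{2^n(2^n+1)}\right),$$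 and the ratio of the right-hand side to $2^{-(n+1)}$ tends to $1$ as $n\to\infty$. **(2) Alternating layered ansatz.** Let $n=m\kappa$ with $m=1$ or $m\ge 2$ even. Layer $l=1,2,\dots$ consists of $m$-qubit blocks $W_{1,l},\dots,W_{\kappa,l}$ on consecutive groups of $m$ qubits, starting at the first qubit if $l$ is odd and shifted by $\lfloor m/2\rfloor$ qubits if $l$ is even; in a shifted layer the last block either wraps around (periodic boundary) or is absent (free boundary). For $m=1$ there is no shift. Fix a block $(k_0,d)$ of layer $d\ge1$ and a qubit of that block, and let $B$ be $X$, $Y$ or $Z$ on that qubit. Let $U=\tilde W\,V_{d-1}\cdots V_1$, where $V_l$ is the product of the blocks of layer $l$ and $\tilde W$ (the truncated block) is a unitary acting on the qubits of block $(k_0,d)$; let $U'$ be built likewise from blocks $W'_{k,l}$ and $\tilde W'$. All these random unitaries, for both inputs, are independent; $\tilde W$, $\tilde W'$ and all blocks of the layers before $d$ in the backward light cone of block $(k_0,d)$ are 2-designs. Let $\rho_0$ be a density matrix. Then: * $\mathbb E[k]=0$. * Write $P_h=\mathrm{Tr}[(\mathrm{Tr}_{\bar h}\rho_0)^2]$ for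 the purity of the reduction of $\rho_0$ to a set $h$ of qubits. If $P_{(h\cup h')\setminus(h\cap h')}\ge P_hP_{h'}$ and $P_{h\cup h'}\ge P_hP_{h'}$ for all $h,h'$ that are unions of supports of first-layer blocks in the light cone of block $(k_0,d)$ (for $d=1$ the only such block is $(k_0,1)$ itself), then $$\mathrm{Var}[k]\ \ge\ \frac{2^{md}-1}{2(2^{2m}-1)^2(2^m+1)^{4(d-1)}}.$$ Tensor products of single-qubit pure states and the completely mixed state satisfy these inequalities. * If $\rho_0$ is a tensor product of single-qubit pure states, then $$\mathrm{Var}[k]\ \ge\ \frac{2^{2md}(2^{md}-1)}{2(2^{2m}-1)^2(2^m+1)^{4(d-1)}}.$$ The bounds do not involve $n$. In particular there is no exponential decay in $n$ for shallow circuits: for all $m\ge1$ and $c>0$ there is an integer $C\ge0$ such that, for all $n\ge2$ and $1\le d\le c\log n$, $$\frac{2^{md}-1}{2(2^{2m}-1)^2(2^m+1)^{4(d-1)}}\ge n^{-C}.$$ -/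

import Mathlib

open MeasureTheory ProbabilityTheory Filter Asymptotics
open scoped Matrix ComplexOrder

/-! ### Operators on `n` qubits, in the computational basis -/

/-- Operators on `n` qubits; the computational basis is indexed by bit strings `Fin n → Fin 2`. -/
abbrev QMatrix (n : ℕ) : Type := Matrix (Fin n → Fin 2) (Fin n → Fin 2) ℂ

/-- Unitary operators on `n` qubits. -/
abbrev QUnitary (n : ℕ) : Type := Matrix.unitaryGroup (Fin n → Fin 2) ℂ

/-- Density matrices. -/
def IsDensityMatrix {n : ℕ} (ρ : QMatrix n) : Prop :=
  ρ.PosSemidef ∧ ρ.trace = 1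

/-- Pure states `|ψ⟩⟨ψ|` with `ψ` a unit vector. -/
def IsPureState {n : ℕ} (ρ : QMatrix n) : Prop :=
  ∃ ψ : (Fin n → Fin 2) → ℂ, star ψ ⬝ᵥ ψ = 1 ∧ ρ = Matrix.vecMulVec ψ (star ψ)

/-- Tensor products of `n` single-qubit pure states. -/
def IsProductPureState {n : ℕ} (ρ : QMatrix n) : Prop :=
  ∃ φ : Fin n → Fin 2 → ℂ, (∀ q, star (φ q) ⬝ᵥ φ q = 1) ∧
    ρ = Matrix.vecMulVec (fun x => ∏ q, φ q (x q)) (star fun x => ∏ q, φ q (x q))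

/-- The completely mixed state. -/
noncomputable def completelyMixed (n : ℕ) : QMatrix n := ((2 : ℂ) ^ n)⁻¹ • 1

/-- The bit string that equals `a` on `h` and `c` off `h`. -/
def glue {n : ℕ} (h : Finset (Fin n)) (a : h → Fin 2) (c : ↥hᶜ → Fin 2) : Fin n → Fin 2 :=
  fun q => if hq : q ∈ h then a ⟨q, hq⟩ else c ⟨q, Finset.mem_compl.mpr hq⟩

/-- The reduced operator on the qubits in `h`: partial trace over the complement of `h`. -/
noncomputable def reduced {n : ℕ} (ρ : QMatrix n) (h : Finset (Fin n)) :
    Matrix (h → Fin 2) (h → Fin 2) ℂ :=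
  fun a b => ∑ c : ↥hᶜ → Fin 2, ρ (glue h a c) (glue h b c)

/-- The purity `Tr[(Tr_{h̄} ρ)²]` of the reduced state on `h`. -/
noncomputable def purity {n : ℕ} (ρ : QMatrix n) (h : Finset (Fin n)) : ℝ :=
  (Matrix.trace (reduced ρ h * reduced ρ h)).re

/-- Labels of the three Pauli operators. -/
inductive Pauli : Type
  | X : Pauli
  | Y : Pauli
  | Z : Pauli

/-- The Pauli matrices. -/
noncomputable def Pauli.mat : Pauli → Matrix (Fin 2) (Fin 2) ℂ
  | .X => !![0, 1; 1, 0]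
  | .Y => !![0, -Complex.I; Complex.I, 0]
  | .Z => !![1, 0; 0, -1]

/-- The Pauli operator `σ` on qubit `q`, tensored with the identity on the other qubits. -/
noncomputable def pauliOn {n : ℕ} (q : Fin n) (σ : Pauli) : QMatrix n :=
  fun x y => if ∀ r, r ≠ q → x r = y r then σ.mat (x q) (y q) else 0

/-- The operator `W` on `r` qubits acting on the qubits `e 0, …, e (r-1)` out of `n` (`e` injective),
tensored with the identity on the other qubits. -/
noncomputable def localOp {r n : ℕ} (e : Fin r → Fin n) (W : QMatrix r) : QMatrix n :=
  fun x y => if ∀ q, (∀ j, e j ≠ q) → x q = y q then W (x ∘ e) (y ∘ e) else 0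

/-! ### Unitary designs -/

noncomputable instance unitaryGroup_measurableSpace (ι : Type*) [Fintype ι] [DecidableEq ι] :
    MeasurableSpace (Matrix.unitaryGroup ι ℂ) := borel _

instance unitaryGroup_borelSpace (ι : Type*) [Fintype ι] [DecidableEq ι] :
    BorelSpace (Matrix.unitaryGroup ι ℂ) := ⟨rfl⟩

instance unitaryGroup_compactSpace (ι : Type*) [Fintype ι] [DecidableEq ι] :
    CompactSpace (Matrix.unitaryGroup ι ℂ) := by
  suffices IsCompact (Matrix.unitaryGroup ι ℂ : Set (Matrix ι ι ℂ)) from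
    isCompact_iff_compactSpace.mp this
  have hK : IsCompact (Set.pi Set.univ fun _ : ι =>
      Set.pi Set.univ fun _ : ι => Metric.closedBall (0 : ℂ) 1) :=
    isCompact_univ_pi fun _ => isCompact_univ_pi fun _ => isCompact_closedBall 0 1
  refine IsCompact.of_isClosed_subset (t := (Matrix.unitaryGroup ι ℂ : Set (Matrix ι ι ℂ))) hK ?_ ?_
  · have : (Matrix.unitaryGroup ι ℂ : Set (Matrix ι ι ℂ)) = {A | A * star A = 1} := by
      ext A
      exact Matrix.mem_unitaryGroup_iff
    rw [this]
    exact isClosed_eq (continuous_id.mul continuous_star) continuous_const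
  · intro A hA i _ j _
    simpa using entry_norm_bound_of_unitary hA i j

/-- The Haar probability measure on the unitary group. -/
noncomputable def haarUnitary (ι : Type*) [Fintype ι] [DecidableEq ι] :
    Measure (Matrix.unitaryGroup ι ℂ) :=
  Measure.haarMeasure ⊤

/-- The tensor power `A^{⊗ t}`. -/
noncomputable def tensorPower {ι : Type*} (t : ℕ) (A : Matrix ι ι ℂ) : Matrix (Fin t → ι) (Fin t → ι) ℂ :=
  fun a b => ∏ s, A (a s) (b s)

/-- An ensemble of unitaries with law `μ` is a `t`-design if
`E_μ[W^{⊗t} X (W†)^{⊗t}] = ∫ W^{⊗t} X (W†)^{⊗t} dHaar` for every operator `X`;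
the matrix-valued integrals are taken entry by entry. -/
def IsUnitaryDesign {ι : Type*} [Fintype ι] [DecidableEq ι] (t : ℕ)
    (μ : Measure (Matrix.unitaryGroup ι ℂ)) : Prop :=
  ∀ (X : Matrix (Fin t → ι) (Fin t → ι) ℂ) (a b : Fin t → ι),
    ∫ W, (tensorPower t (W : Matrix ι ι ℂ) * X * (tensorPower t (W : Matrix ι ι ℂ))ᴴ) a b ∂μ =
    ∫ W, (tensorPower t (W : Matrix ι ι ℂ) * X * (tensorPower t (W : Matrix ι ι ℂ))ᴴ) a b
      ∂(haarUnitary ι)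

/-! ### The kernel -/

/-- `B̃ = U† B U`. -/
noncomputable def conjBy {n : ℕ} (U B : QMatrix n) : QMatrix n := Uᴴ * B * U

/-- The term `(1/2) Tr[ρ {B̃, B̃'}]` of the kernel, with `B̃ = U† B U` and `B̃' = U'† B U'`.
It is a real number for Hermitian `ρ` and `B`, see `aldTerm_eq`. -/
noncomputable def aldTerm {n : ℕ} (ρ B U U' : QMatrix n) : ℝ :=
  ((1 / 2 : ℂ) *
    Matrix.trace (ρ * (conjBy U B * conjBy U' B + conjBy U' B * conjBy U B))).re

theorem aldTerm_eq {n : ℕ} {ρ B : QMatrix n} (hρ : ρ.IsHermitian) (hB : B.IsHermitian)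
    (U U' : QMatrix n) :
    (aldTerm ρ B U U' : ℂ) = (1 / 2 : ℂ) *
      Matrix.trace (ρ * (conjBy U B * conjBy U' B + conjBy U' B * conjBy U B)) := by
  have h1 : ∀ V : QMatrix n, (conjBy V B)ᴴ = conjBy V B := fun V => by
    simp [conjBy, Matrix.conjTranspose_mul, hB.eq, Matrix.mul_assoc]
  have h2 : star (Matrix.trace (ρ * (conjBy U B * conjBy U' B + conjBy U' B * conjBy U B))) =
      Matrix.trace (ρ * (conjBy U B * conjBy U' B + conjBy U' B * conjBy U B)) := by
    rw [← Matrix.trace_conjTranspose, Matrix.conjTranspose_mul, Matrix.conjTranspose_add,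
      Matrix.conjTranspose_mul, Matrix.conjTranspose_mul, h1, h1, hρ.eq, Matrix.trace_mul_comm,
      add_comm]
  unfold aldTerm
  apply Complex.conj_eq_iff_re.mp
  rw [map_mul]
  exact congrArg₂ (· * ·) (by rw [map_div₀, map_one, map_ofNat]) h2

/-! ### The alternating layered ansatz

There are `n = m * κ` qubits. Layers are numbered from `1`. Layer `l` consists of consecutive
`m`-qubit blocks, starting at qubit `0` in odd layers and at qubit `m / 2` in even layers, so that
a block overlaps each of two neighbouring blocks of the previous layer in `m / 2` qubits. For `m = 1`
all offsets vanish and the circuit is a tensor-product circuit. -/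

/-- What happens at the ends of the qubit array in the shifted layers: with `periodic` boundary the
last block of a shifted layer wraps around, so that every layer has exactly `κ` blocks; with `free`
boundary that block is absent. -/
inductive Boundary : Type
  | free : Boundary
  | periodic : Boundary

def layerOffset (m l : ℕ) : ℕ := if Odd l then 0 else m / 2

/-- The qubits (in order) on which block `k` of layer `l` acts. -/
def blockWire (m κ l : ℕ) (k : Fin κ) (j : Fin m) : Fin (m * κ) :=
  ⟨(layerOffset m l + k * m + j) % (m * κ), Nat.mod_lt _ (Nat.mul_pos j.pos k.pos)⟩

/-- The set of qubits on which block `k` of layer `l` acts. -/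
def blockSupport (m κ l : ℕ) (k : Fin κ) : Finset (Fin (m * κ)) :=
  Finset.univ.image (blockWire m κ l k)

/-- Whether layer `l` has a block number `k`. -/
def HasBlock (bc : Boundary) (m κ l : ℕ) (k : Fin κ) : Prop :=
  match bc with
  | .periodic => True
  | .free => layerOffset m l + k * m + m ≤ m * κ

open Classical in
/-- The operator of layer `l`, whose block `k` is `W k`. -/
noncomputable def layerOp (bc : Boundary) (m κ l : ℕ) (W : Fin κ → QUnitary m) : QMatrix (m * κ) :=
  (List.ofFn fun k : Fin κ =>
    if HasBlock bc m κ l k then localOp (blockWire m κ l k) (W k : QMatrix m) else 1).prod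

/-- The unitaries out of which the part `U_{1:i}` of the circuit is built: the blocks `W_{k,l}` of
the layers, and the truncated block `W̃_{k,d}` that ends with the gate of the `i`-th parameter. -/
inductive Piece (κ : ℕ) : Type
  | block (l : ℕ) (k : Fin κ) : Piece κ
  | truncated : Piece κ

/-- The product of the layers `1, …, l` (layer `1` acts first). -/
noncomputable def layersOp (bc : Boundary) (m κ : ℕ) (W : Piece κ → QUnitary m) :
    ℕ → QMatrix (m * κ)
  | 0 => 1
  | l + 1 => layerOp bc m κ (l + 1) (fun k => W (.block (l + 1) k)) * layersOp bc m κ W l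

/-- `U_{1:i}` for a parameter in block `k` of layer `d`: all layers before layer `d`, followed by the
truncated block. -/
noncomputable def circuitUpTo (bc : Boundary) (m κ d : ℕ) (k : Fin κ) (W : Piece κ → QUnitary m) :
    QMatrix (m * κ) :=
  localOp (blockWire m κ d k) (W .truncated : QMatrix m) * layersOp bc m κ W (d - 1)

/-- `InLightCone bc m κ d k l k'`: block `k'` of layer `l` is in the (backward) light cone of
block `k` of layer `d`. -/
inductive InLightCone (bc : Boundary) (m κ d : ℕ) (k : Fin κ) : ℕ → Fin κ → Prop
  | self : InLightCone bc m κ d k d k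
  | step {l₂ l : ℕ} {k₂ k' : Fin κ} : InLightCone bc m κ d k l₂ k₂ → 1 ≤ l → l < l₂ →
      HasBlock bc m κ l k' → ¬ Disjoint (blockSupport m κ l k') (blockSupport m κ l₂ k₂) →
      InLightCone bc m κ d k l k'

/-- The pieces of `U_{1:i}` that matter: the truncated block and the blocks of the layers before
layer `d` in the light cone. -/
def conePieces (bc : Boundary) (m κ d : ℕ) (k : Fin κ) : Set (Piece κ) :=
  {a | a = .truncated ∨ ∃ l k', a = .block l k' ∧ l < d ∧ InLightCone bc m κ d k l k'}

/-- The union of the supports of the first-layer blocks in `A`. -/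
def firstLayerRegion (m κ : ℕ) (A : Finset (Fin κ)) : Finset (Fin (m * κ)) :=
  A.biUnion (blockSupport m κ 1)

/-- The purity-product assumption on the initial state: for all unions `h`, `h'` of supports of
first-layer blocks in the light cone of block `k` of layer `d`, the purities of the reduced
states on `(h ∪ h') \ (h ∩ h')` and on `h ∪ h'` are at least the product of those on `h` and `h'`. -/
def PurityProduct (bc : Boundary) (m κ d : ℕ) (k : Fin κ) (ρ : QMatrix (m * κ)) : Prop :=
  ∀ A A' : Finset (Fin κ),
    (∀ a ∈ A, InLightCone bc m κ d k 1 a) → (∀ a ∈ A', InLightCone bc m κ d k 1 a) →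
    purity ρ (firstLayerRegion m κ A) * purity ρ (firstLayerRegion m κ A') ≤
        purity ρ ((firstLayerRegion m κ A ∪ firstLayerRegion m κ A') \
          (firstLayerRegion m κ A ∩ firstLayerRegion m κ A')) ∧
      purity ρ (firstLayerRegion m κ A) * purity ρ (firstLayerRegion m κ A') ≤
        purity ρ (firstLayerRegion m κ A ∪ firstLayerRegion m κ A')

/-!
The variance of the kernel term `k = (1/2) Tr[ρ {B̃, B̃'}]` is a quadratic function of the second
moments `M = 𝔼[B̃ ⊗ B̃]` and `M' = 𝔼[B̃' ⊗ B̃']`, because the two circuits are independent, and its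
mean vanishes because `𝔼[B̃]` does. So everything rests on `M`.

*Averaging over one gate.* The Haar average of `(V ⊗ V)† X (V ⊗ V)` commutes with all tensor squares
`u ⊗ u` of unitaries. Testing this against diagonal unitaries, permutations and one real reflection
shows that such a matrix is a combination of `1` and `SWAP` (`exists_eq_of_commute`), and the traces
of `X` and `SWAP * X` determine the coefficients (`twirl`). For a gate on all qubits, and for the
truncated block, this gives `M` in terms of `1` and the swap of the support. For partial swaps
`swapOn h` (exchange the two copies of the qubits in `h`), averaging over a gate with support `β`
replaces `h` by `h \ β` or `h ∪ β` with nonnegative weights `keepCoef` and `fillCoef` that depend on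
`|h ∩ β|` only (`expMat_conj_localOp_swapOn`). Hence `M = ∑ c_h swapOn h` throughout,
with the same real coefficients for both inputs.

*Variance.* For `M = M' = ∑ c_h swapOn h`,
`Var[k] = (1/2) ∑ c_h c_h' (P_{hΔh'} + 2^|h ∩ h'| P_{h ∪ h'})`, with `P` the purities of `ρ`
(`variance_aldTerm`). For circuits on all qubits only `∅` and the set of all qubits occur.

*Lower bounds.* In the ansatz all `c_h` with `h ≠ ∅` are nonnegative, and the `h` that occur after
the first layer are unions of supports of first-layer blocks in the light cone. If the purities are
supermultiplicative, each summand with `h` and `h'` nonempty is at least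
`c_h c_h' P_h P_h' (2 + (2^|h ∩ h'| - 1))`; the pairs with `∅`, whose coefficient may be negative,
satisfy this with equality. The first parts add up to `2 (∑ c_h P_h)^2 ≥ 0`, and so a single set `h`
is enough for a lower bound `(1/2) c_h^2 (2^|h| - 1) P_h^2` (`le_sum_of_purity_mul_le`). That set is
followed through the circuit (`LayerInv`): at first it is the support of the truncated block, and it
is enlarged by every block that it meets. It remains a union of half blocks, and so it meets a block
in nothing, in one half or in everything; each half block that it gains costs at most a factor
`halfCoef m` in the coefficient. It stays within a window that grows by half a block at each side
per layer, and it is largest, with the smallest bound, if it fills the window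
(`LayerInv.exists_large`).

Moments are matrices of integrals (`expMat`) of bounded measurable matrix functions
(`MatBddMeas`); independence of a gate from the rest of the circuit enters through
`expMat_sandwich`.
-/

open scoped Kronecker

/-! ### Bounded random matrices and their expectations -/

/-- A bounded complex random variable that is measurable with respect to the sub-σ-algebra `m`. -/
def BddMeas {Ω : Type*} (m : MeasurableSpace Ω) (f : Ω → ℂ) : Prop :=
  Measurable[m] f ∧ ∃ C : ℝ, ∀ ω, ‖f ω‖ ≤ C

namespace BddMeas

variable {Ω : Type*} {m : MeasurableSpace Ω} {f g : Ω → ℂ}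

theorem const (c : ℂ) : BddMeas m fun _ : Ω => c :=
  ⟨@measurable_const _ _ _ m c, ‖c‖, fun _ => le_rfl⟩

theorem add (hf : BddMeas m f) (hg : BddMeas m g) : BddMeas m fun ω => f ω + g ω := by
  obtain ⟨hf, C, hC⟩ := hf
  obtain ⟨hg, D, hD⟩ := hg
  exact ⟨hf.add hg, C + D, fun ω => (norm_add_le _ _).trans (add_le_add (hC ω) (hD ω))⟩

theorem mul (hf : BddMeas m f) (hg : BddMeas m g) : BddMeas m fun ω => f ω * g ω := by
  obtain ⟨hf, C, hC⟩ := hf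
  obtain ⟨hg, D, hD⟩ := hg
  refine ⟨hf.mul hg, C * D, fun ω => ?_⟩
  rw [norm_mul]
  exact mul_le_mul (hC ω) (hD ω) (norm_nonneg _) ((norm_nonneg _).trans (hC ω))

theorem star (hf : BddMeas m f) : BddMeas m fun ω => star (f ω) := by
  obtain ⟨hf, C, hC⟩ := hf
  exact ⟨continuous_star.measurable.comp hf, C, fun ω => by simpa using hC ω⟩

theorem sum {ι : Type*} {s : Finset ι} {F : ι → Ω → ℂ} (h : ∀ i ∈ s, BddMeas m (F i)) :
    BddMeas m fun ω => ∑ i ∈ s, F i ω := by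
  classical
  induction s using Finset.induction_on with
  | empty => simpa using const 0
  | insert a s ha ih =>
    simp only [Finset.sum_insert ha]
    exact (h a (Finset.mem_insert_self a s)).add
      (ih fun i hi => h i (Finset.mem_insert_of_mem hi))

theorem mono {m' : MeasurableSpace Ω} (hm : m ≤ m') (hf : BddMeas m f) : BddMeas m' f :=
  ⟨hf.1.mono hm le_rfl, hf.2⟩

theorem memLp {P : Measure Ω} [IsFiniteMeasure P] (hf : BddMeas m f) (p : ENNReal) :
    MemLp f p P := by
  obtain ⟨hf, C, hC⟩ := hf
  exact MemLp.of_bound hf.aestronglyMeasurable C (ae_of_all _ hC)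

theorem integrable {P : Measure Ω} [IsFiniteMeasure P] (hf : BddMeas m f) : Integrable f P :=
  memLp_one_iff_integrable.mp (hf.memLp 1)

end BddMeas

/-- Random variables that are measurable with respect to independent σ-algebras have
multiplicative expectation. -/
theorem integral_mul_of_indep {Ω : Type*} [mΩ : MeasurableSpace Ω] {P : Measure Ω}
    [IsProbabilityMeasure P] {m₁ m₂ : MeasurableSpace Ω} (h₁ : m₁ ≤ mΩ) (h₂ : m₂ ≤ mΩ)
    (hind : Indep m₁ m₂ P) {f g : Ω → ℂ} (hf : BddMeas m₁ f) (hg : BddMeas m₂ g) :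
    ∫ ω, f ω * g ω ∂P = (∫ ω, f ω ∂P) * ∫ ω, g ω ∂P := by
  have hfg : IndepFun f g P :=
    indep_of_indep_of_le_left (indep_of_indep_of_le_right hind hg.1.comap_le) hf.1.comap_le
  exact hfg.integral_fun_mul_eq_mul_integral
    (hf.mono h₁).1.aestronglyMeasurable (hg.mono h₂).1.aestronglyMeasurable

/-- A random matrix all of whose entries are bounded and measurable with respect to `m`. -/
def MatBddMeas {Ω α β : Type*} (m : MeasurableSpace Ω) (A : Ω → Matrix α β ℂ) : Prop :=
  ∀ i j, BddMeas m fun ω => A ω i j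

namespace MatBddMeas

variable {Ω α β γ : Type*} {m : MeasurableSpace Ω}

theorem const (A : Matrix α β ℂ) : MatBddMeas m fun _ : Ω => A := fun _ _ => .const _

theorem add {A B : Ω → Matrix α β ℂ} (hA : MatBddMeas m A) (hB : MatBddMeas m B) :
    MatBddMeas m fun ω => A ω + B ω := fun i j => (hA i j).add (hB i j)

theorem mul [Fintype β] {A : Ω → Matrix α β ℂ} {B : Ω → Matrix β γ ℂ} (hA : MatBddMeas m A)
    (hB : MatBddMeas m B) : MatBddMeas m fun ω => A ω * B ω := fun i j => by
  simp only [Matrix.mul_apply]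
  exact .sum fun k _ => (hA i k).mul (hB k j)

theorem conjTranspose {A : Ω → Matrix α β ℂ} (hA : MatBddMeas m A) :
    MatBddMeas m fun ω => (A ω)ᴴ := fun i j => (hA j i).star

theorem kronecker {α' β' : Type*} {A : Ω → Matrix α β ℂ} {B : Ω → Matrix α' β' ℂ}
    (hA : MatBddMeas m A) (hB : MatBddMeas m B) : MatBddMeas m fun ω => A ω ⊗ₖ B ω :=
  fun i j => (hA i.1 j.1).mul (hB i.2 j.2)

theorem mono {m' : MeasurableSpace Ω} (hm : m ≤ m') {A : Ω → Matrix α β ℂ}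
    (hA : MatBddMeas m A) : MatBddMeas m' A := fun i j => (hA i j).mono hm

theorem trace [Fintype α] {A : Ω → Matrix α α ℂ} (hA : MatBddMeas m A) :
    BddMeas m fun ω => (A ω).trace := .sum fun i _ => hA i i

theorem conjBy {n : ℕ} {U B : Ω → QMatrix n} (hU : MatBddMeas m U) (hB : MatBddMeas m B) :
    MatBddMeas m fun ω => conjBy (U ω) (B ω) := (hU.conjTranspose.mul hB).mul hU

/-- A measurable random unitary has bounded measurable entries. -/
theorem of_unitary {ι : Type*} [Fintype ι] [DecidableEq ι] {U : Ω → Matrix.unitaryGroup ι ℂ}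
    (hU : Measurable[m] U) : MatBddMeas m fun ω => (U ω : Matrix ι ι ℂ) := fun i j => by
  have hc : Continuous fun V : Matrix.unitaryGroup ι ℂ => (V : Matrix ι ι ℂ) i j :=
    (continuous_subtype_val.matrix_elem i j)
  exact ⟨hc.measurable.comp hU, 1, fun ω => entry_norm_bound_of_unitary (U ω).2 i j⟩

end MatBddMeas

/-- The expectation of a random matrix, taken entry by entry. -/
noncomputable def expMat {Ω α β : Type*} [MeasurableSpace Ω] (P : Measure Ω)
    (A : Ω → Matrix α β ℂ) : Matrix α β ℂ := fun i j => ∫ ω, A ω i j ∂P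

section expMat

variable {Ω : Type*} {m₁ m₂ : MeasurableSpace Ω} [mΩ : MeasurableSpace Ω] {P : Measure Ω}
  [IsProbabilityMeasure P] {α β : Type*}

theorem expMat_const (A : Matrix α β ℂ) : expMat P (fun _ => A) = A := by
  ext i j
  simp [expMat]

variable [Fintype α]

theorem expMat_sandwich_apply (h₁ : m₁ ≤ mΩ) (h₂ : m₂ ≤ mΩ)
    (hind : Indep m₁ m₂ P) {C : Ω → Matrix α β ℂ} {N : Ω → Matrix α α ℂ}
    (hC : MatBddMeas m₁ C) (hN : MatBddMeas m₂ N) (a b : β) :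
    expMat P (fun ω => (C ω)ᴴ * N ω * C ω) a b =
      ∑ j, ∑ i, (∫ ω, star (C ω i a) * C ω j b ∂P) * expMat P N i j := by
  have hb : ∀ i j, BddMeas m₁ fun ω => star (C ω i a) * C ω j b :=
    fun i j => (hC i a).star.mul (hC j b)
  have hbN : ∀ i j, BddMeas mΩ fun ω => (star (C ω i a) * C ω j b) * N ω i j :=
    fun i j => ((hb i j).mono h₁).mul ((hN i j).mono h₂)
  have hexp : ∀ ω, ((C ω)ᴴ * N ω * C ω) a b =
      ∑ j, ∑ i, (star (C ω i a) * C ω j b) * N ω i j := fun ω => by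
    simp only [Matrix.mul_apply, Matrix.conjTranspose_apply, Finset.sum_mul]
    exact Finset.sum_congr rfl fun j _ => Finset.sum_congr rfl fun i _ => by ring
  simp only [expMat, hexp]
  rw [integral_finsetSum _ fun j _ => (BddMeas.sum fun i _ => hbN i j).integrable]
  refine Finset.sum_congr rfl fun j _ => ?_
  rw [integral_finsetSum _ fun i _ => (hbN i j).integrable]
  exact Finset.sum_congr rfl fun i _ => integral_mul_of_indep h₁ h₂ hind (hb i j) (hN i j)

theorem expMat_sandwich_const_apply {C : Ω → Matrix α β ℂ} (hC : MatBddMeas mΩ C)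
    (X : Matrix α α ℂ) (a b : β) :
    expMat P (fun ω => (C ω)ᴴ * X * C ω) a b =
      ∑ j, ∑ i, (∫ ω, star (C ω i a) * C ω j b ∂P) * X i j := by
  rw [expMat_sandwich_apply le_rfl bot_le (indep_bot_right mΩ) hC (.const X), expMat_const]

/-- An independent middle factor may be replaced by its expectation. -/
theorem expMat_sandwich (h₁ : m₁ ≤ mΩ) (h₂ : m₂ ≤ mΩ)
    (hind : Indep m₁ m₂ P) {C : Ω → Matrix α β ℂ} {N : Ω → Matrix α α ℂ}
    (hC : MatBddMeas m₁ C) (hN : MatBddMeas m₂ N) :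
    expMat P (fun ω => (C ω)ᴴ * N ω * C ω) = expMat P (fun ω => (C ω)ᴴ * expMat P N * C ω) := by
  ext a b
  rw [expMat_sandwich_apply h₁ h₂ hind hC hN, expMat_sandwich_const_apply (hC.mono h₁)]

theorem expMat_const_mul_mul {A : Ω → Matrix α α ℂ} (hA : MatBddMeas mΩ A)
    (C D : Matrix α α ℂ) : expMat P (fun ω => C * A ω * D) = C * expMat P A * D := by
  ext a b
  simp only [expMat, Matrix.mul_apply, Finset.sum_mul]
  have h : ∀ i j, BddMeas mΩ fun ω => C a i * A ω i j * D j b :=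
    fun i j => ((BddMeas.const _).mul (hA i j)).mul (.const _)
  rw [integral_finsetSum _ fun j _ => (BddMeas.sum fun i _ => h i j).integrable]
  refine Finset.sum_congr rfl fun j _ => ?_
  rw [integral_finsetSum _ fun i _ => (h i j).integrable]
  refine Finset.sum_congr rfl fun i _ => ?_
  rw [integral_mul_const, integral_const_mul]

theorem trace_expMat {A : Ω → Matrix α α ℂ} (hA : MatBddMeas mΩ A) :
    (expMat P A).trace = ∫ ω, (A ω).trace ∂P :=
  (integral_finsetSum _ fun i _ => (hA i i).integrable).symm

end expMat

/-! ### Second moments of the Haar measure and of unitary 2-designs -/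

/-- The operator on `ℂ^ι ⊗ ℂ^ι` that exchanges the two tensor factors. -/
def swapMat (ι : Type*) [DecidableEq ι] : Matrix (ι × ι) (ι × ι) ℂ :=
  fun a b => if a.1 = b.2 ∧ a.2 = b.1 then 1 else 0

section commutant

variable {ι : Type*} [Fintype ι] [DecidableEq ι]

theorem swapMat_mul_apply (A : Matrix (ι × ι) (ι × ι) ℂ) (a b : ι × ι) :
    (swapMat ι * A) a b = A (a.2, a.1) b := by
  simp [Matrix.mul_apply, swapMat, Fintype.sum_prod_type, ite_and]

theorem mul_swapMat_apply (A : Matrix (ι × ι) (ι × ι) ℂ) (a b : ι × ι) :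
    (A * swapMat ι) a b = A a (b.2, b.1) := by
  simp [Matrix.mul_apply, swapMat, Fintype.sum_prod_type, ite_and]

theorem swapMat_mul_self : swapMat ι * swapMat ι = 1 := by
  ext a b
  rw [swapMat_mul_apply]
  simp [swapMat, Matrix.one_apply, Prod.ext_iff, and_comm]

theorem swapMat_mul_kronecker (A B : Matrix ι ι ℂ) :
    swapMat ι * (A ⊗ₖ B) = (B ⊗ₖ A) * swapMat ι := by
  ext a b
  rw [swapMat_mul_apply, mul_swapMat_apply]
  simp [Matrix.kroneckerMap_apply, mul_comm]

theorem trace_swapMat : (swapMat ι).trace = Fintype.card ι := by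
  simp only [Matrix.trace, swapMat, Matrix.diag_apply, Fintype.sum_prod_type, ite_and]
  simp

/-- Commuting with `V ⊗ V` for all diagonal unitaries `V` leaves only the matrix entries of the
identity and of the swap. -/
theorem apply_eq_zero_of_commute_diagonal {N : Matrix (ι × ι) (ι × ι) ℂ}
    (hN : ∀ V ∈ Matrix.unitaryGroup ι ℂ, (V ⊗ₖ V) * N = N * (V ⊗ₖ V)) {p q r s : ι}
    (h₁ : ¬(r = p ∧ s = q)) (h₂ : ¬(r = q ∧ s = p)) : N (p, q) (r, s) = 0 := by
  by_contra hne
  have key : ∀ x : ι, (if p = x then Complex.I else 1) * (if q = x then Complex.I else 1) =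
      (if r = x then Complex.I else 1) * (if s = x then Complex.I else 1) := fun x => by
    have hV : Matrix.diagonal (fun y : ι => if y = x then Complex.I else 1) ∈
        Matrix.unitaryGroup ι ℂ := by
      rw [Matrix.mem_unitaryGroup_iff, Matrix.star_eq_conjTranspose,
        Matrix.diagonal_conjTranspose, Matrix.diagonal_mul_diagonal, ← Matrix.diagonal_one]
      congr 1
      ext y
      by_cases hy : y = x <;> simp [hy]
    have h := congrFun (congrFun (hN _ hV) (p, q)) (r, s)
    rw [Matrix.diagonal_kronecker_diagonal, Matrix.diagonal_mul, Matrix.mul_diagonal,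
      mul_comm] at h
    exact mul_left_cancel₀ hne h
  have hI : Complex.I ≠ 1 := fun h => by simpa using congrArg Complex.re h
  have hI' : (-1 : ℂ) ≠ Complex.I := fun h => by simpa using congrArg Complex.re h
  have hI'' : (-1 : ℂ) ≠ 1 := by norm_num
  have kp := key p
  have kq := key q
  by_cases hpq : p = q
  · subst hpq
    by_cases hr : r = p <;> by_cases hs : s = p <;> simp_all
  · have hqp : q ≠ p := fun h => hpq h.symm
    rw [if_pos rfl, if_neg hqp, mul_one] at kp
    rw [if_pos rfl, if_neg hpq, one_mul] at kq
    have kp' : r = p ∨ s = p := by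
      by_contra! hcon
      rw [if_neg hcon.1, if_neg hcon.2, mul_one] at kp
      exact hI kp
    have kq' : r = q ∨ s = q := by
      by_contra! hcon
      rw [if_neg hcon.1, if_neg hcon.2, mul_one] at kq
      exact hI kq
    rcases kp' with rfl | rfl
    · exact h₁ ⟨rfl, kq'.resolve_left hpq⟩
    · exact h₂ ⟨kq'.resolve_right hpq, rfl⟩

theorem apply_perm_of_commute {N : Matrix (ι × ι) (ι × ι) ℂ}
    (hN : ∀ V ∈ Matrix.unitaryGroup ι ℂ, (V ⊗ₖ V) * N = N * (V ⊗ₖ V)) (σ : Equiv.Perm ι)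
    (p q r s : ι) : N (σ p, σ q) (σ r, σ s) = N (p, q) (r, s) := by
  have hV : (Matrix.of fun i j => if σ i = j then (1 : ℂ) else 0) ∈ Matrix.unitaryGroup ι ℂ := by
    rw [Matrix.mem_unitaryGroup_iff]
    ext i j
    simp [Matrix.mul_apply, Matrix.star_apply, Matrix.one_apply, apply_ite, eq_comm]
  have h := congrFun (congrFun (hN _ hV) (p, q)) (σ r, σ s)
  simpa [Matrix.mul_apply, Fintype.sum_prod_type, Matrix.kroneckerMap_apply] using h

/-- A reflection that mixes two basis vectors links the entry at `(a, a)` with those at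
`(a, b)`. -/
theorem apply_diag_of_commute {N : Matrix (ι × ι) (ι × ι) ℂ}
    (hN : ∀ V ∈ Matrix.unitaryGroup ι ℂ, (V ⊗ₖ V) * N = N * (V ⊗ₖ V)) {a b : ι} (hab : a ≠ b) :
    N (a, a) (a, a) = N (a, b) (a, b) + N (b, a) (a, b) := by
  -- the reflection in the hyperplane orthogonal to `e_a + 2 e_b`
  set u : ι → ℂ := fun x => if x = a then 1 else if x = b then 2 else 0 with hu
  set V : Matrix ι ι ℂ := 1 - (2 / 5 : ℂ) • Matrix.vecMulVec u u with hVdef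
  have huu : u ⬝ᵥ u = 5 := by
    have h : ∀ x, u x * u x = (if x = a then 1 else 0) + (if x = b then 4 else 0) := fun x => by
      by_cases h1 : x = a
      · subst h1
        simp [hu, hab]
      · by_cases h2 : x = b
        · simp [hu, h2, hab.symm]
          norm_num
        · simp [hu, h1, h2]
    simp only [dotProduct, h, Finset.sum_add_distrib, Finset.sum_ite_eq', Finset.mem_univ, if_true]
    norm_num
  have hVstar : star V = V := by
    ext x y
    have hs : ∀ z, star (u z) = u z := fun z => by
      simp only [hu]
      split_ifs <;> simp
    have h25 : star (2 / 5 : ℂ) = 2 / 5 := by simp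
    simp only [hVdef, Matrix.star_apply, Matrix.sub_apply, Matrix.smul_apply,
      Matrix.vecMulVec_apply, star_sub, smul_eq_mul, star_mul', hs, h25, Matrix.one_apply]
    rw [mul_comm (u y) (u x)]
    congr 1
    by_cases h : x = y
    · simp [h]
    · simp [h, Ne.symm h]
  have hV : V ∈ Matrix.unitaryGroup ι ℂ := by
    rw [Matrix.mem_unitaryGroup_iff, hVstar, hVdef, Matrix.sub_mul, Matrix.mul_sub, Matrix.mul_sub]
    simp only [Matrix.smul_mul, Matrix.mul_smul, Matrix.vecMulVec_mul_vecMulVec, huu,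
      Matrix.one_mul, Matrix.mul_one, smul_smul, Matrix.vecMulVec_smul]
    module
  have h := congrFun (congrFun (hN _ hV) (a, a)) (a, b)
  have e₁ : ((V ⊗ₖ V) * N) (a, a) (a, b) =
      V a a * V a b * N (a, b) (a, b) + V a b * V a a * N (b, a) (a, b) := by
    rw [Matrix.mul_apply, Finset.sum_eq_add (a, b) (b, a)]
    · rfl
    · simp [hab]
    · rintro ⟨x, y⟩ - ⟨h1, h2⟩
      rw [apply_eq_zero_of_commute_diagonal hN, mul_zero]
      · rintro ⟨rfl, rfl⟩
        exact h1 rfl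
      · rintro ⟨rfl, rfl⟩
        exact h2 rfl
    · simp
    · simp
  have e₂ : (N * (V ⊗ₖ V)) (a, a) (a, b) = N (a, a) (a, a) * (V a a * V a b) := by
    rw [Matrix.mul_apply, Finset.sum_eq_single (a, a)]
    · rfl
    · rintro ⟨x, y⟩ - h1
      rw [apply_eq_zero_of_commute_diagonal hN, zero_mul]
      · rintro ⟨rfl, rfl⟩
        exact h1 rfl
      · rintro ⟨rfl, rfl⟩
        exact h1 rfl
    · simp
  have haa : V a a = 3 / 5 := by
    simp [hVdef, hu, Matrix.vecMulVec_apply]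
    norm_num
  have hb : V a b = -4 / 5 := by
    simp [hVdef, hu, Matrix.vecMulVec_apply, hab, hab.symm]
    norm_num
  rw [e₁, e₂, haa, hb] at h
  linear_combination (25 / 12 : ℂ) * h

omit [Fintype ι] in
theorem exists_perm_apply_eq {a b p q : ι} (hab : a ≠ b) (hpq : p ≠ q) :
    ∃ σ : Equiv.Perm ι, σ a = p ∧ σ b = q := by
  have h1 : p ≠ Equiv.swap a p b := fun h => by
    have := congrArg (Equiv.swap a p) h
    rw [Equiv.swap_apply_right, Equiv.swap_apply_self] at this
    exact hab this
  refine ⟨Equiv.swap (Equiv.swap a p b) q * Equiv.swap a p, ?_, ?_⟩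
  · rw [Equiv.Perm.mul_apply, Equiv.swap_apply_left, Equiv.swap_apply_of_ne_of_ne h1 hpq]
  · rw [Equiv.Perm.mul_apply, Equiv.swap_apply_left]

/-- The commutant of `{V ⊗ V | V unitary}` is spanned by the identity and the swap. -/
theorem exists_eq_of_commute [Nontrivial ι] {N : Matrix (ι × ι) (ι × ι) ℂ}
    (hN : ∀ V ∈ Matrix.unitaryGroup ι ℂ, (V ⊗ₖ V) * N = N * (V ⊗ₖ V)) :
    ∃ α β : ℂ, N = α • 1 + β • swapMat ι := by
  obtain ⟨a, b, hab⟩ := exists_pair_ne ι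
  have hα : ∀ p q, p ≠ q → N (p, q) (p, q) = N (a, b) (a, b) := fun p q hpq => by
    obtain ⟨σ, rfl, rfl⟩ := exists_perm_apply_eq hab hpq
    exact apply_perm_of_commute hN σ _ _ _ _
  have hβ : ∀ p q, p ≠ q → N (p, q) (q, p) = N (a, b) (b, a) := fun p q hpq => by
    obtain ⟨σ, rfl, rfl⟩ := exists_perm_apply_eq hab hpq
    exact apply_perm_of_commute hN σ _ _ _ _
  refine ⟨N (a, b) (a, b), N (a, b) (b, a), ?_⟩
  ext ⟨p, q⟩ ⟨r, s⟩
  simp only [Matrix.add_apply, Matrix.smul_apply, Matrix.one_apply, swapMat, smul_eq_mul,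
    Prod.mk.injEq]
  by_cases h₁ : r = p ∧ s = q
  · obtain ⟨rfl, rfl⟩ := h₁
    by_cases hrs : r = s
    · subst hrs
      obtain ⟨c, hc⟩ := exists_ne r
      rw [apply_diag_of_commute hN hc.symm, hα r c hc.symm, hβ c r hc]
      simp
    · rw [hα r s hrs]
      simp [hrs]
  · by_cases h₂ : r = q ∧ s = p
    · obtain ⟨rfl, rfl⟩ := h₂
      have hrs : s ≠ r := fun h => h₁ ⟨h.symm, h⟩
      rw [hβ s r hrs]
      simp [hrs]
    · rw [apply_eq_zero_of_commute_diagonal hN h₁ h₂, if_neg, if_neg]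
      · simp
      · rintro ⟨rfl, rfl⟩
        exact h₂ ⟨rfl, rfl⟩
      · rintro ⟨rfl, rfl⟩
        exact h₁ ⟨rfl, rfl⟩

end commutant

section twirl

variable {ι : Type*} [Fintype ι] [DecidableEq ι]

instance haarUnitary_isProbabilityMeasure : IsProbabilityMeasure (haarUnitary ι) :=
  ⟨Measure.haarMeasure_self (K₀ := ⊤)⟩

instance haarUnitary_isHaarMeasure : (haarUnitary ι).IsHaarMeasure := by
  unfold haarUnitary
  infer_instance

/-- The Haar measure of the compact group of unitaries is also invariant under right
translations. -/
theorem map_mul_right_haarUnitary (V : Matrix.unitaryGroup ι ℂ) :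
    (haarUnitary ι).map (· * V) = haarUnitary ι := by
  have : IsProbabilityMeasure ((haarUnitary ι).map (· * V)) :=
    Measure.isProbabilityMeasure_map (measurable_mul_const V).aemeasurable
  have : ((haarUnitary ι).map (· * V)).IsHaarMeasure :=
    Measure.isHaarMeasure_map_smul (haarUnitary ι) (MulOpposite.op V)
  exact Measure.isHaarMeasure_eq_of_isProbabilityMeasure _ _

/-- The value of the twofold twirl of `X`, in terms of `Tr X` and `Tr (S X)`. -/
noncomputable def twirl (X : Matrix (ι × ι) (ι × ι) ℂ) : Matrix (ι × ι) (ι × ι) ℂ :=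
  ((X.trace - (swapMat ι * X).trace / Fintype.card ι) / ((Fintype.card ι : ℂ) ^ 2 - 1)) • 1 +
    (((swapMat ι * X).trace - X.trace / Fintype.card ι) / ((Fintype.card ι : ℂ) ^ 2 - 1)) •
      swapMat ι

theorem kronecker_self_conjTranspose_mul {V : Matrix ι ι ℂ} (hV : V ∈ Matrix.unitaryGroup ι ℂ) :
    (V ⊗ₖ V)ᴴ * (V ⊗ₖ V) = 1 := by
  rw [Matrix.conjTranspose_kronecker, ← Matrix.mul_kronecker_mul, ← Matrix.star_eq_conjTranspose,
    Matrix.mem_unitaryGroup_iff'.mp hV, Matrix.one_kronecker_one]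

theorem kronecker_self_mul_conjTranspose {V : Matrix ι ι ℂ} (hV : V ∈ Matrix.unitaryGroup ι ℂ) :
    (V ⊗ₖ V) * (V ⊗ₖ V)ᴴ = 1 := by
  rw [Matrix.conjTranspose_kronecker, ← Matrix.mul_kronecker_mul, ← Matrix.star_eq_conjTranspose,
    Matrix.mem_unitaryGroup_iff.mp hV, Matrix.one_kronecker_one]

theorem matBddMeas_kronecker_self {Ω : Type*} {m : MeasurableSpace Ω}
    {W : Ω → Matrix.unitaryGroup ι ℂ} (hW : Measurable[m] W) :
    MatBddMeas m fun ω => (W ω : Matrix ι ι ℂ) ⊗ₖ (W ω : Matrix ι ι ℂ) :=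
  (MatBddMeas.of_unitary hW).kronecker (MatBddMeas.of_unitary hW)

/-- The Haar average commutes with every `V ⊗ V` by invariance, and conjugation by `V ⊗ V` preserves
`Tr X` and `Tr (S X)`; this determines it. -/
theorem expMat_haar [Nontrivial ι] (X : Matrix (ι × ι) (ι × ι) ℂ) :
    expMat (haarUnitary ι) (fun W => ((W : Matrix ι ι ℂ) ⊗ₖ (W : Matrix ι ι ℂ))ᴴ * X *
      ((W : Matrix ι ι ℂ) ⊗ₖ (W : Matrix ι ι ℂ))) = twirl X := by
  set K : Matrix.unitaryGroup ι ℂ → Matrix (ι × ι) (ι × ι) ℂ :=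
    fun W => (W : Matrix ι ι ℂ) ⊗ₖ (W : Matrix ι ι ℂ) with hK
  have hKm : MatBddMeas (unitaryGroup_measurableSpace ι) K :=
    matBddMeas_kronecker_self measurable_id
  have hF : MatBddMeas (unitaryGroup_measurableSpace ι) (fun W => (K W)ᴴ * X * K W) :=
    (hKm.conjTranspose.mul (.const X)).mul hKm
  set N := expMat (haarUnitary ι) (fun W => (K W)ᴴ * X * K W) with hN
  have hcomm : ∀ V ∈ Matrix.unitaryGroup ι ℂ, (V ⊗ₖ V) * N = N * (V ⊗ₖ V) := by
    intro V hV
    have hinv : (V ⊗ₖ V)ᴴ * N * (V ⊗ₖ V) = N := by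
      rw [hN, ← expMat_const_mul_mul hF]
      ext a b
      simp only [expMat]
      conv_rhs => rw [← map_mul_right_haarUnitary ⟨V, hV⟩]
      rw [integral_map (measurable_mul_const _).aemeasurable
        (hF a b).1.aestronglyMeasurable]
      refine integral_congr_ae (ae_of_all _ fun W => ?_)
      have : K (W * ⟨V, hV⟩) = K W * (V ⊗ₖ V) := by
        simp [hK, Matrix.mul_kronecker_mul]
      simp only [this, Matrix.conjTranspose_mul, Matrix.mul_assoc]
    calc (V ⊗ₖ V) * N = (V ⊗ₖ V) * ((V ⊗ₖ V)ᴴ * N * (V ⊗ₖ V)) := by rw [hinv]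
      _ = ((V ⊗ₖ V) * (V ⊗ₖ V)ᴴ) * (N * (V ⊗ₖ V)) := by simp only [Matrix.mul_assoc]
      _ = N * (V ⊗ₖ V) := by rw [kronecker_self_mul_conjTranspose hV, Matrix.one_mul]
  obtain ⟨α, β, hαβ⟩ := exists_eq_of_commute hcomm
  have htr : N.trace = X.trace := by
    rw [hN, trace_expMat hF]
    have : ∀ W, ((K W)ᴴ * X * K W).trace = X.trace := fun W => by
      rw [Matrix.trace_mul_comm, ← Matrix.mul_assoc, kronecker_self_mul_conjTranspose W.2,
        Matrix.one_mul]
    simp [this]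
  have htr' : (swapMat ι * N).trace = (swapMat ι * X).trace := by
    have h1 : swapMat ι * N = expMat (haarUnitary ι)
        (fun W => swapMat ι * ((K W)ᴴ * X * K W) * 1) := by
      rw [expMat_const_mul_mul hF, Matrix.mul_one]
    rw [h1, trace_expMat (((MatBddMeas.const _).mul hF).mul (.const _))]
    have : ∀ W, (swapMat ι * ((K W)ᴴ * X * K W) * 1).trace = (swapMat ι * X).trace := fun W => by
      have hs : swapMat ι * (K W)ᴴ = (K W)ᴴ * swapMat ι := by
        simp only [hK, Matrix.conjTranspose_kronecker, swapMat_mul_kronecker]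
      rw [Matrix.mul_one, ← Matrix.mul_assoc, ← Matrix.mul_assoc, hs, Matrix.trace_mul_comm,
        Matrix.mul_assoc, ← Matrix.mul_assoc, kronecker_self_mul_conjTranspose W.2, Matrix.one_mul]
    simp only [this, integral_const, probReal_univ, one_smul]
  have hcard : (1 : ℝ) < Fintype.card ι := by exact_mod_cast Fintype.one_lt_card
  have hD : (Fintype.card ι : ℂ) ≠ 0 := by
    exact_mod_cast Fintype.card_ne_zero
  have hD2 : (Fintype.card ι : ℂ) ^ 2 - 1 ≠ 0 := by
    have : ((Fintype.card ι : ℝ) ^ 2 - 1) ≠ 0 := by nlinarith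
    exact_mod_cast this
  have e1 : X.trace = α * (Fintype.card ι : ℂ) ^ 2 + β * Fintype.card ι := by
    rw [← htr, hαβ, Matrix.trace_add, Matrix.trace_smul, Matrix.trace_smul, trace_swapMat,
      Matrix.trace_one]
    simp [sq]
  have e2 : (swapMat ι * X).trace = α * Fintype.card ι + β * (Fintype.card ι : ℂ) ^ 2 := by
    rw [← htr', hαβ, Matrix.mul_add, Matrix.mul_smul, Matrix.mul_smul, swapMat_mul_self,
      Matrix.mul_one, Matrix.trace_add, Matrix.trace_smul, Matrix.trace_smul, trace_swapMat,
      Matrix.trace_one]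
    simp [sq]
  rw [hαβ, twirl, e1, e2]
  congr 2 <;> field_simp <;> ring

omit [Fintype ι] [DecidableEq ι] in
theorem tensorPower_two_apply (A : Matrix ι ι ℂ) (a b : Fin 2 → ι) :
    tensorPower 2 A a b = A (a 0) (b 0) * A (a 1) (b 1) := by
  simp [tensorPower, Fin.prod_univ_two]

/-- The second moments of the entries of a 2-design are those of the Haar measure. -/
theorem IsUnitaryDesign.integral_two {μ : Measure (Matrix.unitaryGroup ι ℂ)}
    (h : IsUnitaryDesign 2 μ) (i a j b : ι × ι) :
    ∫ W, star (((W : Matrix ι ι ℂ) ⊗ₖ (W : Matrix ι ι ℂ)) i a) *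
        ((W : Matrix ι ι ℂ) ⊗ₖ (W : Matrix ι ι ℂ)) j b ∂μ =
      ∫ W, star (((W : Matrix ι ι ℂ) ⊗ₖ (W : Matrix ι ι ℂ)) i a) *
        ((W : Matrix ι ι ℂ) ⊗ₖ (W : Matrix ι ι ℂ)) j b ∂(haarUnitary ι) := by
  have key := h (Matrix.single ![b.1, b.2] ![a.1, a.2] 1) ![j.1, j.2] ![i.1, i.2]
  have e : ∀ W : Matrix.unitaryGroup ι ℂ, (tensorPower 2 (W : Matrix ι ι ℂ) *
      (Matrix.single ![b.1, b.2] ![a.1, a.2] 1 : Matrix (Fin 2 → ι) (Fin 2 → ι) ℂ) *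
        (tensorPower 2 (W : Matrix ι ι ℂ))ᴴ)
        ![j.1, j.2] ![i.1, i.2] =
      star (((W : Matrix ι ι ℂ) ⊗ₖ (W : Matrix ι ι ℂ)) i a) *
        ((W : Matrix ι ι ℂ) ⊗ₖ (W : Matrix ι ι ℂ)) j b := fun W => by
    rw [Matrix.mul_apply, Finset.sum_eq_single ![a.1, a.2]]
    · rw [Matrix.mul_single_apply_same]
      simp [tensorPower_two_apply, Matrix.kroneckerMap_apply]
      ring
    · intro c _ hc
      rw [Matrix.mul_single_apply_of_ne _ _ _ _ _ hc, zero_mul]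
    · simp
  simpa only [e] using key

theorem IsUnitaryDesign.integral_one {μ : Measure (Matrix.unitaryGroup ι ℂ)}
    (h : IsUnitaryDesign 1 μ) (i a j b : ι) :
    ∫ W, star ((W : Matrix ι ι ℂ) i a) * (W : Matrix ι ι ℂ) j b ∂μ =
      ∫ W, star ((W : Matrix ι ι ℂ) i a) * (W : Matrix ι ι ℂ) j b ∂(haarUnitary ι) := by
  have key := h (Matrix.single ![b] ![a] 1) ![j] ![i]
  have e : ∀ W : Matrix.unitaryGroup ι ℂ, (tensorPower 1 (W : Matrix ι ι ℂ) *
      (Matrix.single ![b] ![a] 1 : Matrix (Fin 1 → ι) (Fin 1 → ι) ℂ) *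
        (tensorPower 1 (W : Matrix ι ι ℂ))ᴴ) ![j] ![i] =
      star ((W : Matrix ι ι ℂ) i a) * (W : Matrix ι ι ℂ) j b := fun W => by
    rw [Matrix.mul_apply, Finset.sum_eq_single ![a]]
    · rw [Matrix.mul_single_apply_same]
      simp [tensorPower]
      ring
    · intro c _ hc
      rw [Matrix.mul_single_apply_of_ne _ _ _ _ _ hc, zero_mul]
    · simp
  simpa only [e] using key

variable {Ω : Type*} [mΩ : MeasurableSpace Ω] {P : Measure Ω} [IsProbabilityMeasure P]

/-- Averaging over a 2-design is the Haar twirl. -/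
theorem expMat_of_isUnitaryDesign_two [Nontrivial ι] {W : Ω → Matrix.unitaryGroup ι ℂ}
    (hW : Measurable W) (hd : IsUnitaryDesign 2 (P.map W)) (X : Matrix (ι × ι) (ι × ι) ℂ) :
    expMat P (fun ω => ((W ω : Matrix ι ι ℂ) ⊗ₖ (W ω : Matrix ι ι ℂ))ᴴ * X *
      ((W ω : Matrix ι ι ℂ) ⊗ₖ (W ω : Matrix ι ι ℂ))) = twirl X := by
  rw [← expMat_haar]
  have hm : MatBddMeas (unitaryGroup_measurableSpace ι) fun W : Matrix.unitaryGroup ι ℂ =>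
    (W : Matrix ι ι ℂ) ⊗ₖ (W : Matrix ι ι ℂ) := matBddMeas_kronecker_self measurable_id
  ext a b
  rw [expMat_sandwich_const_apply (matBddMeas_kronecker_self hW), expMat_sandwich_const_apply hm]
  refine Finset.sum_congr rfl fun j _ => Finset.sum_congr rfl fun i _ => ?_
  rw [← hd.integral_two, integral_map hW.aemeasurable
    ((hm i a).star.mul (hm j b)).1.aestronglyMeasurable]

theorem twirl_kronecker_one {B : Matrix ι ι ℂ} (hB : B.trace = 0) : twirl (B ⊗ₖ 1) = 0 := by
  have h : (swapMat ι * (B ⊗ₖ (1 : Matrix ι ι ℂ))).trace = 0 := by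
    rw [← hB]
    simp [Matrix.trace, swapMat_mul_apply, Fintype.sum_prod_type, Matrix.one_apply]
  rw [twirl, h, Matrix.trace_kronecker, hB]
  simp

omit [Fintype ι] [IsProbabilityMeasure P] in
theorem expMat_eq_zero_of_kronecker_one [Nonempty ι] {A : Ω → Matrix ι ι ℂ}
    (h : expMat P (fun ω => A ω ⊗ₖ (1 : Matrix ι ι ℂ)) = 0) : expMat P A = 0 := by
  obtain ⟨c⟩ := ‹Nonempty ι›
  ext a b
  have := congrFun (congrFun h (a, c)) (b, c)
  simpa [expMat, Matrix.kroneckerMap_apply] using this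

/-- Traceless operators are averaged to zero by a 2-design. -/
theorem expMat_conj_eq_zero_of_two [Nontrivial ι] {W : Ω → Matrix.unitaryGroup ι ℂ}
    (hW : Measurable W) (hd : IsUnitaryDesign 2 (P.map W)) {B : Matrix ι ι ℂ}
    (hB : B.trace = 0) :
    expMat P (fun ω => (W ω : Matrix ι ι ℂ)ᴴ * B * (W ω : Matrix ι ι ℂ)) = 0 := by
  apply expMat_eq_zero_of_kronecker_one
  rw [← twirl_kronecker_one hB, ← expMat_of_isUnitaryDesign_two hW hd]
  congr 1
  ext ω : 1
  rw [Matrix.conjTranspose_kronecker, ← Matrix.mul_kronecker_mul, ← Matrix.mul_kronecker_mul,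
    Matrix.mul_one, ← Matrix.star_eq_conjTranspose, Matrix.mem_unitaryGroup_iff'.mp (W ω).2]

theorem isUnitaryDesign_haar (t : ℕ) : IsUnitaryDesign t (haarUnitary ι) := fun _ _ _ => rfl

/-- Traceless operators are averaged to zero by a 1-design. -/
theorem expMat_conj_eq_zero_of_one [Nontrivial ι] {W : Ω → Matrix.unitaryGroup ι ℂ}
    (hW : Measurable W) (hd : IsUnitaryDesign 1 (P.map W)) {B : Matrix ι ι ℂ}
    (hB : B.trace = 0) :
    expMat P (fun ω => (W ω : Matrix ι ι ℂ)ᴴ * B * (W ω : Matrix ι ι ℂ)) = 0 := by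
  have hm : MatBddMeas (unitaryGroup_measurableSpace ι) fun W : Matrix.unitaryGroup ι ℂ =>
    (W : Matrix ι ι ℂ) := .of_unitary measurable_id
  have h0 : expMat (haarUnitary ι) (fun W => (W : Matrix ι ι ℂ)ᴴ * B * (W : Matrix ι ι ℂ)) = 0 :=
    expMat_conj_eq_zero_of_two (W := id) measurable_id
      (by rw [Measure.map_id]; exact isUnitaryDesign_haar 2) hB
  rw [← h0]
  ext a b
  rw [expMat_sandwich_const_apply (.of_unitary hW), expMat_sandwich_const_apply hm]
  refine Finset.sum_congr rfl fun j _ => Finset.sum_congr rfl fun i _ => ?_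
  rw [← hd.integral_one, integral_map hW.aemeasurable
    ((hm i a).star.mul (hm j b)).1.aestronglyMeasurable]

end twirl

/-! ### Partial swap operators and purities -/

/-- The matrix entry `⟨xy| · |zw⟩` of the swap of two qubits if `p` holds, and of the identity
otherwise. -/
def qubitSwap (p : Prop) [Decidable p] (x y z w : Fin 2) : ℂ :=
  if p then (if x = w ∧ y = z then 1 else 0) else (if x = z ∧ y = w then 1 else 0)

/-- The operator on two copies of `n` qubits that exchanges the two copies of every qubit in `h`. -/
def swapOn {n : ℕ} (h : Finset (Fin n)) :
    Matrix ((Fin n → Fin 2) × (Fin n → Fin 2)) ((Fin n → Fin 2) × (Fin n → Fin 2)) ℂ :=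
  fun a b => ∏ q, qubitSwap (q ∈ h) (a.1 q) (a.2 q) (b.1 q) (b.2 q)

/-- The bit string that agrees with `x` on `h` and with `y` off `h`. -/
def mixOn {n : ℕ} (h : Finset (Fin n)) (x y : Fin n → Fin 2) : Fin n → Fin 2 :=
  fun q => if q ∈ h then x q else y q

section swapOn

variable {n : ℕ}

theorem sum_prod_eq_prod_sum (f : Fin n → Fin 2 → Fin 2 → ℂ) :
    ∑ k : (Fin n → Fin 2) × (Fin n → Fin 2), ∏ q, f q (k.1 q) (k.2 q) =
      ∏ q, ∑ u, ∑ v, f q u v := by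
  rw [Finset.prod_univ_sum, Fintype.piFinset_univ, Fintype.sum_prod_type]
  refine Finset.sum_congr rfl fun x _ => ?_
  rw [Finset.prod_univ_sum, Fintype.piFinset_univ]

theorem swapOn_apply (h : Finset (Fin n)) (a b : (Fin n → Fin 2) × (Fin n → Fin 2)) :
    swapOn h a b = if a.1 = mixOn h b.2 b.1 ∧ a.2 = mixOn h b.1 b.2 then 1 else 0 := by
  have : ∀ q, qubitSwap (q ∈ h) (a.1 q) (a.2 q) (b.1 q) (b.2 q) =
      if a.1 q = mixOn h b.2 b.1 q ∧ a.2 q = mixOn h b.1 b.2 q then 1 else 0 := fun q => by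
    by_cases hq : q ∈ h <;> simp [qubitSwap, mixOn, hq]
  simp only [swapOn, this, Fintype.prod_boole, funext_iff, forall_and]

theorem mixOn_empty (x y : Fin n → Fin 2) : mixOn ∅ x y = y := by
  ext q
  simp [mixOn]

theorem mixOn_univ (x y : Fin n → Fin 2) : mixOn Finset.univ x y = x := by
  ext q
  simp [mixOn]

theorem swapOn_empty : swapOn (∅ : Finset (Fin n)) = 1 := by
  ext a b
  simp [swapOn_apply, mixOn_empty, Matrix.one_apply, Prod.ext_iff]

theorem swapOn_univ : swapOn (Finset.univ : Finset (Fin n)) = swapMat (Fin n → Fin 2) := by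
  ext a b
  simp [swapOn_apply, mixOn_univ, swapMat]

theorem swapOn_mul_swapOn (h h' : Finset (Fin n)) :
    swapOn h * swapOn h' = swapOn ((h ∪ h') \ (h ∩ h')) := by
  ext a b
  simp only [Matrix.mul_apply, swapOn, ← Finset.prod_mul_distrib]
  rw [sum_prod_eq_prod_sum (fun q u v => qubitSwap (q ∈ h) (a.1 q) (a.2 q) u v *
    qubitSwap (q ∈ h') u v (b.1 q) (b.2 q))]
  refine Finset.prod_congr rfl fun q _ => ?_
  by_cases hq : q ∈ h <;> by_cases hq' : q ∈ h' <;>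
    simp [qubitSwap, hq, hq', ite_and]

/-- Contraction of two partial swaps in the order that arises from the mixed term
`Tr[ρ B̃ B̃'] Tr[ρ B̃' B̃]`; every qubit in `h ∩ h'` contributes a closed loop. -/
theorem sum_swapOn_mul_swapOn (h h' : Finset (Fin n)) (i i' j j' : Fin n → Fin 2) :
    ∑ k : (Fin n → Fin 2) × (Fin n → Fin 2),
        swapOn h (j, k.2) (k.1, i') * swapOn h' (k.1, j') (i, k.2) =
      2 ^ (h ∩ h').card * swapOn (h ∪ h') (j, j') (i, i') := by
  simp only [swapOn, ← Finset.prod_mul_distrib]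
  rw [sum_prod_eq_prod_sum (fun q u v => qubitSwap (q ∈ h) (j q) v u (i' q) *
    qubitSwap (q ∈ h') u (j' q) (i q) v)]
  have h2 : (2 : ℂ) ^ (h ∩ h').card = ∏ q : Fin n, if q ∈ h ∩ h' then 2 else 1 := by
    rw [Finset.prod_ite_mem, Finset.univ_inter, Finset.prod_const]
  rw [h2, ← Finset.prod_mul_distrib]
  refine Finset.prod_congr rfl fun q _ => ?_
  by_cases hq : q ∈ h <;> by_cases hq' : q ∈ h' <;>
    simp [qubitSwap, hq, hq', ite_and] <;>
    grind

theorem prod_ite_mem_eq_pow_mul_pow (h : Finset (Fin n)) (a b : ℂ) :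
    (∏ q : Fin n, if q ∈ h then a else b) = a ^ h.card * b ^ (n - h.card) := by
  rw [Finset.prod_ite, Finset.prod_const, Finset.prod_const, Finset.filter_mem_eq_inter,
    Finset.univ_inter, Finset.filter_not, Finset.filter_mem_eq_inter, Finset.univ_inter,
    Finset.card_sdiff_of_subset (Finset.subset_univ h), Finset.card_univ, Fintype.card_fin]

theorem trace_swapOn (h : Finset (Fin n)) :
    (swapOn h).trace = 2 ^ h.card * 4 ^ (n - h.card) := by
  rw [← prod_ite_mem_eq_pow_mul_pow]
  simp only [Matrix.trace, Matrix.diag_apply, swapOn]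
  rw [sum_prod_eq_prod_sum (fun q u v => qubitSwap (q ∈ h) u v u v)]
  refine Finset.prod_congr rfl fun q _ => ?_
  by_cases hq : q ∈ h
  · simp [qubitSwap, hq, ite_and]
  · simp only [qubitSwap, hq, if_false, and_self, if_true, Fin.sum_univ_two]
    norm_num

theorem trace_swapMat_mul_swapOn (h : Finset (Fin n)) :
    (swapMat (Fin n → Fin 2) * swapOn h).trace = 4 ^ h.card * 2 ^ (n - h.card) := by
  rw [← swapOn_univ, swapOn_mul_swapOn, Finset.union_eq_left.mpr (Finset.subset_univ h),
    Finset.univ_inter, trace_swapOn,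
    Finset.card_sdiff_of_subset (Finset.subset_univ h), Finset.card_univ, Fintype.card_fin,
    Nat.sub_sub_self (by simpa using Finset.card_le_univ h), mul_comm]

theorem trace_kronecker_mul_swapOn_eq_sum (ρ : QMatrix n) (h : Finset (Fin n)) :
    ((ρ ⊗ₖ ρ) * swapOn h).trace = ∑ x, ∑ y, ρ x (mixOn h y x) * ρ y (mixOn h x y) := by
  simp only [Matrix.trace, Matrix.diag_apply, Matrix.mul_apply, Fintype.sum_prod_type,
    swapOn_apply, ite_and, Matrix.kroneckerMap_apply]
  simp

theorem mixOn_glue (h : Finset (Fin n)) (a b : h → Fin 2) (c c' : ↥hᶜ → Fin 2) :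
    mixOn h (glue h a c) (glue h b c') = glue h a c' := by
  ext q
  by_cases hq : q ∈ h <;> simp [mixOn, glue, hq]

/-- Bit strings as pairs of bit strings on `h` and off `h`. -/
def glueEquiv (h : Finset (Fin n)) :
    (h → Fin 2) × (↥hᶜ → Fin 2) ≃ (Fin n → Fin 2) where
  toFun p := glue h p.1 p.2
  invFun x := (fun q => x q, fun q => x q)
  left_inv p := by
    ext q
    · simp [glue, q.2]
    · have := Finset.mem_compl.mp q.2
      simp [glue, this]
  right_inv x := by
    ext q
    by_cases hq : q ∈ h <;> simp [glue, hq]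

theorem sum_glue {M : Type*} [AddCommMonoid M] (h : Finset (Fin n)) (F : (Fin n → Fin 2) → M) :
    ∑ x, F x = ∑ a : h → Fin 2, ∑ c : ↥hᶜ → Fin 2, F (glue h a c) := by
  rw [← (glueEquiv h).sum_comp F, Fintype.sum_prod_type]
  rfl

/-- Purities are expectations of partial swaps in `ρ ⊗ ρ`. -/
theorem trace_kronecker_mul_swapOn (ρ : QMatrix n) (h : Finset (Fin n)) :
    ((ρ ⊗ₖ ρ) * swapOn h).trace = (reduced ρ h * reduced ρ h).trace := by
  rw [trace_kronecker_mul_swapOn_eq_sum, sum_glue h]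
  simp only [sum_glue h (fun y => ρ _ (mixOn h y _) * ρ y (mixOn h _ y)), mixOn_glue,
    Matrix.trace, Matrix.diag_apply, Matrix.mul_apply, reduced, Finset.sum_mul_sum]
  refine Finset.sum_congr rfl fun a _ => ?_
  rw [Finset.sum_comm]

theorem reduced_isHermitian {ρ : QMatrix n} (hρ : ρ.IsHermitian) (h : Finset (Fin n)) :
    (reduced ρ h).IsHermitian := by
  ext a b
  simp only [Matrix.conjTranspose_apply, reduced, star_sum]
  exact Finset.sum_congr rfl fun c _ => hρ.apply _ _

theorem trace_reduced (ρ : QMatrix n) (h : Finset (Fin n)) : (reduced ρ h).trace = ρ.trace := by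
  simp only [Matrix.trace, Matrix.diag_apply, reduced]
  rw [sum_glue h]

theorem trace_mul_self_of_isHermitian {α : Type*} [Fintype α] {R : Matrix α α ℂ}
    (hR : R.IsHermitian) : (R * R).trace = ((∑ a, ∑ b, ‖R a b‖ ^ 2 : ℝ) : ℂ) := by
  simp only [Matrix.trace, Matrix.diag_apply, Matrix.mul_apply]
  push_cast
  refine Finset.sum_congr rfl fun a _ => Finset.sum_congr rfl fun b _ => ?_
  rw [← hR.apply b a, Complex.star_def, Complex.mul_conj, Complex.normSq_eq_norm_sq]
  push_cast
  rfl

theorem purity_eq_sum {ρ : QMatrix n} (hρ : ρ.IsHermitian) (h : Finset (Fin n)) :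
    purity ρ h = ∑ a, ∑ b, ‖reduced ρ h a b‖ ^ 2 := by
  rw [purity, trace_mul_self_of_isHermitian (reduced_isHermitian hρ h), Complex.ofReal_re]

theorem trace_kronecker_mul_swapOn_eq_purity {ρ : QMatrix n} (hρ : ρ.IsHermitian)
    (h : Finset (Fin n)) : ((ρ ⊗ₖ ρ) * swapOn h).trace = (purity ρ h : ℂ) := by
  rw [trace_kronecker_mul_swapOn, purity_eq_sum hρ,
    trace_mul_self_of_isHermitian (reduced_isHermitian hρ h)]

theorem purity_nonneg {ρ : QMatrix n} (hρ : ρ.IsHermitian) (h : Finset (Fin n)) :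
    0 ≤ purity ρ h := by
  rw [purity_eq_sum hρ]
  positivity

theorem purity_empty {ρ : QMatrix n} (hρ : ρ.trace = 1) : purity ρ ∅ = 1 := by
  have := trace_kronecker_mul_swapOn ρ ∅
  rw [swapOn_empty, Matrix.mul_one, Matrix.trace_kronecker, hρ, mul_one] at this
  rw [purity, ← this, Complex.one_re]

/-- The purity of a state of `r` qubits is at least `2 ^ (-r)`. -/
theorem inv_two_pow_le_purity {ρ : QMatrix n} (hρ : IsDensityMatrix ρ) (h : Finset (Fin n)) :
    ((2 : ℝ) ^ h.card)⁻¹ ≤ purity ρ h := by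
  have hH := hρ.1.isHermitian
  rw [purity_eq_sum hH]
  set R := reduced ρ h
  have h1 : (1 : ℝ) ≤ ∑ a, ‖R a a‖ := by
    have := trace_reduced ρ h
    rw [hρ.2] at this
    calc (1 : ℝ) = ‖R.trace‖ := by rw [this, norm_one]
      _ ≤ ∑ a, ‖R a a‖ := norm_sum_le _ _
  have h2 : (∑ a, ‖R a a‖) ^ 2 ≤ 2 ^ h.card * ∑ a, ‖R a a‖ ^ 2 := by
    have := sq_sum_le_card_mul_sum_sq (s := (Finset.univ : Finset (h → Fin 2)))
      (f := fun a => ‖R a a‖)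
    simpa [Finset.card_univ] using this
  have h3 : ∑ a, ‖R a a‖ ^ 2 ≤ ∑ a, ∑ b, ‖R a b‖ ^ 2 :=
    Finset.sum_le_sum fun a _ => Finset.single_le_sum (f := fun b => ‖R a b‖ ^ 2)
      (fun b _ => by positivity) (Finset.mem_univ a)
  have hpos : (0 : ℝ) < 2 ^ h.card := by positivity
  rw [inv_le_iff_one_le_mul₀ hpos]
  nlinarith

theorem IsProductPureState.purity_eq_one {ρ : QMatrix n} (hρ : IsProductPureState ρ)
    (h : Finset (Fin n)) : purity ρ h = 1 := by
  obtain ⟨φ, hφ, rfl⟩ := hρ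
  set ρ : QMatrix n := Matrix.vecMulVec (fun x => ∏ q, φ q (x q)) (star fun x => ∏ q, φ q (x q))
    with hρ
  have hnorm : ∑ x : Fin n → Fin 2, ∏ q, (φ q (x q) * star (φ q (x q))) = 1 := by
    have := (Finset.prod_univ_sum (fun _ : Fin n => (Finset.univ : Finset (Fin 2)))
      (fun q u => φ q u * star (φ q u))).symm
    rw [Fintype.piFinset_univ] at this
    rw [this]
    refine Finset.prod_eq_one fun q _ => ?_
    rw [← hφ q]
    exact Finset.sum_congr rfl fun u _ => mul_comm _ _
  have key : ∀ x y, ρ x (mixOn h y x) * ρ y (mixOn h x y) =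
      (∏ q, (φ q (x q) * star (φ q (x q)))) * ∏ q, (φ q (y q) * star (φ q (y q))) := fun x y => by
    simp only [hρ, Matrix.vecMulVec_apply, Pi.star_apply, star_prod, ← Finset.prod_mul_distrib]
    refine Finset.prod_congr rfl fun q _ => ?_
    by_cases hq : q ∈ h
    · simp only [mixOn, hq, if_true]
      ring
    · simp only [mixOn, hq, if_false]
  rw [purity, ← trace_kronecker_mul_swapOn, trace_kronecker_mul_swapOn_eq_sum]
  -- exchanging bits between the two copies only rearranges the factors of a product state
  simp only [key]
  rw [← Finset.sum_mul_sum, hnorm, one_mul, Complex.one_re]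

theorem purity_completelyMixed (h : Finset (Fin n)) :
    purity (completelyMixed n) h = ((2 : ℝ) ^ h.card)⁻¹ := by
  have hred : reduced (completelyMixed n) h = ((2 : ℂ) ^ h.card)⁻¹ • 1 := by
    ext a b
    have hinj : ∀ c : ↥hᶜ → Fin 2, (glue h a c = glue h b c) ↔ a = b := fun c => by
      constructor
      · intro e
        exact congrArg Prod.fst ((glueEquiv h).injective (a₁ := (a, c)) (a₂ := (b, c)) e)
      · rintro rfl
        rfl
    have hle : h.card ≤ n := by simpa using Finset.card_le_univ h
    simp only [reduced, completelyMixed, Matrix.smul_apply, Matrix.one_apply, hinj, smul_eq_mul,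
      Finset.sum_const, Finset.card_univ, Fintype.card_pi, Fintype.card_fin, Finset.prod_const,
      Fintype.card_coe, Finset.card_compl, nsmul_eq_mul]
    by_cases hab : a = b
    · simp only [hab, if_true, mul_one]
      push_cast
      rw [pow_sub₀ _ two_ne_zero hle]
      field_simp
    · simp [hab]
  rw [purity, hred]
  simp only [Matrix.smul_mul, Matrix.mul_smul, Matrix.one_mul, Matrix.trace_smul, Matrix.trace_one,
    Fintype.card_pi, Fintype.card_fin, Finset.prod_const, Finset.card_univ, Fintype.card_coe,
    smul_eq_mul]
  rw [show ((2 : ℂ) ^ h.card)⁻¹ * (((2 : ℂ) ^ h.card)⁻¹ * ((2 ^ h.card : ℕ) : ℂ)) =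
    ((((2 : ℝ) ^ h.card)⁻¹ : ℝ) : ℂ) by push_cast; field_simp]
  exact Complex.ofReal_re _

end swapOn

/-! ### Pauli operators and local gates -/

/-- The tensor product of one-qubit operators. -/
def tensorProd {n : ℕ} (A : Fin n → Matrix (Fin 2) (Fin 2) ℂ) : QMatrix n :=
  fun x y => ∏ q, A q (x q) (y q)

section pauli

variable {n : ℕ}

theorem tensorProd_mul (A B : Fin n → Matrix (Fin 2) (Fin 2) ℂ) :
    tensorProd A * tensorProd B = tensorProd fun q => A q * B q := by
  ext x y
  simp only [Matrix.mul_apply, tensorProd, ← Finset.prod_mul_distrib]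
  rw [Finset.prod_univ_sum, Fintype.piFinset_univ]

theorem tensorProd_one : tensorProd (fun _ : Fin n => (1 : Matrix (Fin 2) (Fin 2) ℂ)) = 1 := by
  ext x y
  simp only [tensorProd, Matrix.one_apply, Fintype.prod_boole, funext_iff]
  congr

theorem trace_tensorProd (A : Fin n → Matrix (Fin 2) (Fin 2) ℂ) :
    (tensorProd A).trace = ∏ q, (A q).trace := by
  simp only [Matrix.trace, Matrix.diag_apply, tensorProd]
  rw [Finset.prod_univ_sum, Fintype.piFinset_univ]

theorem pauliOn_eq_tensorProd (q : Fin n) (σ : Pauli) :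
    pauliOn q σ = tensorProd fun r => if r = q then σ.mat else 1 := by
  ext x y
  have h : ∀ r, (if r = q then σ.mat else 1) (x r) (y r) =
      (if r = q then σ.mat (x q) (y q) else 1) * (if r ≠ q → x r = y r then 1 else 0) := fun r => by
    by_cases hr : r = q
    · subst hr
      simp
    · simp [hr, Matrix.one_apply]
  simp only [pauliOn, tensorProd, h, Finset.prod_mul_distrib, Fintype.prod_boole,
    Finset.prod_ite_eq', Finset.mem_univ, if_true]
  split_ifs <;> simp

theorem Pauli.trace_mat (σ : Pauli) : σ.mat.trace = 0 := by
  cases σ <;> simp [Pauli.mat, Matrix.trace_fin_two]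

theorem Pauli.mat_mul_self (σ : Pauli) : σ.mat * σ.mat = 1 := by
  cases σ <;> ext i j <;> fin_cases i <;> fin_cases j <;> simp [Pauli.mat]

theorem Pauli.mat_isHermitian (σ : Pauli) : σ.mat.IsHermitian := by
  cases σ <;> ext i j <;> fin_cases i <;> fin_cases j <;> simp [Pauli.mat]

theorem trace_pauliOn (q : Fin n) (σ : Pauli) : (pauliOn q σ).trace = 0 := by
  rw [pauliOn_eq_tensorProd, trace_tensorProd]
  exact Finset.prod_eq_zero (Finset.mem_univ q) (by simp [σ.trace_mat])

theorem pauliOn_mul_self (q : Fin n) (σ : Pauli) : pauliOn q σ * pauliOn q σ = 1 := by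
  rw [pauliOn_eq_tensorProd, tensorProd_mul, ← tensorProd_one]
  congr 1
  ext1 r
  by_cases h : r = q <;> simp [h, σ.mat_mul_self]

theorem pauliOn_isHermitian (q : Fin n) (σ : Pauli) : (pauliOn q σ).IsHermitian := by
  ext x y
  have : (∀ r, r ≠ q → y r = x r) ↔ ∀ r, r ≠ q → x r = y r :=
    forall_congr' fun r => imp_congr_right fun _ => eq_comm
  simp only [Matrix.conjTranspose_apply, pauliOn, this]
  split_ifs
  · exact σ.mat_isHermitian.apply _ _
  · exact star_zero ℂ

theorem trace_swapMat_mul_kronecker {ι : Type*} [Fintype ι] [DecidableEq ι] (A B : Matrix ι ι ℂ) :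
    (swapMat ι * (A ⊗ₖ B)).trace = (A * B).trace := by
  have h : ∀ a : ι × ι, (swapMat ι * (A ⊗ₖ B)) a a = A a.2 a.1 * B a.1 a.2 := fun a => by
    rw [swapMat_mul_apply, Matrix.kroneckerMap_apply]
  simp only [Matrix.trace, Matrix.diag_apply, h, Fintype.sum_prod_type, Matrix.mul_apply]
  rw [Finset.sum_comm]

theorem card_bitStrings : (Fintype.card (Fin n → Fin 2) : ℂ) = 2 ^ n := by
  simp

theorem four_pow_sub_one_ne_zero (hn : 1 ≤ n) : (4 : ℝ) ^ n - 1 ≠ 0 := by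
  have := one_lt_pow₀ (show (1 : ℝ) < 4 by norm_num) (by omega : n ≠ 0)
  linarith

/-- The twofold twirl of `B ⊗ B` for a Pauli operator `B`. -/
theorem twirl_pauliOn (q : Fin n) (σ : Pauli) :
    twirl (pauliOn q σ ⊗ₖ pauliOn q σ) =
      ((-1 / (4 ^ n - 1) : ℝ) : ℂ) • swapOn ∅ +
        ((2 ^ n / (4 ^ n - 1) : ℝ) : ℂ) • swapOn Finset.univ := by
  have h4 : ((2 : ℂ) ^ n) ^ 2 = 4 ^ n := by rw [← pow_mul, mul_comm, pow_mul]; norm_num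
  have h2 : (2 : ℂ) ^ n ≠ 0 := by positivity
  rw [twirl, Matrix.trace_kronecker, trace_swapMat_mul_kronecker, pauliOn_mul_self,
    trace_pauliOn, Matrix.trace_one, card_bitStrings, h4, swapOn_empty, swapOn_univ]
  congr 2
  · push_cast
    rw [div_self h2]
    ring
  · push_cast
    ring

end pauli

section localOp

variable {r n : ℕ} {e : Fin r → Fin n}

theorem localOp_extend (he : Function.Injective e) (W : QMatrix r) (p : Fin r → Fin 2)
    (x : Fin n → Fin 2) : localOp e W (Function.extend e p x) x = W p (x ∘ e) := by
  rw [localOp, if_pos]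
  · congr 1
    ext1 j
    exact he.extend_apply p x j
  · intro q hq
    exact Function.extend_apply' p x q fun ⟨j, hj⟩ => hq j hj

theorem eq_extend_of_localOp_ne_zero {W : QMatrix r} {x y : Fin n → Fin 2}
    (he : Function.Injective e) (h : localOp e W x y ≠ 0) :
    x = Function.extend e (x ∘ e) y := by
  have h' : ∀ q, (∀ j, e j ≠ q) → x q = y q := by
    by_contra hc
    exact h (if_neg hc)
  ext1 q
  by_cases hq : ∃ j, e j = q
  · obtain ⟨j, rfl⟩ := hq
    rw [he.extend_apply]
    rfl
  · rw [Function.extend_apply' _ _ _ hq]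
    exact h' q fun j hj => hq ⟨j, hj⟩

/-- Sums against a column of a local gate run over the bit strings of its block only. -/
theorem sum_localOp_mul (he : Function.Injective e) (W : QMatrix r) (x : Fin n → Fin 2)
    (φ : ℂ → ℂ) (hφ : φ 0 = 0) (F : (Fin n → Fin 2) → ℂ) :
    ∑ p, φ (localOp e W p x) * F p =
      ∑ p, φ (W p (x ∘ e)) * F (Function.extend e p x) := by
  symm
  refine Fintype.sum_of_injective (fun p => Function.extend e p x) ?_ _ _ ?_ ?_
  · intro p p' h
    ext1 j
    have := congrFun h (e j)
    simpa only [he.extend_apply] using this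
  · intro p hp
    have : localOp e W p x = 0 := by
      by_contra hne
      exact hp ⟨p ∘ e, (eq_extend_of_localOp_ne_zero he hne).symm⟩
    rw [this, hφ, zero_mul]
  · intro p
    rw [localOp_extend he]

theorem localOp_mul (he : Function.Injective e) (A B : QMatrix r) :
    localOp e A * localOp e B = localOp e (A * B) := by
  ext x y
  rw [Matrix.mul_apply]
  simp only [mul_comm (localOp e A x _)]
  have hs := sum_localOp_mul he B y id rfl (fun p => localOp e A x p)
  simp only [id] at hs
  rw [hs]
  have h : ∀ p, localOp e A x (Function.extend e p y) =
      if ∀ q, (∀ j, e j ≠ q) → x q = y q then A (x ∘ e) p else 0 := fun p => by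
    have h1 : (∀ q, (∀ j, e j ≠ q) → x q = Function.extend e p y q) ↔
        ∀ q, (∀ j, e j ≠ q) → x q = y q := by
      refine forall_congr' fun q => forall_congr' fun hq => ?_
      rw [Function.extend_apply' p y q fun ⟨j, hj⟩ => hq j hj]
    have h2 : Function.extend e p y ∘ e = p := Function.extend_comp he _ _
    simp only [localOp, h1, h2]
  simp only [h]
  simp only [localOp, Matrix.mul_apply]
  split_ifs
  · exact Finset.sum_congr rfl fun p _ => mul_comm _ _
  · simp

theorem localOp_conjTranspose (A : QMatrix r) : (localOp e A)ᴴ = localOp e Aᴴ := by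
  ext x y
  have : (∀ q, (∀ j, e j ≠ q) → y q = x q) ↔ ∀ q, (∀ j, e j ≠ q) → x q = y q :=
    forall_congr' fun r => imp_congr_right fun _ => eq_comm
  simp only [Matrix.conjTranspose_apply, localOp, this]
  split_ifs
  · rfl
  · exact star_zero ℂ

theorem pauliOn_eq_localOp (he : Function.Injective e) (j : Fin r) (σ : Pauli) :
    pauliOn (e j) σ = localOp e (pauliOn j σ) := by
  ext x y
  simp only [pauliOn, localOp, Function.comp]
  by_cases h : ∀ q, q ≠ e j → x q = y q
  · rw [if_pos h, if_pos fun q hq => h q fun hqj => hq j hqj.symm,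
      if_pos fun i hi => h _ fun hij => hi (he hij)]
  · rw [if_neg h]
    split_ifs with h1 h2
    · refine absurd (fun q hq => ?_) h
      by_cases hqe : ∃ i, e i = q
      · obtain ⟨i, rfl⟩ := hqe
        exact h2 i fun hij => hq (congrArg e hij)
      · exact h1 q fun i hi => hqe ⟨i, hi⟩
    · rfl
    · rfl

/-- The part of an operator on two copies of `n` qubits seen by a gate, for given bits off the
block of the gate. -/
noncomputable def blockPart (e : Fin r → Fin n)
    (M : Matrix ((Fin n → Fin 2) × (Fin n → Fin 2)) ((Fin n → Fin 2) × (Fin n → Fin 2)) ℂ)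
    (a b : (Fin n → Fin 2) × (Fin n → Fin 2)) :
    Matrix ((Fin r → Fin 2) × (Fin r → Fin 2)) ((Fin r → Fin 2) × (Fin r → Fin 2)) ℂ :=
  fun p q => M (Function.extend e p.1 a.1, Function.extend e p.2 a.2)
    (Function.extend e q.1 b.1, Function.extend e q.2 b.2)

theorem sum_kronecker_localOp_mul (he : Function.Injective e) (W : QMatrix r)
    (a : (Fin n → Fin 2) × (Fin n → Fin 2)) (φ : ℂ →*₀ ℂ)
    (F : (Fin n → Fin 2) × (Fin n → Fin 2) → ℂ) :
    ∑ p, φ ((localOp e W ⊗ₖ localOp e W) p a) * F p =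
      ∑ p, φ ((W ⊗ₖ W) p (a.1 ∘ e, a.2 ∘ e)) *
        F (Function.extend e p.1 a.1, Function.extend e p.2 a.2) := by
  simp only [Fintype.sum_prod_type, Matrix.kroneckerMap_apply, map_mul, mul_assoc,
    ← Finset.mul_sum]
  rw [sum_localOp_mul he W a.1 φ (map_zero φ)]
  refine Finset.sum_congr rfl fun p _ => ?_
  rw [sum_localOp_mul he W a.2 φ (map_zero φ) fun q => F (Function.extend e p a.1, q)]

theorem conj_localOp_apply (he : Function.Injective e) (W : QMatrix r)
    (M : Matrix ((Fin n → Fin 2) × (Fin n → Fin 2)) ((Fin n → Fin 2) × (Fin n → Fin 2)) ℂ)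
    (a b : (Fin n → Fin 2) × (Fin n → Fin 2)) :
    ((localOp e W ⊗ₖ localOp e W)ᴴ * M * (localOp e W ⊗ₖ localOp e W)) a b =
      ((W ⊗ₖ W)ᴴ * blockPart e M a b * (W ⊗ₖ W)) (a.1 ∘ e, a.2 ∘ e) (b.1 ∘ e, b.2 ∘ e) := by
  simp only [Matrix.mul_apply, Matrix.conjTranspose_apply]
  simp only [mul_comm (∑ _, _)]
  have h1 := sum_kronecker_localOp_mul he W b (MonoidWithZeroHom.id ℂ)
  simp only [MonoidWithZeroHom.id_apply] at h1
  rw [h1]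
  refine Finset.sum_congr rfl fun q _ => ?_
  congr 1
  have h2 := sum_kronecker_localOp_mul he W a (starRingEnd ℂ).toMonoidWithZeroHom
  exact h2 _

/-- The factor of a partial swap that comes from the qubits outside a block. -/
def offBlock (e : Fin r → Fin n) (h : Finset (Fin n)) (a b : (Fin n → Fin 2) × (Fin n → Fin 2)) :
    ℂ :=
  ∏ q ∈ (Finset.univ.image e)ᶜ, qubitSwap (q ∈ h) (a.1 q) (a.2 q) (b.1 q) (b.2 q)

theorem swapOn_apply_eq_mul (he : Function.Injective e) (h : Finset (Fin n))
    (a b : (Fin n → Fin 2) × (Fin n → Fin 2)) :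
    swapOn h a b = offBlock e h a b * swapOn (Finset.univ.filter fun j => e j ∈ h)
      (a.1 ∘ e, a.2 ∘ e) (b.1 ∘ e, b.2 ∘ e) := by
  rw [swapOn, ← Finset.prod_mul_prod_compl (Finset.univ.image e), mul_comm, offBlock]
  congr 1
  rw [Finset.prod_image fun i _ j _ hij => he hij]
  simp [swapOn]

theorem blockPart_swapOn (he : Function.Injective e) (h : Finset (Fin n))
    (a b : (Fin n → Fin 2) × (Fin n → Fin 2)) :
    blockPart e (swapOn h) a b =
      offBlock e h a b • swapOn (Finset.univ.filter fun j => e j ∈ h) := by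
  ext p q
  simp only [blockPart, Matrix.smul_apply, smul_eq_mul]
  rw [swapOn_apply_eq_mul he]
  simp only [Function.extend_comp he]
  congr 1
  refine Finset.prod_congr rfl fun i hi => ?_
  have : ¬∃ j, e j = i := fun ⟨j, hj⟩ =>
    Finset.mem_compl.mp hi (Finset.mem_image.mpr ⟨j, Finset.mem_univ j, hj⟩)
  simp only [Function.extend_apply' _ _ _ this]

/-- The weight with which twirling a block of `m` qubits, `r` of which are swapped, replaces the
partial swap on the block by the identity. -/
noncomputable def keepCoef (m r : ℕ) : ℝ := (4 ^ m / 2 ^ r - 2 ^ r) / (4 ^ m - 1)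

/-- The weight with which twirling a block of `m` qubits, `r` of which are swapped, replaces the
partial swap on the block by the full swap. -/
noncomputable def fillCoef (m r : ℕ) : ℝ := (2 ^ m * 2 ^ r - 2 ^ m / 2 ^ r) / (4 ^ m - 1)

theorem keepCoef_zero {m : ℕ} (hm : 1 ≤ m) : keepCoef m 0 = 1 := by
  simp [keepCoef, div_self (four_pow_sub_one_ne_zero hm)]

theorem fillCoef_zero (m : ℕ) : fillCoef m 0 = 0 := by
  simp [fillCoef]

theorem fillCoef_self {m : ℕ} (hm : 1 ≤ m) : fillCoef m m = 1 := by
  have h : (2 : ℝ) ^ m * 2 ^ m = 4 ^ m := by rw [← mul_pow]; norm_num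
  rw [fillCoef, h, div_self (by positivity), div_self (four_pow_sub_one_ne_zero hm)]

theorem keepCoef_nonneg {m r : ℕ} (hr : r ≤ m) : 0 ≤ keepCoef m r := by
  have h1 : (1 : ℝ) ≤ 4 ^ m := one_le_pow₀ (by norm_num)
  have h2 : (2 : ℝ) ^ r ≤ 2 ^ m := pow_le_pow_right₀ (by norm_num) hr
  have h : (2 : ℝ) ^ m * 2 ^ m = 4 ^ m := by rw [← mul_pow]; norm_num
  refine div_nonneg (sub_nonneg.mpr ?_) (by linarith)
  rw [le_div_iff₀ (by positivity), ← h]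
  exact mul_le_mul h2 h2 (by positivity) (by positivity)

theorem fillCoef_nonneg (m r : ℕ) : 0 ≤ fillCoef m r := by
  have h1 : (1 : ℝ) ≤ 4 ^ m := one_le_pow₀ (by norm_num)
  have h2 : (1 : ℝ) ≤ 2 ^ r := one_le_pow₀ (by norm_num)
  refine div_nonneg (sub_nonneg.mpr ?_) (by linarith)
  rw [div_le_iff₀ (by positivity), mul_assoc]
  exact le_mul_of_one_le_right (by positivity) (by nlinarith)

theorem twirl_smul {ι : Type*} [Fintype ι] [DecidableEq ι] (c : ℂ)
    (X : Matrix (ι × ι) (ι × ι) ℂ) : twirl (c • X) = c • twirl X := by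
  simp only [twirl, Matrix.trace_smul, Matrix.mul_smul, smul_add, smul_smul, smul_eq_mul]
  congr 2 <;> ring

theorem twirl_swapOn {m : ℕ} (h : Finset (Fin m)) :
    twirl (swapOn h) = (keepCoef m h.card : ℂ) • swapOn ∅ +
      (fillCoef m h.card : ℂ) • swapOn Finset.univ := by
  have hle : h.card ≤ m := by simpa using Finset.card_le_univ h
  have h4 : ((2 : ℂ) ^ m) ^ 2 = 4 ^ m := by rw [← pow_mul, mul_comm, pow_mul]; norm_num
  have h4' : ∀ k, (4 : ℂ) ^ k = 2 ^ k * 2 ^ k := fun k => by rw [← mul_pow]; norm_num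
  rw [twirl, trace_swapOn, trace_swapMat_mul_swapOn, card_bitStrings, h4, swapOn_empty, swapOn_univ,
    pow_sub₀ _ two_ne_zero hle, pow_sub₀ _ four_ne_zero hle]
  congr 2
  · rw [keepCoef]
    push_cast
    congr 1
    rw [h4' h.card, h4' m]
    field_simp
  · rw [fillCoef]
    push_cast
    congr 1
    rw [h4' h.card, h4' m]
    field_simp

theorem card_filter_mem_eq (he : Function.Injective e) (h : Finset (Fin n)) :
    (Finset.univ.filter fun j => e j ∈ h).card = (h ∩ Finset.univ.image e).card := by
  rw [← Finset.card_image_of_injective _ he]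
  congr 1
  ext q
  simp only [Finset.mem_image, Finset.mem_filter, Finset.mem_univ, true_and, Finset.mem_inter]
  constructor
  · rintro ⟨j, hj, rfl⟩
    exact ⟨hj, j, rfl⟩
  · rintro ⟨hq, j, rfl⟩
    exact ⟨j, hq, rfl⟩

theorem offBlock_congr {h h' : Finset (Fin n)}
    (hh : ∀ q, q ∉ Finset.univ.image e → (q ∈ h ↔ q ∈ h'))
    (a b : (Fin n → Fin 2) × (Fin n → Fin 2)) : offBlock e h a b = offBlock e h' a b := by
  refine Finset.prod_congr rfl fun q hq => ?_
  have := hh q (Finset.mem_compl.mp hq)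
  simp only [qubitSwap, this]

theorem swapOn_sdiff_apply (he : Function.Injective e) (h : Finset (Fin n))
    (a b : (Fin n → Fin 2) × (Fin n → Fin 2)) :
    swapOn (h \ Finset.univ.image e) a b = offBlock e h a b *
      swapOn ∅ (a.1 ∘ e, a.2 ∘ e) (b.1 ∘ e, b.2 ∘ e) := by
  rw [swapOn_apply_eq_mul he, offBlock_congr (h' := h)]
  · congr 3
    ext j
    simp
  · intro q hq
    simp only [Finset.mem_sdiff, hq, not_false_eq_true, and_true]

theorem swapOn_union_apply (he : Function.Injective e) (h : Finset (Fin n))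
    (a b : (Fin n → Fin 2) × (Fin n → Fin 2)) :
    swapOn (h ∪ Finset.univ.image e) a b = offBlock e h a b *
      swapOn Finset.univ (a.1 ∘ e, a.2 ∘ e) (b.1 ∘ e, b.2 ∘ e) := by
  rw [swapOn_apply_eq_mul he, offBlock_congr (h' := h)]
  · congr 3
    ext j
    simp
  · intro q hq
    simp only [Finset.mem_union, hq, or_false]

variable {Ω : Type*} [mΩ : MeasurableSpace Ω] {P : Measure Ω} [IsProbabilityMeasure P]

/-- Averaging a partial swap over a random local gate. A gate that does not meet the swapped qubits
need not be a design: it cancels. -/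
theorem expMat_conj_localOp_swapOn (he : Function.Injective e) (hr : 1 ≤ r)
    {W : Ω → QUnitary r} (hW : Measurable W) {h : Finset (Fin n)}
    (hd : IsUnitaryDesign 2 (P.map W) ∨ Disjoint h (Finset.univ.image e)) :
    expMat P (fun ω => (localOp e (W ω : QMatrix r) ⊗ₖ localOp e (W ω : QMatrix r))ᴴ * swapOn h *
        (localOp e (W ω : QMatrix r) ⊗ₖ localOp e (W ω : QMatrix r))) =
      (keepCoef r (h ∩ Finset.univ.image e).card : ℂ) • swapOn (h \ Finset.univ.image e) +
      (fillCoef r (h ∩ Finset.univ.image e).card : ℂ) • swapOn (h ∪ Finset.univ.image e) := by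
  have : Nonempty (Fin r) := ⟨⟨0, hr⟩⟩
  set h₀ : Finset (Fin r) := Finset.univ.filter fun j => e j ∈ h with hh₀
  have key : ∀ c : ℂ, expMat P (fun ω => ((W ω : QMatrix r) ⊗ₖ (W ω : QMatrix r))ᴴ *
      (c • swapOn h₀) * ((W ω : QMatrix r) ⊗ₖ (W ω : QMatrix r))) =
        c • ((keepCoef r h₀.card : ℂ) • swapOn ∅ +
          (fillCoef r h₀.card : ℂ) • swapOn Finset.univ) := by
    intro c
    rcases hd with hd | hd
    · rw [expMat_of_isUnitaryDesign_two hW hd, twirl_smul, twirl_swapOn]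
    · have h0 : h₀ = ∅ := by
        refine Finset.filter_false_of_mem fun j _ hj => ?_
        exact Finset.disjoint_left.mp hd hj (Finset.mem_image_of_mem e (Finset.mem_univ j))
      rw [h0, Finset.card_empty, keepCoef_zero hr, fillCoef_zero, swapOn_empty]
      simp only [Matrix.mul_smul, Matrix.smul_mul, Matrix.mul_one,
        kronecker_self_conjTranspose_mul (W _).2, expMat_const]
      simp
  ext a b
  simp only [Matrix.add_apply, Matrix.smul_apply, smul_eq_mul, swapOn_sdiff_apply he,
    swapOn_union_apply he]
  have hk := congrFun (congrFun (key (offBlock e h a b)) (a.1 ∘ e, a.2 ∘ e)) (b.1 ∘ e, b.2 ∘ e)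
  simp only [expMat, Matrix.add_apply, Matrix.smul_apply, smul_eq_mul] at hk
  simp only [expMat, conj_localOp_apply he, blockPart_swapOn he, ← card_filter_mem_eq he]
  rw [hk]
  ring

/-- Averaging `B ⊗ B` over a random local gate, for a Pauli operator `B` on a qubit of its
block. -/
theorem expMat_conj_localOp_pauliOn (he : Function.Injective e)
    {W : Ω → QUnitary r} (hW : Measurable W) (hd : IsUnitaryDesign 2 (P.map W)) (j : Fin r)
    (σ : Pauli) :
    expMat P (fun ω => (localOp e (W ω : QMatrix r) ⊗ₖ localOp e (W ω : QMatrix r))ᴴ *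
        (pauliOn (e j) σ ⊗ₖ pauliOn (e j) σ) *
        (localOp e (W ω : QMatrix r) ⊗ₖ localOp e (W ω : QMatrix r))) =
      ((-1 / (4 ^ r - 1) : ℝ) : ℂ) • swapOn ∅ +
        ((2 ^ r / (4 ^ r - 1) : ℝ) : ℂ) • swapOn (Finset.univ.image e) := by
  have : Nonempty (Fin r) := ⟨j⟩
  have key := (expMat_of_isUnitaryDesign_two hW hd (pauliOn j σ ⊗ₖ pauliOn j σ)).trans
    (twirl_pauliOn j σ)
  have hblock : ∀ a b, blockPart e (pauliOn (e j) σ ⊗ₖ pauliOn (e j) σ) a b =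
      offBlock e ∅ a b • (pauliOn j σ ⊗ₖ pauliOn j σ) := by
    intro a b
    ext p q
    have h1 : ∀ (p q : Fin r → Fin 2) (x y : Fin n → Fin 2),
        pauliOn (e j) σ (Function.extend e p x) (Function.extend e q y) =
        (if ∀ i, i ∉ Finset.univ.image e → x i = y i then 1 else 0) * pauliOn j σ p q := by
      intro p q x y
      simp only [pauliOn_eq_localOp he, localOp, Function.extend_comp he]
      have : (∀ i, (∀ j, e j ≠ i) → Function.extend e p x i = Function.extend e q y i) ↔
          ∀ i, i ∉ Finset.univ.image e → x i = y i := by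
        refine forall_congr' fun i => ?_
        have h2 : (∀ j, e j ≠ i) ↔ i ∉ Finset.univ.image e := by simp
        rw [← h2]
        refine forall_congr' fun hi => ?_
        rw [Function.extend_apply' _ _ _ fun ⟨j, hj⟩ => hi j hj,
          Function.extend_apply' _ _ _ fun ⟨j, hj⟩ => hi j hj]
      simp only [this]
      split_ifs <;> simp
    have h3 : offBlock e ∅ a b = (if ∀ i, i ∉ Finset.univ.image e → a.1 i = b.1 i then 1 else 0) *
        (if ∀ i, i ∉ Finset.univ.image e → a.2 i = b.2 i then 1 else 0) := by
      simp only [offBlock, qubitSwap, Finset.notMem_empty, if_false, Finset.prod_boole,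
        Finset.mem_compl, forall_and]
      by_cases h4 : ∀ i, i ∉ Finset.univ.image e → a.1 i = b.1 i
      · rw [if_pos h4, one_mul, if_congr (and_iff_right h4) rfl rfl]
      · rw [if_neg h4, zero_mul, if_neg fun h5 => h4 h5.1]
    simp only [blockPart, Matrix.kroneckerMap_apply, Matrix.smul_apply, smul_eq_mul, h1, h3]
    ring
  ext a b
  have e1 := swapOn_sdiff_apply he ∅ a b
  have e2 := swapOn_union_apply he ∅ a b
  rw [Finset.empty_sdiff] at e1
  rw [Finset.empty_union] at e2
  have hk := congrFun (congrFun key (a.1 ∘ e, a.2 ∘ e)) (b.1 ∘ e, b.2 ∘ e)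
  simp only [Matrix.add_apply, Matrix.smul_apply, smul_eq_mul] at hk
  simp only [Matrix.add_apply, Matrix.smul_apply, smul_eq_mul, e1, e2]
  rw [mul_left_comm, mul_left_comm (Complex.ofReal _) (offBlock e ∅ a b), ← mul_add, ← hk]
  simp only [expMat, conj_localOp_apply he, hblock, Matrix.mul_smul, Matrix.smul_mul,
    Matrix.smul_apply, smul_eq_mul]
  exact integral_const_mul _ _

/-- A Pauli operator on a qubit of the block of a gate is averaged to zero by the gate. -/
theorem expMat_conj_localOp_pauliOn_eq_zero (he : Function.Injective e)
    {W : Ω → QUnitary r} (hW : Measurable W) (hd : IsUnitaryDesign 2 (P.map W)) (j : Fin r)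
    (σ : Pauli) :
    expMat P (fun ω => (localOp e (W ω : QMatrix r))ᴴ * pauliOn (e j) σ *
      localOp e (W ω : QMatrix r)) = 0 := by
  have : Nonempty (Fin r) := ⟨j⟩
  have key := expMat_conj_eq_zero_of_two hW hd (trace_pauliOn j σ)
  ext x y
  have hk := congrFun (congrFun key (x ∘ e)) (y ∘ e)
  simp only [expMat, pauliOn_eq_localOp he, localOp_conjTranspose, localOp_mul he]
  simp only [localOp]
  split_ifs
  · exact hk
  · simp

end localOp

/-! ### Mean and variance of the kernel -/

/-- The combination `∑ c_h S_h` of partial swaps. -/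
noncomputable def swapSum {n : ℕ} (c : Finset (Fin n) → ℝ) :
    Matrix ((Fin n → Fin 2) × (Fin n → Fin 2)) ((Fin n → Fin 2) × (Fin n → Fin 2)) ℂ :=
  ∑ h, (c h : ℂ) • swapOn h

/-- The bilinear form whose value at `(A ⊗ A, A' ⊗ A')` is `Tr[ρ A A'] Tr[ρ A' A]`. -/
noncomputable def crossForm {ι : Type*} [Fintype ι] (ρ : Matrix ι ι ℂ)
    (M M' : Matrix (ι × ι) (ι × ι) ℂ) : ℂ :=
  ∑ i, ∑ j, ∑ i', ∑ j', ∑ k : ι × ι,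
    ρ i j * ρ i' j' * (M (j, k.2) (k.1, i') * M' (k.1, j') (i, k.2))

section forms

variable {ι : Type*} [Fintype ι]

theorem trace_mul_mul_eq_sum (R A A' : Matrix ι ι ℂ) :
    (R * A * A').trace = ∑ i, ∑ k, ∑ j, R i j * (A j k * A' k i) := by
  simp only [Matrix.trace, Matrix.diag_apply, Matrix.mul_apply, Finset.sum_mul]
  simp only [mul_assoc]

theorem crossForm_kronecker (ρ A A' : Matrix ι ι ℂ) :
    crossForm ρ (A ⊗ₖ A) (A' ⊗ₖ A') = (ρ * A * A').trace * (ρ * A' * A).trace := by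
  have h1 : (ρ * A * A').trace = ∑ i, ∑ j, ∑ k, ρ i j * (A j k * A' k i) := by
    rw [trace_mul_mul_eq_sum]
    exact Finset.sum_congr rfl fun i _ => Finset.sum_comm
  have h2 : (ρ * A' * A).trace = ∑ i, ∑ j, ∑ k, ρ i j * (A' j k * A k i) := by
    rw [trace_mul_mul_eq_sum]
    exact Finset.sum_congr rfl fun i _ => Finset.sum_comm
  rw [h1, h2]
  simp only [Finset.sum_mul_sum]
  simp only [crossForm, Fintype.sum_prod_type, Matrix.kroneckerMap_apply]
  refine Finset.sum_congr rfl fun i _ => ?_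
  rw [Finset.sum_comm]
  refine Finset.sum_congr rfl fun i' _ => Finset.sum_congr rfl fun j _ =>
    Finset.sum_congr rfl fun j' _ => Finset.sum_congr rfl fun k _ =>
    Finset.sum_congr rfl fun k' _ => ?_
  ring

variable {n : ℕ}

theorem trace_mul_swapSum_mul_swapSum {ρ : QMatrix n} (hρ : ρ.IsHermitian)
    (c : Finset (Fin n) → ℝ) :
    ((ρ ⊗ₖ ρ) * swapSum c * swapSum c).trace =
      ((∑ h, ∑ h', c h * c h' * purity ρ ((h ∪ h') \ (h ∩ h')) : ℝ) : ℂ) := by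
  have hmul : swapSum c * swapSum c =
      ∑ h, ∑ h', ((c h : ℂ) * c h') • swapOn ((h ∪ h') \ (h ∩ h')) := by
    simp only [swapSum, Finset.sum_mul_sum, Matrix.smul_mul, Matrix.mul_smul, smul_smul,
      swapOn_mul_swapOn]
    exact Finset.sum_congr rfl fun h _ => Finset.sum_congr rfl fun h' _ => by rw [mul_comm]
  rw [Matrix.mul_assoc, hmul]
  simp only [Finset.mul_sum, Matrix.trace_sum, Matrix.mul_smul, Matrix.trace_smul, smul_eq_mul,
    trace_kronecker_mul_swapOn_eq_purity hρ]
  push_cast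
  refine Finset.sum_congr rfl fun h _ => Finset.sum_congr rfl fun h' _ => rfl

theorem crossForm_swapOn {ρ : QMatrix n} (hρ : ρ.IsHermitian) (h h' : Finset (Fin n)) :
    crossForm ρ (swapOn h) (swapOn h') =
      ((2 ^ (h ∩ h').card * purity ρ (h ∪ h') : ℝ) : ℂ) := by
  simp only [crossForm, ← Finset.mul_sum, sum_swapOn_mul_swapOn]
  push_cast
  rw [← trace_kronecker_mul_swapOn_eq_purity hρ]
  simp only [Matrix.trace, Matrix.diag_apply, Matrix.mul_apply, Fintype.sum_prod_type,
    Matrix.kroneckerMap_apply, Finset.mul_sum]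
  refine Finset.sum_congr rfl fun i _ => ?_
  rw [Finset.sum_comm]
  refine Finset.sum_congr rfl fun i' _ => Finset.sum_congr rfl fun j _ =>
    Finset.sum_congr rfl fun j' _ => ?_
  ring

theorem crossForm_add_left (ρ : Matrix ι ι ℂ) (M N M' : Matrix (ι × ι) (ι × ι) ℂ) :
    crossForm ρ (M + N) M' = crossForm ρ M M' + crossForm ρ N M' := by
  simp only [crossForm, Matrix.add_apply, add_mul, mul_add, Finset.sum_add_distrib]

theorem crossForm_add_right (ρ : Matrix ι ι ℂ) (M N M' : Matrix (ι × ι) (ι × ι) ℂ) :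
    crossForm ρ M' (M + N) = crossForm ρ M' M + crossForm ρ M' N := by
  simp only [crossForm, Matrix.add_apply, mul_add, Finset.sum_add_distrib]

theorem crossForm_smul_left (ρ : Matrix ι ι ℂ) (c : ℂ) (M M' : Matrix (ι × ι) (ι × ι) ℂ) :
    crossForm ρ (c • M) M' = c * crossForm ρ M M' := by
  simp only [crossForm, Matrix.smul_apply, smul_eq_mul, Finset.mul_sum]
  congr! 5
  ring

theorem crossForm_smul_right (ρ : Matrix ι ι ℂ) (c : ℂ) (M M' : Matrix (ι × ι) (ι × ι) ℂ) :
    crossForm ρ M (c • M') = c * crossForm ρ M M' := by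
  simp only [crossForm, Matrix.smul_apply, smul_eq_mul, Finset.mul_sum]
  congr! 5
  ring

/-- `crossForm` as a bilinear map. -/
noncomputable def crossBilin (ρ : Matrix ι ι ℂ) :
    Matrix (ι × ι) (ι × ι) ℂ →ₗ[ℂ] Matrix (ι × ι) (ι × ι) ℂ →ₗ[ℂ] ℂ :=
  LinearMap.mk₂ ℂ (crossForm ρ) (crossForm_add_left ρ) (crossForm_smul_left ρ)
    (fun M N N' => crossForm_add_right ρ N N' M) (fun c M N => crossForm_smul_right ρ c M N)

theorem crossForm_swapSum {ρ : QMatrix n} (hρ : ρ.IsHermitian) (c : Finset (Fin n) → ℝ) :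
    crossForm ρ (swapSum c) (swapSum c) =
      ((∑ h, ∑ h', c h * c h' * (2 ^ (h ∩ h').card * purity ρ (h ∪ h')) : ℝ) : ℂ) := by
  have e : ∀ M M', crossForm ρ M M' = crossBilin ρ M M' := fun _ _ => rfl
  rw [e, swapSum]
  simp only [map_sum, map_smul, LinearMap.sum_apply, LinearMap.smul_apply, ← e,
    crossForm_swapOn hρ, smul_eq_mul, Finset.mul_sum]
  rw [Finset.sum_comm]
  push_cast
  refine Finset.sum_congr rfl fun h _ => Finset.sum_congr rfl fun h' _ => ?_
  ring

end forms

section kernel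

variable {Ω : Type*} {m₁ m₂ : MeasurableSpace Ω} [mΩ : MeasurableSpace Ω] {P : Measure Ω}
  [IsProbabilityMeasure P]

theorem integral_trace_mul_mul {ι : Type*} [Fintype ι] (h₁ : m₁ ≤ mΩ) (h₂ : m₂ ≤ mΩ)
    (hind : Indep m₁ m₂ P) {A A' : Ω → Matrix ι ι ℂ} (hA : MatBddMeas m₁ A)
    (hA' : MatBddMeas m₂ A') (R : Matrix ι ι ℂ) :
    ∫ ω, (R * A ω * A' ω).trace ∂P = (R * expMat P A * expMat P A').trace := by
  have hb : ∀ i k j, BddMeas mΩ fun ω => R i j * (A ω j k * A' ω k i) := fun i k j =>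
    (BddMeas.const _).mul (((hA j k).mono h₁).mul ((hA' k i).mono h₂))
  simp only [trace_mul_mul_eq_sum]
  rw [integral_finsetSum _ fun i _ => (BddMeas.sum fun k _ => .sum fun j _ => hb i k j).integrable]
  refine Finset.sum_congr rfl fun i _ => ?_
  rw [integral_finsetSum _ fun k _ => (BddMeas.sum fun j _ => hb i k j).integrable]
  refine Finset.sum_congr rfl fun k _ => ?_
  rw [integral_finsetSum _ fun j _ => (hb i k j).integrable]
  refine Finset.sum_congr rfl fun j _ => ?_
  rw [integral_const_mul, integral_mul_of_indep h₁ h₂ hind (hA j k) (hA' k i)]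
  rfl

theorem integral_crossForm {ι : Type*} [Fintype ι] (h₁ : m₁ ≤ mΩ) (h₂ : m₂ ≤ mΩ)
    (hind : Indep m₁ m₂ P) {M M' : Ω → Matrix (ι × ι) (ι × ι) ℂ} (hM : MatBddMeas m₁ M)
    (hM' : MatBddMeas m₂ M') (ρ : Matrix ι ι ℂ) :
    ∫ ω, crossForm ρ (M ω) (M' ω) ∂P = crossForm ρ (expMat P M) (expMat P M') := by
  have hb : ∀ i j i' j' (k : ι × ι), BddMeas mΩ fun ω =>
      ρ i j * ρ i' j' * (M ω (j, k.2) (k.1, i') * M' ω (k.1, j') (i, k.2)) := fun i j i' j' k =>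
    (BddMeas.const _).mul (((hM _ _).mono h₁).mul ((hM' _ _).mono h₂))
  simp only [crossForm]
  rw [integral_finsetSum _ fun i _ => (BddMeas.sum fun j _ => .sum fun i' _ => .sum fun j' _ =>
    .sum fun k _ => hb i j i' j' k).integrable]
  refine Finset.sum_congr rfl fun i _ => ?_
  rw [integral_finsetSum _ fun j _ => (BddMeas.sum fun i' _ => .sum fun j' _ =>
    .sum fun k _ => hb i j i' j' k).integrable]
  refine Finset.sum_congr rfl fun j _ => ?_
  rw [integral_finsetSum _ fun i' _ => (BddMeas.sum fun j' _ =>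
    .sum fun k _ => hb i j i' j' k).integrable]
  refine Finset.sum_congr rfl fun i' _ => ?_
  rw [integral_finsetSum _ fun j' _ => (BddMeas.sum fun k _ => hb i j i' j' k).integrable]
  refine Finset.sum_congr rfl fun j' _ => ?_
  rw [integral_finsetSum _ fun k _ => (hb i j i' j' k).integrable]
  refine Finset.sum_congr rfl fun k _ => ?_
  rw [integral_const_mul, integral_mul_of_indep h₁ h₂ hind (hM _ _) (hM' _ _)]
  rfl

variable {n : ℕ} {ρ B : QMatrix n} {U U' : Ω → QMatrix n}

theorem bddMeas_aldTerm (hU : MatBddMeas mΩ U) (hU' : MatBddMeas mΩ U') (ρ B : QMatrix n) :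
    BddMeas mΩ fun ω => (1 / 2 : ℂ) * Matrix.trace (ρ * (conjBy (U ω) B * conjBy (U' ω) B +
      conjBy (U' ω) B * conjBy (U ω) B)) := by
  have hA := hU.conjBy (.const B)
  have hA' := hU'.conjBy (.const B)
  exact (BddMeas.const _).mul
    ((MatBddMeas.const ρ).mul ((hA.mul hA').add (hA'.mul hA))).trace

theorem memLp_aldTerm (hU : MatBddMeas mΩ U) (hU' : MatBddMeas mΩ U') (ρ B : QMatrix n) :
    MemLp (fun ω => aldTerm ρ B (U ω) (U' ω)) 2 P :=
  ((bddMeas_aldTerm hU hU' ρ B).memLp 2).re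

theorem aldTerm_eq_half_add (hρ : ρ.IsHermitian) (hB : B.IsHermitian) (V V' : QMatrix n) :
    (aldTerm ρ B V V' : ℂ) = (1 / 2 : ℂ) *
      ((ρ * conjBy V B * conjBy V' B).trace + (ρ * conjBy V' B * conjBy V B).trace) := by
  rw [aldTerm_eq hρ hB, Matrix.mul_add, Matrix.trace_add, Matrix.mul_assoc, Matrix.mul_assoc]

/-- If one of the two Heisenberg-evolved generators averages to zero, so does the kernel. -/
theorem integral_aldTerm_eq_zero (h₁ : m₁ ≤ mΩ) (h₂ : m₂ ≤ mΩ) (hind : Indep m₁ m₂ P)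
    (hU : MatBddMeas m₁ U) (hU' : MatBddMeas m₂ U') (hρ : ρ.IsHermitian) (hB : B.IsHermitian)
    (h0 : expMat P (fun ω => conjBy (U ω) B) = 0 ∨ expMat P (fun ω => conjBy (U' ω) B) = 0) :
    ∫ ω, aldTerm ρ B (U ω) (U' ω) ∂P = 0 := by
  have hA : MatBddMeas m₁ fun ω => conjBy (U ω) B := hU.conjBy (.const B)
  have hA' : MatBddMeas m₂ fun ω => conjBy (U' ω) B := hU'.conjBy (.const B)
  have hR := MatBddMeas.const (Ω := Ω) (m := mΩ) ρ
  rw [← Complex.ofReal_inj, ← integral_complex_ofReal]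
  simp only [aldTerm_eq_half_add hρ hB]
  rw [integral_const_mul, integral_add
    (((hR.mul (hA.mono h₁)).mul (hA'.mono h₂)).trace).integrable
    (((hR.mul (hA'.mono h₂)).mul (hA.mono h₁)).trace).integrable,
    integral_trace_mul_mul h₁ h₂ hind hA hA', integral_trace_mul_mul h₂ h₁ hind.symm hA' hA]
  rcases h0 with h0 | h0 <;> simp [h0]

/-- The variance of the kernel if the second moments of both Heisenberg-evolved generators are the
same combination of partial swaps. -/
theorem variance_aldTerm (h₁ : m₁ ≤ mΩ) (h₂ : m₂ ≤ mΩ) (hind : Indep m₁ m₂ P)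
    (hU : MatBddMeas m₁ U) (hU' : MatBddMeas m₂ U') (hρ : ρ.IsHermitian) (hB : B.IsHermitian)
    (h0 : ∫ ω, aldTerm ρ B (U ω) (U' ω) ∂P = 0) {c : Finset (Fin n) → ℝ}
    (hc : expMat P (fun ω => conjBy (U ω) B ⊗ₖ conjBy (U ω) B) = swapSum c)
    (hc' : expMat P (fun ω => conjBy (U' ω) B ⊗ₖ conjBy (U' ω) B) = swapSum c) :
    variance (fun ω => aldTerm ρ B (U ω) (U' ω)) P =
      1 / 2 * ∑ h, ∑ h', c h * c h' * (purity ρ ((h ∪ h') \ (h ∩ h')) +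
        2 ^ (h ∩ h').card * purity ρ (h ∪ h')) := by
  have hA : MatBddMeas m₁ fun ω => conjBy (U ω) B := hU.conjBy (.const B)
  have hA' : MatBddMeas m₂ fun ω => conjBy (U' ω) B := hU'.conjBy (.const B)
  have hR := MatBddMeas.const (Ω := Ω) (m := mΩ) ρ
  have hT := ((hR.mul (hA.mono h₁)).mul (hA'.mono h₂)).trace
  have hT' := ((hR.mul (hA'.mono h₂)).mul (hA.mono h₁)).trace
  have hsq : ∀ V V' : QMatrix n, (ρ * V * V').trace * (ρ * V * V').trace =
      ((ρ ⊗ₖ ρ) * (V ⊗ₖ V) * (V' ⊗ₖ V')).trace := fun V V' => by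
    rw [← Matrix.mul_kronecker_mul, ← Matrix.mul_kronecker_mul, Matrix.trace_kronecker]
  rw [variance_of_integral_eq_zero
    (memLp_aldTerm (hU.mono h₁) (hU'.mono h₂) ρ B).aestronglyMeasurable.aemeasurable h0,
    ← Complex.ofReal_inj, ← integral_complex_ofReal]
  simp only [Complex.ofReal_pow,
    aldTerm_eq_half_add hρ hB]
  have hexp : ∀ t t' : ℂ, (1 / 2 * (t + t')) ^ 2 =
      1 / 4 * (t * t) + (1 / 4 * (t' * t') + 1 / 2 * (t * t')) := fun t t' => by ring
  simp only [hexp]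
  rw [integral_add ((BddMeas.const _).mul (hT.mul hT)).integrable
    (((BddMeas.const _).mul (hT'.mul hT')).add ((BddMeas.const _).mul (hT.mul hT'))).integrable,
    integral_add ((BddMeas.const _).mul (hT'.mul hT')).integrable
      ((BddMeas.const _).mul (hT.mul hT')).integrable,
    integral_const_mul, integral_const_mul, integral_const_mul]
  -- the squares of the traces are traces against `ρ ⊗ ρ`, and the mixed product is a `crossForm`
  simp only [hsq, ← crossForm_kronecker]
  rw [integral_trace_mul_mul h₁ h₂ hind (hA.kronecker hA) (hA'.kronecker hA'),
    integral_trace_mul_mul h₂ h₁ hind.symm (hA'.kronecker hA') (hA.kronecker hA),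
    integral_crossForm h₁ h₂ hind (hA.kronecker hA) (hA'.kronecker hA'), hc, hc',
    trace_mul_swapSum_mul_swapSum hρ, crossForm_swapSum hρ]
  simp only [mul_add, Finset.sum_add_distrib]
  push_cast
  ring

theorem conjBy_kronecker (V B : QMatrix n) :
    conjBy V B ⊗ₖ conjBy V B = (V ⊗ₖ V)ᴴ * (B ⊗ₖ B) * (V ⊗ₖ V) := by
  simp only [conjBy, Matrix.conjTranspose_kronecker, Matrix.mul_kronecker_mul]

end kernel

/-! ### Random circuits on all qubits -/

theorem IsPureState.isDensityMatrix {n : ℕ} {ρ : QMatrix n} (hρ : IsPureState ρ) :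
    IsDensityMatrix ρ := by
  obtain ⟨ψ, hψ, rfl⟩ := hρ
  exact ⟨Matrix.posSemidef_vecMulVec_self_star ψ, by
    rw [Matrix.trace_vecMulVec, dotProduct_comm, hψ]⟩

theorem IsPureState.purity_univ {n : ℕ} {ρ : QMatrix n} (hρ : IsPureState ρ) :
    purity ρ Finset.univ = 1 := by
  have hH := hρ.isDensityMatrix.1.isHermitian
  have hsq : ρ * ρ = ρ := by
    obtain ⟨ψ, hψ, rfl⟩ := hρ
    rw [Matrix.vecMulVec_mul_vecMulVec, hψ, one_smul]
  have h := trace_kronecker_mul_swapOn_eq_purity hH Finset.univ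
  rw [swapOn_univ, Matrix.trace_mul_comm, trace_swapMat_mul_kronecker, hsq,
    hρ.isDensityMatrix.2] at h
  exact_mod_cast h.symm

/-- The coefficients `a` at `∅` and `b` at `s`. -/
noncomputable def twoCoef {n : ℕ} (s : Finset (Fin n)) (a b : ℝ) : Finset (Fin n) → ℝ :=
  Pi.single ∅ a + Pi.single s b

theorem sum_twoCoef_mul {n : ℕ} (s : Finset (Fin n)) (a b : ℝ) (f : Finset (Fin n) → ℝ) :
    ∑ h, twoCoef s a b h * f h = a * f ∅ + b * f s := by
  simp [twoCoef, add_mul, Finset.sum_add_distrib, Pi.single_apply]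

theorem swapSum_twoCoef {n : ℕ} (s : Finset (Fin n)) (a b : ℝ) :
    swapSum (twoCoef s a b) = (a : ℂ) • swapOn ∅ + (b : ℂ) • swapOn s := by
  have h : ∀ (t : Finset (Fin n)) (x : ℝ),
      ∑ h, (((Pi.single t x : Finset (Fin n) → ℝ) h : ℝ) : ℂ) • swapOn h = (x : ℂ) • swapOn t := by
    intro t x
    rw [Finset.sum_eq_single t, Pi.single_eq_same]
    · intro h _ hne
      rw [Pi.single_eq_of_ne hne, Complex.ofReal_zero, zero_smul]
    · simp
  simp only [swapSum, twoCoef, Pi.add_apply, Complex.ofReal_add, add_smul,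
    Finset.sum_add_distrib, h]

section allQubits

variable {Ω : Type*} [mΩ : MeasurableSpace Ω] {P : Measure Ω} [IsProbabilityMeasure P] {n : ℕ}
  {ρ : QMatrix n} {U U' : Ω → QUnitary n}

theorem memLp_and_integral_aldTerm_of_one_design (hρ : IsPureState ρ) (q : Fin n) (σ : Pauli)
    (hU : Measurable U) (hU' : Measurable U') (hind : IndepFun U U' P)
    (hd : IsUnitaryDesign 1 (P.map U) ∨ IsUnitaryDesign 1 (P.map U')) :
    MemLp (fun ω => aldTerm ρ (pauliOn q σ) (U ω) (U' ω)) 2 P ∧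
      ∫ ω, aldTerm ρ (pauliOn q σ) (U ω) (U' ω) ∂P = 0 := by
  have : Nonempty (Fin n) := ⟨q⟩
  refine ⟨memLp_aldTerm (.of_unitary hU) (.of_unitary hU') _ _,
    integral_aldTerm_eq_zero hU.comap_le hU'.comap_le hind
      (.of_unitary (comap_measurable U)) (.of_unitary (comap_measurable U'))
      hρ.isDensityMatrix.1.isHermitian (pauliOn_isHermitian q σ) ?_⟩
  exact hd.imp (fun hd => expMat_conj_eq_zero_of_one hU hd (trace_pauliOn q σ))
    fun hd => expMat_conj_eq_zero_of_one hU' hd (trace_pauliOn q σ)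

theorem mean_and_variance_aldTerm_of_two_design (hρ : IsPureState ρ) (q : Fin n) (σ : Pauli)
    (hU : Measurable U) (hU' : Measurable U') (hind : IndepFun U U' P)
    (hd : IsUnitaryDesign 2 (P.map U)) (hd' : IsUnitaryDesign 2 (P.map U')) :
    MemLp (fun ω => aldTerm ρ (pauliOn q σ) (U ω) (U' ω)) 2 P ∧
      ∫ ω, aldTerm ρ (pauliOn q σ) (U ω) (U' ω) ∂P = 0 ∧
      variance (fun ω => aldTerm ρ (pauliOn q σ) (U ω) (U' ω)) P =
        2 ^ n / (2 * (2 ^ (2 * n) - 1)) * (1 + (2 ^ n - 2) / (2 ^ n * (2 ^ n + 1))) := by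
  have hne : Nonempty (Fin n) := ⟨q⟩
  have hH := hρ.isDensityMatrix.1.isHermitian
  have hmean : ∫ ω, aldTerm ρ (pauliOn q σ) (U ω) (U' ω) ∂P = 0 :=
    integral_aldTerm_eq_zero hU.comap_le hU'.comap_le hind
      (.of_unitary (comap_measurable U)) (.of_unitary (comap_measurable U'))
      hH (pauliOn_isHermitian q σ)
      (.inl (expMat_conj_eq_zero_of_two hU hd (trace_pauliOn q σ)))
  refine ⟨memLp_aldTerm (.of_unitary hU) (.of_unitary hU') _ _, hmean, ?_⟩
  have hsecond : ∀ V : Ω → QUnitary n, Measurable V → IsUnitaryDesign 2 (P.map V) →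
      expMat P (fun ω => conjBy (V ω : QMatrix n) (pauliOn q σ) ⊗ₖ
        conjBy (V ω : QMatrix n) (pauliOn q σ)) =
      swapSum (twoCoef Finset.univ (-1 / (4 ^ n - 1)) (2 ^ n / (4 ^ n - 1))) := fun V hV hVd => by
    simp only [conjBy_kronecker]
    rw [expMat_of_isUnitaryDesign_two hV hVd, twirl_pauliOn, swapSum_twoCoef]
  rw [variance_aldTerm hU.comap_le hU'.comap_le hind
    (.of_unitary (comap_measurable U)) (.of_unitary (comap_measurable U')) hH
    (pauliOn_isHermitian q σ) hmean (hsecond U hU hd) (hsecond U' hU' hd')]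
  simp only [mul_assoc, ← Finset.mul_sum, sum_twoCoef_mul]
  simp only [Finset.empty_union, Finset.union_empty, Finset.empty_inter, Finset.inter_empty,
    Finset.union_self, Finset.inter_self, Finset.sdiff_empty, Finset.sdiff_self,
    Finset.card_empty, Finset.card_univ, Fintype.card_fin, hρ.purity_univ,
    purity_empty hρ.isDensityMatrix.2, pow_zero]
  have h4 : (4 : ℝ) ^ n = (2 ^ n) ^ 2 := by rw [← pow_mul, mul_comm, pow_mul]; norm_num
  have h22 : (2 : ℝ) ^ (2 * n) = (2 ^ n) ^ 2 := by rw [mul_comm, pow_mul]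
  have hD : (2 : ℝ) ≤ 2 ^ n := by
    simpa using pow_le_pow_right₀ (show (1 : ℝ) ≤ 2 by norm_num) (Fin.pos q)
  rw [h4, h22]
  generalize (2 : ℝ) ^ n = D at hD
  have h1 : D - 1 ≠ 0 := by linarith
  have h2 : D + 1 ≠ 0 := by linarith
  have h3 : D ≠ 0 := by linarith
  rw [show D ^ 2 - 1 = (D - 1) * (D + 1) by ring]
  field_simp
  ring

theorem isEquivalent_variance_one_div_two_pow :
    (fun n : ℕ => (2 ^ n / (2 * (2 ^ (2 * n) - 1)) *
        (1 + (2 ^ n - 2) / (2 ^ n * (2 ^ n + 1))) : ℝ)) ~[atTop]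
      fun n : ℕ => 1 / 2 ^ (n + 1) := by
  refine isEquivalent_of_tendsto_one ?_
  -- in terms of `ε = 2 ^ (-n)` the ratio is `(1 + ε (1 - 2 ε) / (1 + ε)) / (1 - ε ^ 2)`
  have hε : Tendsto (fun n : ℕ => ((1 / 2 : ℝ)) ^ n) atTop (nhds 0) :=
    tendsto_pow_atTop_nhds_zero_of_lt_one (by norm_num) (by norm_num)
  have hlim : Tendsto (fun ε : ℝ => (1 + ε * (1 - 2 * ε) / (1 + ε)) / (1 - ε ^ 2)) (nhds 0)
      (nhds 1) := by
    have : ContinuousAt (fun ε : ℝ => (1 + ε * (1 - 2 * ε) / (1 + ε)) / (1 - ε ^ 2)) 0 := by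
      refine ContinuousAt.div (ContinuousAt.add continuousAt_const
        (ContinuousAt.div (by fun_prop) (by fun_prop) (by norm_num))) (by fun_prop) (by norm_num)
    simpa [ContinuousAt] using this
  refine (hlim.comp hε).congr' ?_
  filter_upwards [eventually_ge_atTop 1] with n hn
  have hD : (2 : ℝ) ≤ 2 ^ n := by
    simpa using pow_le_pow_right₀ (show (1 : ℝ) ≤ 2 by norm_num) hn
  simp only [Function.comp, Pi.div_apply]
  rw [one_div_pow, pow_succ (2 : ℝ) n, mul_comm 2 n, pow_mul]
  generalize (2 : ℝ) ^ n = D at hD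
  have h1 : D - 1 ≠ 0 := by linarith
  have h2 : D + 1 ≠ 0 := by linarith
  have h3 : D ≠ 0 := by linarith
  rw [show D ^ 2 - 1 = (D - 1) * (D + 1) by ring,
    show (1 - (1 / D) ^ 2 : ℝ) = (D - 1) * (D + 1) / D ^ 2 by field_simp; ring,
    show (1 + 1 / D : ℝ) = (D + 1) / D by field_simp]
  field_simp

end allQubits

/-! ### Geometry of the layers -/

section geometry

variable {m κ : ℕ}

theorem blockWire_inj {l : ℕ} {k k' : Fin κ} {j j' : Fin m}
    (h : blockWire m κ l k j = blockWire m κ l k' j') : k = k' ∧ j = j' := by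
  have hlt : ∀ (k : Fin κ) (j : Fin m), (k : ℕ) * m + j < m * κ := fun k j => by
    have h1 : ((k : ℕ) + 1) * m ≤ κ * m := Nat.mul_le_mul_right m k.2
    have h2 := j.2
    nlinarith
  have h1 : layerOffset m l + (k * m + j) ≡ layerOffset m l + (k' * m + j') [MOD m * κ] := by
    have := congrArg Fin.val h
    simpa only [blockWire, add_assoc, Nat.ModEq] using this
  have h2 : (k : ℕ) * m + j = k' * m + j' := by
    have := Nat.ModEq.add_left_cancel' _ h1
    rwa [Nat.ModEq, Nat.mod_eq_of_lt (hlt k j), Nat.mod_eq_of_lt (hlt k' j')] at this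
  have hm : 0 < m := j.pos
  have h3 : ∀ (k : Fin κ) (j : Fin m), ((k : ℕ) * m + j) / m = k := fun k j => by
    rw [mul_comm, Nat.mul_add_div hm, Nat.div_eq_of_lt j.2, add_zero]
  have hk : (k : ℕ) = k' := by rw [← h3 k j, h2, h3]
  exact ⟨Fin.ext hk, Fin.ext (by rw [hk] at h2; omega)⟩

theorem blockWire_injective (l : ℕ) (k : Fin κ) : Function.Injective (blockWire m κ l k) :=
  fun _ _ h => (blockWire_inj h).2

theorem mem_blockSupport {l : ℕ} {k : Fin κ} {q : Fin (m * κ)} :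
    q ∈ blockSupport m κ l k ↔ ∃ j, blockWire m κ l k j = q := by
  simp [blockSupport]

theorem eq_of_mem_blockSupport {l : ℕ} {k k' : Fin κ} {q : Fin (m * κ)}
    (h : q ∈ blockSupport m κ l k) (h' : q ∈ blockSupport m κ l k') : k = k' := by
  obtain ⟨j, rfl⟩ := mem_blockSupport.mp h
  obtain ⟨j', hj⟩ := mem_blockSupport.mp h'
  exact (blockWire_inj hj.symm).1

theorem card_blockSupport (l : ℕ) (k : Fin κ) : (blockSupport m κ l k).card = m := by
  rw [blockSupport, Finset.card_image_of_injective _ (blockWire_injective l k), Finset.card_univ,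
    Fintype.card_fin]

theorem hasBlock_one (bc : Boundary) (k : Fin κ) : HasBlock bc m κ 1 k := by
  cases bc
  · have h1 : ((k : ℕ) + 1) * m ≤ κ * m := Nat.mul_le_mul_right m k.2
    simp only [HasBlock, layerOffset, odd_one, if_true]
    linarith
  · trivial

theorem exists_mem_blockSupport_one (q : Fin (m * κ)) : ∃ k, q ∈ blockSupport m κ 1 k := by
  have hm : 0 < m := Nat.pos_of_mul_pos_right (Fin.pos q)
  refine ⟨⟨q / m, Nat.div_lt_of_lt_mul q.2⟩,
    mem_blockSupport.mpr ⟨⟨q % m, Nat.mod_lt _ hm⟩, Fin.ext ?_⟩⟩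
  simp only [blockWire, layerOffset, odd_one, if_true, zero_add]
  rw [mul_comm (_ / m) m, Nat.div_add_mod, Nat.mod_eq_of_lt q.2]

/-- A set of qubits that is a union of half blocks. The length `(m + 1) / 2` is `m / 2` for even
`m`, and `1` for `m = 1`, where any set of qubits qualifies. -/
def SegClosed (h : Finset (Fin (m * κ))) : Prop :=
  ∀ q q' : Fin (m * κ), (q : ℕ) / ((m + 1) / 2) = q' / ((m + 1) / 2) → q ∈ h → q' ∈ h

theorem SegClosed.union {h h' : Finset (Fin (m * κ))} (hh : SegClosed h) (hh' : SegClosed h') :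
    SegClosed (h ∪ h') := fun q q' hq hmem => by
  rcases Finset.mem_union.mp hmem with h1 | h1
  · exact Finset.mem_union_left _ (hh q q' hq h1)
  · exact Finset.mem_union_right _ (hh' q q' hq h1)

theorem exists_layerOffset_add_eq {s : ℕ} (l k : ℕ) :
    ∃ u, layerOffset (2 * s) l + k * (2 * s) = s * u := by
  unfold layerOffset
  split_ifs
  · exact ⟨2 * k, by ring⟩
  · refine ⟨1 + 2 * k, ?_⟩
    rw [Nat.mul_div_cancel_left s two_pos]
    ring

theorem mul_add_mod_mul (s u κ j : ℕ) :
    (s * u + j) % (s * κ) = s * ((u + j / s) % κ) + j % s := by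
  rcases Nat.eq_zero_or_pos s with rfl | hs
  · simp
  · rw [Nat.mod_mul, Nat.mul_add_mod, Nat.mul_add_div hs, add_comm]

theorem segClosed_blockSupport (hm : m = 1 ∨ Even m) (l : ℕ) (k : Fin κ) :
    SegClosed (blockSupport m κ l k) := by
  rcases hm with rfl | hm
  · intro q q' hq hmem
    have : q = q' := Fin.ext (by simpa using hq)
    rwa [← this]
  · obtain ⟨s, rfl⟩ := hm.two_dvd
    intro q q' hq hmem
    obtain ⟨j, rfl⟩ := mem_blockSupport.mp hmem
    obtain ⟨u, hu⟩ := exists_layerOffset_add_eq (s := s) l k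
    have hs : 0 < s := by
      have := j.2
      omega
    have hs2 : (2 * s + 1) / 2 = s := by omega
    have hj2 : (j : ℕ) / s < 2 := Nat.div_lt_of_lt_mul (by have := j.2; omega)
    rw [hs2] at hq
    have hval : ∀ j : Fin (2 * s), (blockWire (2 * s) κ l k j : ℕ) =
        s * ((u + j / s) % (2 * κ)) + j % s := fun j => by
      rw [← mul_add_mod_mul]
      simp only [blockWire]
      rw [hu]
      congr 1
      ring
    have hdiv : (blockWire (2 * s) κ l k j : ℕ) / s = (u + j / s) % (2 * κ) := by
      rw [hval, Nat.mul_add_div hs, Nat.div_eq_of_lt (Nat.mod_lt _ hs), add_zero]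
    have hi : (q' : ℕ) % s < s := Nat.mod_lt _ hs
    have hlt : s * ((j : ℕ) / s) + q' % s < 2 * s := by nlinarith
    refine mem_blockSupport.mpr ⟨⟨_, hlt⟩, Fin.ext ?_⟩
    rw [hval, Nat.mul_add_div hs, Nat.div_eq_of_lt hi, add_zero, Nat.mul_add_mod,
      Nat.mod_eq_of_lt hi, ← hdiv, hq, Nat.div_add_mod]

/-- A union of half blocks meets every block in nothing, in half of the block, or in all of it. -/
theorem SegClosed.two_mul_card_inter {h : Finset (Fin (m * κ))} (hh : SegClosed h)
    (hm : m = 1 ∨ Even m) (l : ℕ) (k : Fin κ) :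
    (h ∩ blockSupport m κ l k).card = 0 ∨ 2 * (h ∩ blockSupport m κ l k).card = m ∨
      (h ∩ blockSupport m κ l k).card = m := by
  rw [blockSupport, ← card_filter_mem_eq (blockWire_injective l k)]
  rcases hm with rfl | hm
  · have := Finset.card_filter_le (Finset.univ : Finset (Fin 1)) fun j => blockWire 1 κ l k j ∈ h
    rw [Finset.card_univ, Fintype.card_fin] at this
    omega
  · obtain ⟨s, rfl⟩ := hm.two_dvd
    rcases Nat.eq_zero_or_pos s with rfl | hs
    · left
      simp
    obtain ⟨u, hu⟩ := exists_layerOffset_add_eq (s := s) l k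
    have hs2 : (2 * s + 1) / 2 = s := by omega
    have hdiv : ∀ j : Fin (2 * s), (blockWire (2 * s) κ l k j : ℕ) / s =
        (u + j / s) % (2 * κ) := fun j => by
      have : (blockWire (2 * s) κ l k j : ℕ) = s * ((u + j / s) % (2 * κ)) + j % s := by
        rw [← mul_add_mod_mul]
        simp only [blockWire]
        rw [hu]
        congr 1
        ring
      rw [this, Nat.mul_add_div hs, Nat.div_eq_of_lt (Nat.mod_lt _ hs), add_zero]
    have hsame : ∀ j j' : Fin (2 * s), (j : ℕ) / s = j' / s →
        (blockWire (2 * s) κ l k j ∈ h ↔ blockWire (2 * s) κ l k j' ∈ h) := fun j j' hjj => by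
      constructor
      · exact hh _ _ (by rw [hs2, hdiv, hdiv, hjj])
      · exact hh _ _ (by rw [hs2, hdiv, hdiv, hjj])
    have key : ∀ j : Fin (2 * s), blockWire (2 * s) κ l k j ∈ h ↔
        if (j : ℕ) < s then blockWire (2 * s) κ l k ⟨0, by omega⟩ ∈ h
        else blockWire (2 * s) κ l k ⟨s, by omega⟩ ∈ h := fun j => by
      have hj := j.2
      split_ifs with hjs
      · exact hsame _ _ (by rw [Nat.div_eq_of_lt hjs]; simp)
      · refine hsame _ _ ?_
        rw [Nat.div_self hs]
        exact Nat.div_eq_of_lt_le (by omega) (by omega)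
    have hcard : (Finset.univ.filter fun j : Fin (2 * s) => (j : ℕ) < s).card = s := by
      rw [Fin.card_filter_val_lt]
      omega
    have hcard' : (Finset.univ.filter fun j : Fin (2 * s) => ¬(j : ℕ) < s).card = s := by
      have := Finset.card_filter_add_card_filter_not (s := (Finset.univ : Finset (Fin (2 * s))))
        fun j => (j : ℕ) < s
      rw [hcard, Finset.card_univ, Fintype.card_fin] at this
      omega
    rw [Finset.filter_congr fun j _ => key j]
    by_cases h1 : blockWire (2 * s) κ l k ⟨0, by omega⟩ ∈ h <;>
      by_cases h2 : blockWire (2 * s) κ l k ⟨s, by omega⟩ ∈ h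
    · right; right
      simp only [h1, h2, ite_self, Finset.filter_true, Finset.card_univ, Fintype.card_fin]
    · right; left
      simp only [h1, h2, if_false_right, and_true, hcard]
    · right; left
      simp only [h1, h2, if_false_left, and_true, hcard']
    · left
      simp only [h1, h2, ite_self, Finset.filter_false, Finset.card_empty]

/-- The qubits within distance `t ⌊m/2⌋` of block `k` of layer `d`, where positions are counted
cyclically. -/
def InWindow (m κ d : ℕ) (k : Fin κ) (t : ℕ) (q : Fin (m * κ)) : Prop :=
  ∃ x : ℤ, (layerOffset m d + k * m : ℕ) - (t * (m / 2) : ℕ) ≤ x ∧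
    x < (layerOffset m d + k * m + m + t * (m / 2) : ℕ) ∧ x ≡ q [ZMOD (m * κ : ℕ)]

theorem card_le_of_inWindow {d t : ℕ} {k : Fin κ} {h : Finset (Fin (m * κ))}
    (hh : ∀ q ∈ h, InWindow m κ d k t q) : h.card ≤ m + 2 * (t * (m / 2)) := by
  classical
  set lo : ℤ := ((layerOffset m d + k * m : ℕ) : ℤ) - (t * (m / 2) : ℕ) with hlo
  set hi : ℤ := ((layerOffset m d + k * m + m + t * (m / 2) : ℕ) : ℤ) with hhi
  have h1 : h.image (fun q : Fin (m * κ) => (q : ℤ)) ⊆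
      (Finset.Ico lo hi).image fun x => x % (m * κ : ℕ) := by
    intro y hy
    obtain ⟨q, hq, rfl⟩ := Finset.mem_image.mp hy
    obtain ⟨x, hx1, hx2, hx3⟩ := hh q hq
    refine Finset.mem_image.mpr ⟨x, Finset.mem_Ico.mpr ⟨hx1, hx2⟩, ?_⟩
    rw [hx3]
    exact Int.emod_eq_of_lt (by positivity) (by exact_mod_cast q.2)
  have h2 := (Finset.card_le_card h1).trans Finset.card_image_le
  rw [Finset.card_image_of_injective _ fun a b hab => Fin.ext (by exact_mod_cast hab),
    Int.card_Ico] at h2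
  refine h2.trans ?_
  rw [hlo, hhi]
  generalize t * (m / 2) = w
  generalize layerOffset m d + k * m = o
  omega

theorem inWindow_blockSupport (d : ℕ) (k : Fin κ) {q : Fin (m * κ)}
    (hq : q ∈ blockSupport m κ d k) : InWindow m κ d k 0 q := by
  obtain ⟨j, rfl⟩ := mem_blockSupport.mp hq
  refine ⟨(layerOffset m d + k * m + j : ℕ), ?_, ?_, ?_⟩
  · push_cast
    simp
  · have := j.2
    push_cast
    simp
  · simp only [blockWire]
    rw [Int.natCast_mod]
    exact (Int.mod_modEq _ _).symm

theorem InWindow.mono {d t t' : ℕ} {k : Fin κ} {q : Fin (m * κ)} (ht : t ≤ t')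
    (h : InWindow m κ d k t q) : InWindow m κ d k t' q := by
  obtain ⟨x, h1, h2, h3⟩ := h
  have : (t * (m / 2) : ℕ) ≤ t' * (m / 2) := Nat.mul_le_mul_right _ ht
  refine ⟨x, ?_, ?_, h3⟩
  · zify at this
    push_cast at h1 ⊢
    linarith
  · zify at this
    push_cast at h2 ⊢
    linarith

theorem dvd_layerOffset (hm : m = 1 ∨ Even m) (l t : ℕ) :
    (m : ℤ) ∣ layerOffset m l - layerOffset m (l + t) + t * (m / 2 : ℕ) := by
  rcases hm with rfl | hm
  · simp
  · obtain ⟨s, rfl⟩ := hm.two_dvd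
    have hs : 2 * s / 2 = s := by omega
    simp only [layerOffset, hs]
    rcases Nat.even_or_odd l with hl | hl <;> rcases Nat.even_or_odd t with ht | ht
    · rw [if_neg (by simpa using hl), if_neg (by simpa using hl.add ht)]
      obtain ⟨t, rfl⟩ := ht.two_dvd
      exact ⟨t, by push_cast; ring⟩
    · rw [if_neg (by simpa using hl), if_pos (hl.add_odd ht)]
      obtain ⟨t, rfl⟩ := ht
      exact ⟨t + 1, by push_cast; ring⟩
    · rw [if_pos hl, if_pos (hl.add_even ht)]
      obtain ⟨t, rfl⟩ := ht.two_dvd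
      exact ⟨t, by push_cast; ring⟩
    · rw [if_pos hl, if_neg (by simpa using hl.add_odd ht)]
      obtain ⟨t, rfl⟩ := ht
      exact ⟨t, by push_cast; ring⟩

/-- One layer further back, a block that meets the light cone window lies in the next window. -/
theorem InWindow.block (hm : m = 1 ∨ Even m) {l t : ℕ} {k k' : Fin κ} {q q' : Fin (m * κ)}
    (hq : q ∈ blockSupport m κ l k') (hq' : q' ∈ blockSupport m κ l k')
    (hw : InWindow m κ (l + (t + 1)) k t q) : InWindow m κ (l + (t + 1)) k (t + 1) q' := by
  obtain ⟨j, rfl⟩ := mem_blockSupport.mp hq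
  obtain ⟨j', rfl⟩ := mem_blockSupport.mp hq'
  unfold InWindow at hw ⊢
  obtain ⟨x, h1, h2, h3⟩ := hw
  have hcong : ∀ j : Fin m, ((blockWire m κ l k' j : ℕ) : ℤ) ≡
      (layerOffset m l + k' * m + j : ℕ) [ZMOD (m * κ : ℕ)] := fun j => by
    simp only [blockWire]
    rw [Int.natCast_mod]
    exact Int.mod_modEq _ _
  obtain ⟨δ, hδ⟩ := ((h3.trans (hcong j)).symm).dvd
  obtain ⟨w, hw⟩ := dvd_layerOffset hm l (t + 1)
  have hj := j.2
  have hj' := j'.2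
  have hm0 : 0 < m := j.pos
  have hhalf : m = 1 ∧ m / 2 = 0 ∨ m = 2 * (m / 2) := by
    rcases hm with rfl | hm
    · left; simp
    · right
      obtain ⟨s, rfl⟩ := hm.two_dvd
      omega
  generalize m / 2 = s at *
  -- the start of the block, in the lift of the cyclic order that contains `x`
  set p : ℤ := x - j with hp
  have hpt : ∃ v : ℤ, p - (layerOffset m (l + (t + 1)) + k * m - (t + 1) * s) = m * v := by
    refine ⟨k' - k + κ * δ + w, ?_⟩
    push_cast at hδ hw ⊢
    have : x = layerOffset m l + k' * m + j + m * κ * δ := by linarith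
    rw [hp, this]
    linear_combination hw
  obtain ⟨v, hv⟩ := hpt
  push_cast at h1 h2
  have hjz : (j : ℤ) + 1 ≤ m := by exact_mod_cast hj
  have hjz' : (j' : ℤ) + 1 ≤ m := by exact_mod_cast hj'
  have hm0' : (0 : ℤ) < m := by exact_mod_cast hm0
  have hs0 : (0 : ℤ) ≤ s := by positivity
  have hv0 : 0 ≤ v := by
    by_contra hneg
    have : (m : ℤ) * v ≤ m * (-1) := mul_le_mul_of_nonneg_left (by omega) hm0'.le
    nlinarith
  have hupper : p + m ≤ layerOffset m (l + (t + 1)) + k * m + m + (t + 1) * s := by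
    have hr : ∃ z : ℤ, (m : ℤ) + 2 * ((t + 1) * s) = m * z := by
      rcases hhalf with ⟨h, h'⟩ | h
      · exact ⟨1, by simp [h']⟩
      · refine ⟨1 + (t + 1), ?_⟩
        have : (m : ℤ) = 2 * s := by exact_mod_cast h
        rw [this]
        ring
    obtain ⟨z, hz⟩ := hr
    have hpos : 0 < (m : ℤ) * (z - v) := by nlinarith
    have : 1 ≤ z - v := by
      have := pos_of_mul_pos_right hpos hm0'.le
      omega
    nlinarith
  refine ⟨p + j', ?_, ?_, ?_⟩
  · push_cast
    nlinarith [mul_nonneg hm0'.le hv0]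
  · push_cast
    linarith
  · refine Int.ModEq.symm ((hcong j').trans ?_)
    refine (Int.modEq_iff_dvd).mpr ⟨δ, ?_⟩
    rw [← hδ, hp]
    push_cast
    ring

end geometry

/-! ### Evolution of the swap coefficients through the light cone -/

/-- The effect on the coefficients of a combination of partial swaps of averaging over a gate with
`m` qubits and support `β`. -/
noncomputable def stepCoef {n : ℕ} (m : ℕ) (β : Finset (Fin n)) (c : Finset (Fin n) → ℝ) :
    Finset (Fin n) → ℝ := fun h' => ∑ h, c h *
  ((if h' = h \ β then keepCoef m (h ∩ β).card else 0) +
    if h' = h ∪ β then fillCoef m (h ∩ β).card else 0)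

section stepCoef

variable {n m : ℕ} {β : Finset (Fin n)} {c : Finset (Fin n) → ℝ}

theorem swapSum_stepCoef (m : ℕ) (β : Finset (Fin n)) (c : Finset (Fin n) → ℝ) :
    swapSum (stepCoef m β c) = ∑ h, (c h : ℂ) •
      ((keepCoef m (h ∩ β).card : ℂ) • swapOn (h \ β) +
        (fillCoef m (h ∩ β).card : ℂ) • swapOn (h ∪ β)) := by
  simp only [swapSum, stepCoef, Complex.ofReal_sum, Finset.sum_smul]
  rw [Finset.sum_comm]
  refine Finset.sum_congr rfl fun h _ => ?_
  simp only [Complex.ofReal_mul, Complex.ofReal_add, mul_smul, add_smul, ← Finset.smul_sum,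
    Finset.sum_add_distrib, apply_ite Complex.ofReal, Complex.ofReal_zero, ite_smul, zero_smul,
    Finset.sum_ite_eq', Finset.mem_univ, if_true]

theorem exists_of_stepCoef_ne_zero {h' : Finset (Fin n)} (hne : stepCoef m β c h' ≠ 0) :
    ∃ h, c h ≠ 0 ∧ (h' = h \ β ∨ (h' = h ∪ β ∧ ¬Disjoint h β)) := by
  obtain ⟨h, -, hh⟩ := Finset.exists_ne_zero_of_sum_ne_zero hne
  refine ⟨h, left_ne_zero_of_mul hh, ?_⟩
  by_contra! hcon
  refine hh ?_
  rw [if_neg hcon.1, zero_add]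
  split_ifs with h1
  · rw [Finset.disjoint_iff_inter_eq_empty.mp (hcon.2 h1), Finset.card_empty, fillCoef_zero,
      mul_zero]
  · exact mul_zero _

theorem stepCoef_term_nonneg (hβ : β.card ≤ m) (hc : ∀ h : Finset (Fin n), h.Nonempty → 0 ≤ c h)
    {h' : Finset (Fin n)} (hh' : h'.Nonempty) (h : Finset (Fin n)) :
    0 ≤ c h * ((if h' = h \ β then keepCoef m (h ∩ β).card else 0) +
      if h' = h ∪ β then fillCoef m (h ∩ β).card else 0) := by
  rcases h.eq_empty_or_nonempty with rfl | hh
  · rw [Finset.empty_sdiff, if_neg hh'.ne_empty, Finset.empty_inter, Finset.card_empty,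
      fillCoef_zero, ite_self, add_zero, mul_zero]
  · refine mul_nonneg (hc h hh) (add_nonneg ?_ ?_)
    · split_ifs
      · exact keepCoef_nonneg ((Finset.card_le_card Finset.inter_subset_right).trans hβ)
      · exact le_rfl
    · split_ifs
      · exact fillCoef_nonneg _ _
      · exact le_rfl

theorem stepCoef_nonneg (hβ : β.card ≤ m) (hc : ∀ h : Finset (Fin n), h.Nonempty → 0 ≤ c h)
    {h' : Finset (Fin n)} (hh' : h'.Nonempty) : 0 ≤ stepCoef m β c h' :=
  Finset.sum_nonneg fun h _ => stepCoef_term_nonneg hβ hc hh' h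

theorem le_stepCoef_of_disjoint (hm : 1 ≤ m) (hβ : β.card ≤ m)
    (hc : ∀ h : Finset (Fin n), h.Nonempty → 0 ≤ c h) {h : Finset (Fin n)} (hh : h.Nonempty)
    (hd : Disjoint h β) : c h ≤ stepCoef m β c h := by
  refine le_trans ?_ (Finset.single_le_sum
    (fun h₀ _ => stepCoef_term_nonneg hβ hc hh h₀) (Finset.mem_univ h))
  rw [Finset.disjoint_iff_inter_eq_empty.mp hd, Finset.card_empty, keepCoef_zero hm, fillCoef_zero,
    ite_self, add_zero, if_pos (Finset.sdiff_eq_self_of_disjoint hd).symm, mul_one]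

theorem le_stepCoef_union (hβ : β.card ≤ m)
    (hc : ∀ h : Finset (Fin n), h.Nonempty → 0 ≤ c h) {h : Finset (Fin n)} (hh : h.Nonempty) :
    c h * fillCoef m (h ∩ β).card ≤ stepCoef m β c (h ∪ β) := by
  refine le_trans ?_ (Finset.single_le_sum
    (fun h₀ _ => stepCoef_term_nonneg hβ hc (hh.mono Finset.subset_union_left) h₀)
    (Finset.mem_univ h))
  refine mul_le_mul_of_nonneg_left ?_ (hc h hh)
  rw [if_pos rfl]
  refine le_add_of_nonneg_left ?_
  split_ifs
  · exact keepCoef_nonneg ((Finset.card_le_card Finset.inter_subset_right).trans hβ)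
  · exact le_rfl

end stepCoef

/-- The weight of the full swap after twirling a block half of which is swapped. -/
noncomputable def halfCoef (m : ℕ) : ℝ := √(2 ^ m) / (2 ^ m + 1)

theorem fillCoef_half {m r : ℕ} (hm : 1 ≤ m) (hr : 2 * r = m) : fillCoef m r = halfCoef m := by
  subst hr
  have h4 : (4 : ℝ) ^ (2 * r) = (2 ^ r) ^ 4 := by
    rw [← pow_mul, show (4 : ℝ) = 2 ^ 2 by norm_num, ← pow_mul]
    congr 1
    ring
  have h2 : (2 : ℝ) ^ (2 * r) = (2 ^ r) ^ 2 := by rw [mul_comm, pow_mul]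
  have hx : (2 : ℝ) ≤ 2 ^ r := by
    simpa using pow_le_pow_right₀ (show (1 : ℝ) ≤ 2 by norm_num) (show 1 ≤ r by omega)
  rw [fillCoef, halfCoef, h4, h2, Real.sqrt_sq (by positivity)]
  generalize (2 : ℝ) ^ r = x at hx
  have h1 : x - 1 ≠ 0 := by linarith
  have h3 : x + 1 ≠ 0 := by linarith
  have h5 : x ^ 2 + 1 ≠ 0 := by positivity
  have h6 : x ≠ 0 := by linarith
  rw [show x ^ 4 - 1 = (x - 1) * (x + 1) * (x ^ 2 + 1) by ring]
  field_simp
  ring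

/-- What is known about the coefficients `c_h` of the second moment after averaging over the
layers after layer `l` and over the blocks of layer `l` with numbers in `S`: the coefficients of
nonempty sets are nonnegative, the sets that occur lie in the light cone and contain or avoid each
block already treated, and one union of half blocks, of `m (J + 2) / 2` qubits that satisfy `R`, has
coefficient at least `2 ^ m / (4 ^ m - 1) * halfCoef m ^ J`. -/
structure LayerInv (bc : Boundary) (m κ d : ℕ) (k : Fin κ) (l : ℕ) (S : Finset (Fin κ))
    (R : Fin (m * κ) → Prop) (c : Finset (Fin (m * κ)) → ℝ) : Prop where
  nonneg : ∀ h : Finset (Fin (m * κ)), h.Nonempty → 0 ≤ c h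
  cone : ∀ h, c h ≠ 0 → ∀ q ∈ h, ∃ l' k', l ≤ l' ∧ InLightCone bc m κ d k l' k' ∧
    q ∈ blockSupport m κ l' k'
  saturated : ∀ h, c h ≠ 0 → ∀ k' ∈ S, HasBlock bc m κ l k' →
    Disjoint h (blockSupport m κ l k') ∨ blockSupport m κ l k' ⊆ h
  star : ∃ (h : Finset (Fin (m * κ))) (J : ℕ), SegClosed h ∧ 2 * h.card = m * (J + 2) ∧
    (∀ q ∈ h, R q) ∧ 2 ^ m / (4 ^ m - 1) * halfCoef m ^ J ≤ c h

section LayerInv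

variable {bc : Boundary} {m κ d : ℕ} {k : Fin κ} {l : ℕ} {S : Finset (Fin κ)}
  {R R' : Fin (m * κ) → Prop} {c : Finset (Fin (m * κ)) → ℝ}

/-- The invariant holds after averaging over the truncated block. -/
theorem LayerInv.start (hm : m = 1 ∨ Even m) (hm1 : 1 ≤ m) :
    LayerInv bc m κ d k d Finset.univ (InWindow m κ d k 0)
      (twoCoef (blockSupport m κ d k) (-1 / (4 ^ m - 1)) (2 ^ m / (4 ^ m - 1))) := by
  have hcases : ∀ h, twoCoef (blockSupport m κ d k) (-1 / (4 ^ m - 1)) (2 ^ m / (4 ^ m - 1)) h ≠ 0 →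
      h = ∅ ∨ h = blockSupport m κ d k := fun h hne => by
    by_contra! hcon
    exact hne (by simp [twoCoef, hcon.1.ne_empty, hcon.2])
  have h4 : (1 : ℝ) ≤ 4 ^ m := one_le_pow₀ (by norm_num)
  have hb : (0 : ℝ) ≤ 2 ^ m / (4 ^ m - 1) := div_nonneg (by positivity) (by linarith)
  refine ⟨fun h hh => ?_, fun h hne q hq => ?_, fun h hne k' _ _ => ?_,
    blockSupport m κ d k, 0, segClosed_blockSupport hm d k, ?_, fun q => inWindow_blockSupport d k,
    ?_⟩
  · simp only [twoCoef, Pi.add_apply, Pi.single_apply, if_neg hh.ne_empty, zero_add]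
    split_ifs
    · exact hb
    · exact le_rfl
  · rcases hcases h hne with rfl | rfl
    · simp at hq
    · exact ⟨d, k, le_rfl, .self, hq⟩
  · rcases hcases h hne with rfl | rfl
    · exact .inl (Finset.disjoint_empty_left _)
    · by_cases hk : k = k'
      · exact .inr (by rw [hk])
      · exact .inl (Finset.disjoint_left.mpr fun q hq hq' => hk (eq_of_mem_blockSupport hq hq'))
  · rw [card_blockSupport]
    ring
  · have hne : blockSupport m κ d k ≠ ∅ := fun h => by
      have := card_blockSupport (m := m) d k
      rw [h, Finset.card_empty] at this
      omega
    simp [twoCoef, hne]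

theorem LayerInv.mono (h : LayerInv bc m κ d k l S R c) (hR : ∀ q, R q → R' q) :
    LayerInv bc m κ d k l S R' c := by
  obtain ⟨h₀, J, h1, h2, h3, h4⟩ := h.star
  exact ⟨h.nonneg, h.cone, h.saturated, h₀, J, h1, h2, fun q hq => hR q (h3 q hq), h4⟩

theorem LayerInv.next (h : LayerInv bc m κ d k (l + 1) S R c) (hR : ∀ q, R q → R' q) :
    LayerInv bc m κ d k l ∅ R' c := by
  have h' := h.mono hR
  refine ⟨h'.nonneg, fun h₀ hne q hq => ?_, fun _ _ k' hk' => absurd hk' (Finset.notMem_empty k'),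
    h'.star⟩
  obtain ⟨l', k', hl, h1, h2⟩ := h'.cone h₀ hne q hq
  exact ⟨l', k', by omega, h1, h2⟩

/-- An absent block is treated by doing nothing. -/
theorem LayerInv.absent (h : LayerInv bc m κ d k l S R c) {k' : Fin κ}
    (hk' : ¬HasBlock bc m κ l k') : LayerInv bc m κ d k l (insert k' S) R c := by
  refine ⟨h.nonneg, h.cone, fun h₀ hne k'' hk'' hb => ?_, h.star⟩
  rcases Finset.mem_insert.mp hk'' with rfl | hk''
  · exact absurd hb hk'
  · exact h.saturated h₀ hne k'' hk'' hb

/-- A block that meets one of the sets that occur lies in the light cone. -/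
theorem LayerInv.inLightCone (h : LayerInv bc m κ d k l S R c) (hl : 1 ≤ l) {k' : Fin κ}
    (hb : HasBlock bc m κ l k') {h₀ : Finset (Fin (m * κ))} (hne : c h₀ ≠ 0)
    (hd : ¬Disjoint h₀ (blockSupport m κ l k')) : InLightCone bc m κ d k l k' := by
  obtain ⟨q, hq, hq'⟩ := Finset.not_disjoint_iff.mp hd
  obtain ⟨l', k'', hll, hcone, hmem⟩ := h.cone h₀ hne q hq
  rcases hll.eq_or_lt with rfl | hlt
  · rwa [eq_of_mem_blockSupport hq' hmem]
  · exact hcone.step hl hlt hb (Finset.not_disjoint_iff.mpr ⟨q, hq', hmem⟩)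

/-- The invariant survives averaging over one more block of layer `l`. -/
theorem LayerInv.step (h : LayerInv bc m κ d k l S R c) (hm : m = 1 ∨ Even m) (hm1 : 1 ≤ m)
    (hl : 1 ≤ l) {k' : Fin κ} (hb : HasBlock bc m κ l k')
    (hR : ∀ q ∈ blockSupport m κ l k', R q → ∀ q' ∈ blockSupport m κ l k', R q') :
    LayerInv bc m κ d k l (insert k' S) R (stepCoef m (blockSupport m κ l k') c) := by
  set β := blockSupport m κ l k' with hβ
  have hcard : β.card ≤ m := (card_blockSupport l k').le
  refine ⟨fun h₀ hh => stepCoef_nonneg hcard h.nonneg hh, fun h' hne q hq => ?_,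
    fun h' hne k'' hk'' hb'' => ?_, ?_⟩
  · obtain ⟨h₀, hne₀, rfl | ⟨rfl, hd⟩⟩ := exists_of_stepCoef_ne_zero hne
    · exact h.cone h₀ hne₀ q (Finset.sdiff_subset hq)
    · rcases Finset.mem_union.mp hq with hq | hq
      · exact h.cone h₀ hne₀ q hq
      · exact ⟨l, k', le_rfl, h.inLightCone hl hb hne₀ hd, hq⟩
  · by_cases hkk : k'' = k'
    · subst hkk
      obtain ⟨h₀, hne₀, rfl | ⟨rfl, hd⟩⟩ := exists_of_stepCoef_ne_zero hne
      · exact .inl Finset.sdiff_disjoint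
      · exact .inr Finset.subset_union_right
    · have hk''S : k'' ∈ S := Finset.mem_of_mem_insert_of_ne hk'' hkk
      have hdis : Disjoint β (blockSupport m κ l k'') :=
        Finset.disjoint_left.mpr fun q hq hq' => hkk (eq_of_mem_blockSupport hq hq').symm
      obtain ⟨h₀, hne₀, hh'⟩ := exists_of_stepCoef_ne_zero hne
      rcases h.saturated h₀ hne₀ k'' hk''S hb'' with hs | hs
      · left
        rcases hh' with rfl | ⟨rfl, -⟩
        · exact hs.mono_left Finset.sdiff_subset
        · exact Finset.disjoint_union_left.mpr ⟨hs, hdis⟩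
      · right
        rcases hh' with rfl | ⟨rfl, -⟩
        · exact fun q hq => Finset.mem_sdiff.mpr ⟨hs hq, Finset.disjoint_right.mp hdis hq⟩
        · exact hs.trans Finset.subset_union_left
  · obtain ⟨h₀, J, hseg, hcardh, hRh, hc⟩ := h.star
    have hne : h₀.Nonempty := by
      rw [← Finset.card_pos]
      have : 0 < m * (J + 2) := by positivity
      omega
    by_cases hd : Disjoint h₀ β
    · exact ⟨h₀, J, hseg, hcardh, hRh, hc.trans (le_stepCoef_of_disjoint hm1 hcard h.nonneg hne hd)⟩
    have hseg' : SegClosed (h₀ ∪ β) := hseg.union (segClosed_blockSupport hm l k')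
    have hR' : ∀ q ∈ h₀ ∪ β, R q := fun q hq => by
      rcases Finset.mem_union.mp hq with hq | hq
      · exact hRh q hq
      · obtain ⟨p, hp, hp'⟩ := Finset.not_disjoint_iff.mp hd
        exact hR p hp' (hRh p hp) q hq
    have hle := le_stepCoef_union hcard h.nonneg hne
    have hunion := Finset.card_union_add_card_inter h₀ β
    rw [hβ, card_blockSupport] at hunion
    rcases hseg.two_mul_card_inter hm l k' with hr | hr | hr
    · rw [Finset.card_eq_zero, ← Finset.disjoint_iff_inter_eq_empty] at hr
      exact absurd hr hd
    · refine ⟨h₀ ∪ β, J + 1, hseg', by rw [hβ]; linarith, hR', ?_⟩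
      rw [fillCoef_half hm1 hr] at hle
      refine le_trans ?_ hle
      rw [pow_succ, ← mul_assoc]
      exact mul_le_mul_of_nonneg_right hc (by unfold halfCoef; positivity)
    · refine ⟨h₀ ∪ β, J, hseg', by rw [hβ]; linarith, hR', ?_⟩
      rw [hr, fillCoef_self hm1, mul_one] at hle
      exact hc.trans hle

/-- After the first layer, the sets that occur are unions of supports of first-layer blocks in the
light cone. -/
theorem LayerInv.exists_eq_firstLayerRegion (h : LayerInv bc m κ d k 1 Finset.univ R c)
    {h₀ : Finset (Fin (m * κ))} (hne : c h₀ ≠ 0) :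
    ∃ A : Finset (Fin κ), (∀ a ∈ A, InLightCone bc m κ d k 1 a) ∧ h₀ = firstLayerRegion m κ A := by
  classical
  refine ⟨Finset.univ.filter fun a => ¬Disjoint h₀ (blockSupport m κ 1 a), fun a ha => ?_, ?_⟩
  · exact h.inLightCone le_rfl (hasBlock_one bc a) hne (Finset.mem_filter.mp ha).2
  · ext q
    simp only [firstLayerRegion, Finset.mem_biUnion, Finset.mem_filter, Finset.mem_univ, true_and]
    constructor
    · intro hq
      obtain ⟨a, ha⟩ := exists_mem_blockSupport_one q
      exact ⟨a, Finset.not_disjoint_iff.mpr ⟨q, hq, ha⟩, ha⟩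
    · rintro ⟨a, ha, hq⟩
      exact (h.saturated h₀ hne a (Finset.mem_univ a) (hasBlock_one bc a)).resolve_left ha hq

end LayerInv

/-! ### Averaging over the layered circuit -/

theorem conjBy_mul {n : ℕ} (A G B : QMatrix n) : conjBy (A * G) B = Gᴴ * conjBy A B * G := by
  simp only [conjBy, Matrix.conjTranspose_mul, Matrix.mul_assoc]

section moments

variable {Ω : Type*} {m₁ m₂ : MeasurableSpace Ω} [mΩ : MeasurableSpace Ω] {P : Measure Ω}
  [IsProbabilityMeasure P]

theorem expMat_conjBy_mul {n : ℕ} (h₁ : m₁ ≤ mΩ) (h₂ : m₂ ≤ mΩ) (hind : Indep m₁ m₂ P)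
    {G A : Ω → QMatrix n} (hG : MatBddMeas m₁ G) (hA : MatBddMeas m₂ A) (B : QMatrix n) :
    expMat P (fun ω => conjBy (A ω * G ω) B) =
      expMat P (fun ω => (G ω)ᴴ * expMat P (fun ω => conjBy (A ω) B) * G ω) := by
  simp only [conjBy_mul]
  exact expMat_sandwich h₁ h₂ hind hG (hA.conjBy (.const B))

theorem expMat_conjBy_mul_kronecker {n : ℕ} (h₁ : m₁ ≤ mΩ) (h₂ : m₂ ≤ mΩ) (hind : Indep m₁ m₂ P)
    {G A : Ω → QMatrix n} (hG : MatBddMeas m₁ G) (hA : MatBddMeas m₂ A) (B : QMatrix n) :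
    expMat P (fun ω => conjBy (A ω * G ω) B ⊗ₖ conjBy (A ω * G ω) B) =
      expMat P (fun ω => (G ω ⊗ₖ G ω)ᴴ *
        expMat P (fun ω => conjBy (A ω) B ⊗ₖ conjBy (A ω) B) * (G ω ⊗ₖ G ω)) := by
  have h : ∀ ω, conjBy (A ω * G ω) B ⊗ₖ conjBy (A ω * G ω) B =
      (G ω ⊗ₖ G ω)ᴴ * (conjBy (A ω) B ⊗ₖ conjBy (A ω) B) * (G ω ⊗ₖ G ω) := fun ω => by
    simp only [conjBy_mul, Matrix.conjTranspose_kronecker, Matrix.mul_kronecker_mul]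
  simp only [h]
  exact expMat_sandwich h₁ h₂ hind (hG.kronecker hG)
    ((hA.conjBy (.const B)).kronecker (hA.conjBy (.const B)))

end moments

theorem matBddMeas_localOp {Ω : Type*} {m' : MeasurableSpace Ω} {r n : ℕ} (e : Fin r → Fin n)
    {V : Ω → QUnitary r} (hV : Measurable[m'] V) :
    MatBddMeas m' fun ω => localOp e (V ω : QMatrix r) := fun x y => by
  simp only [localOp]
  split_ifs
  · exact MatBddMeas.of_unitary hV _ _
  · exact .const 0

/-- The σ-algebra generated by the pieces in `T`. -/
noncomputable abbrev pieceSigma {Ω : Type*} {m κ : ℕ} (W : Piece κ → Ω → QUnitary m)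
    (T : Set (Piece κ)) : MeasurableSpace Ω :=
  ⨆ a ∈ T, MeasurableSpace.comap (W a) inferInstance

/-- The truncated block, the blocks of the layers after layer `l`, and the blocks of layer `l` with
numbers in `S`. -/
def donePieces {κ : ℕ} (l : ℕ) (S : Finset (Fin κ)) : Set (Piece κ) :=
  {a | a = .truncated ∨ ∃ l' k', a = .block l' k' ∧ (l < l' ∨ l' = l ∧ k' ∈ S)}

open Classical in
/-- The factor contributed by block `k'` of layer `l`; it is `1` if the block is absent. -/
noncomputable def gateOp (bc : Boundary) (m κ l : ℕ) (k' : Fin κ) (V : QUnitary m) :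
    QMatrix (m * κ) :=
  if HasBlock bc m κ l k' then localOp (blockWire m κ l k') (V : QMatrix m) else 1

open Classical in
/-- The effect on the swap coefficients of averaging over block `k'` of layer `l`. -/
noncomputable def gateCoef (bc : Boundary) (m κ l : ℕ) (c : Finset (Fin (m * κ)) → ℝ)
    (k' : Fin κ) : Finset (Fin (m * κ)) → ℝ :=
  if HasBlock bc m κ l k' then stepCoef m (blockSupport m κ l k') c else c

/-- The effect on the swap coefficients of averaging over the layers `l, l - 1, …, 1`. -/
noncomputable def layersCoef (bc : Boundary) (m κ : ℕ) :
    ℕ → (Finset (Fin (m * κ)) → ℝ) → Finset (Fin (m * κ)) → ℝ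
  | 0, c => c
  | l + 1, c => layersCoef bc m κ l ((List.finRange κ).foldl (gateCoef bc m κ (l + 1)) c)

section circuit

variable {Ω : Type*} {m κ : ℕ}

theorem measurable_pieceSigma (W : Piece κ → Ω → QUnitary m) {T : Set (Piece κ)} {a : Piece κ}
    (ha : a ∈ T) : Measurable[pieceSigma W T] (W a) :=
  (comap_measurable (W a)).mono (le_iSup₂_of_le a ha le_rfl) le_rfl

theorem pieceSigma_mono (W : Piece κ → Ω → QUnitary m) {T T' : Set (Piece κ)} (h : T ⊆ T') :
    pieceSigma W T ≤ pieceSigma W T' :=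
  iSup₂_le fun a ha => le_iSup₂_of_le a (h ha) le_rfl

variable [mΩ : MeasurableSpace Ω]

theorem pieceSigma_le {W : Piece κ → Ω → QUnitary m} (hW : ∀ a, Measurable (W a))
    (T : Set (Piece κ)) : pieceSigma W T ≤ mΩ :=
  iSup₂_le fun a _ => (hW a).comap_le

theorem indep_pieceSigma {P : Measure Ω} {W : Piece κ → Ω → QUnitary m}
    (hW : ∀ a, Measurable (W a)) (hind : iIndepFun W P) {T T' : Set (Piece κ)}
    (h : Disjoint T T') : Indep (pieceSigma W T) (pieceSigma W T') P :=
  indep_iSup_of_disjoint (fun a => (hW a).comap_le) hind.iIndep h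

variable {P : Measure Ω} [IsProbabilityMeasure P]

theorem expMat_sandwich_swapSum {n : ℕ} {β : Type*} {C : Ω → Matrix ((Fin n → Fin 2) ×
    (Fin n → Fin 2)) β ℂ} (hC : MatBddMeas mΩ C) (c : Finset (Fin n) → ℝ) :
    expMat P (fun ω => (C ω)ᴴ * swapSum c * C ω) =
      ∑ h, (c h : ℂ) • expMat P (fun ω => (C ω)ᴴ * swapOn h * C ω) := by
  ext a b
  simp only [Matrix.sum_apply, Matrix.smul_apply, expMat_sandwich_const_apply hC, swapSum,
    Finset.mul_sum, smul_eq_mul]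
  conv_rhs =>
    rw [Finset.sum_comm]
    enter [2, j]
    rw [Finset.sum_comm]
  refine Finset.sum_congr rfl fun j _ => Finset.sum_congr rfl fun i _ =>
    Finset.sum_congr rfl fun h _ => ?_
  ring

/-- The random operator `A` is the product of the truncated block, the layers after layer `l` and
the blocks of layer `l` with numbers in `S`, as far as the averages of `A† B A` are concerned: it
depends on these pieces only, its first moment vanishes, and its second moment is the combination of
partial swaps with coefficients `c`. -/
structure CircuitState (P : Measure Ω) (bc : Boundary) (m κ d : ℕ) (k : Fin κ)
    (W : Piece κ → Ω → QUnitary m) (B : QMatrix (m * κ)) (l : ℕ) (S : Finset (Fin κ))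
    (R : Fin (m * κ) → Prop) (c : Finset (Fin (m * κ)) → ℝ) (A : Ω → QMatrix (m * κ)) :
    Prop where
  meas : MatBddMeas (pieceSigma W (donePieces l S)) A
  mean : expMat P (fun ω => conjBy (A ω) B) = 0
  second : expMat P (fun ω => conjBy (A ω) B ⊗ₖ conjBy (A ω) B) = swapSum c
  inv : LayerInv bc m κ d k l S R c

variable {bc : Boundary} {d : ℕ} {k : Fin κ} {W : Piece κ → Ω → QUnitary m}
  {B : QMatrix (m * κ)} {l : ℕ} {S : Finset (Fin κ)} {R R' : Fin (m * κ) → Prop}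
  {c : Finset (Fin (m * κ)) → ℝ} {A : Ω → QMatrix (m * κ)}

theorem donePieces_insert (l : ℕ) (S : Finset (Fin κ)) (k' : Fin κ) :
    donePieces l S ⊆ donePieces l (insert k' S) := by
  rintro a (rfl | ⟨l', k'', rfl, h | ⟨rfl, h⟩⟩)
  · exact .inl rfl
  · exact .inr ⟨l', k'', rfl, .inl h⟩
  · exact .inr ⟨l', k'', rfl, .inr ⟨rfl, Finset.mem_insert_of_mem h⟩⟩

/-- Multiplication by one more block. Only the swaps that meet the block need it to be a design, and
then the block lies in the light cone. -/
theorem CircuitState.step (hA : CircuitState P bc m κ d k W B l S R c A)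
    (hW : ∀ a, Measurable (W a)) (hind : iIndepFun W P)
    (hd : ∀ a ∈ conePieces bc m κ d k, IsUnitaryDesign 2 (P.map (W a)))
    (hm : m = 1 ∨ Even m) (hm1 : 1 ≤ m) (hl : 1 ≤ l) (hld : l < d) {k' : Fin κ} (hk' : k' ∉ S)
    (hR : ∀ q ∈ blockSupport m κ l k', R q → ∀ q' ∈ blockSupport m κ l k', R q') :
    CircuitState P bc m κ d k W B l (insert k' S) R (gateCoef bc m κ l c k')
      (fun ω => A ω * gateOp bc m κ l k' (W (.block l k') ω)) := by
  have hmono := pieceSigma_mono W (donePieces_insert l S k')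
  by_cases hb : HasBlock bc m κ l k'
  swap
  · simp only [gateOp, gateCoef, if_neg hb, mul_one]
    exact ⟨hA.meas.mono hmono, hA.mean, hA.second, hA.inv.absent hb⟩
  simp only [gateOp, gateCoef, if_pos hb]
  have hmem : (Piece.block l k' : Piece κ) ∈ donePieces l (insert k' S) :=
    .inr ⟨l, k', rfl, .inr ⟨rfl, Finset.mem_insert_self k' S⟩⟩
  have hdisj : Disjoint {(Piece.block l k' : Piece κ)} (donePieces l S) := by
    refine Set.disjoint_singleton_left.mpr ?_
    rintro (h | ⟨l', k'', h, h'⟩)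
    · cases h
    · cases h
      rcases h' with h' | h'
      · exact lt_irrefl _ h'
      · exact hk' h'.2
  have hG : MatBddMeas (pieceSigma W {Piece.block l k'})
      (fun ω => localOp (blockWire m κ l k') (W (.block l k') ω : QMatrix m)) :=
    matBddMeas_localOp _ (measurable_pieceSigma W rfl)
  have hi := indep_pieceSigma hW hind hdisj
  refine ⟨(hA.meas.mono hmono).mul (matBddMeas_localOp _ (measurable_pieceSigma W hmem)), ?_, ?_,
    hA.inv.step hm hm1 hl hb hR⟩
  · rw [expMat_conjBy_mul (pieceSigma_le hW _) (pieceSigma_le hW _) hi hG hA.meas, hA.mean]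
    simp only [Matrix.mul_zero, Matrix.zero_mul, expMat_const]
  · rw [expMat_conjBy_mul_kronecker (pieceSigma_le hW _) (pieceSigma_le hW _) hi hG hA.meas,
      hA.second, expMat_sandwich_swapSum ((hG.kronecker hG).mono (pieceSigma_le hW _)),
      swapSum_stepCoef]
    refine Finset.sum_congr rfl fun h _ => ?_
    by_cases hc : c h = 0
    · simp [hc]
    · rw [expMat_conj_localOp_swapOn (blockWire_injective l k') hm1 (hW _)]
      · rfl
      · by_cases hdis : Disjoint h (blockSupport m κ l k')
        · exact .inr hdis
        · exact .inl (hd _ (.inr ⟨l, k', rfl, hld, hA.inv.inLightCone hl hb hc hdis⟩))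

theorem CircuitState.steps (hW : ∀ a, Measurable (W a)) (hind : iIndepFun W P)
    (hd : ∀ a ∈ conePieces bc m κ d k, IsUnitaryDesign 2 (P.map (W a)))
    (hm : m = 1 ∨ Even m) (hm1 : 1 ≤ m) (hl : 1 ≤ l) (hld : l < d)
    (hR : ∀ k', ∀ q ∈ blockSupport m κ l k', R q → ∀ q' ∈ blockSupport m κ l k', R q')
    (ks : List (Fin κ)) (hks : ks.Nodup) :
    ∀ {S : Finset (Fin κ)} {c : Finset (Fin (m * κ)) → ℝ} {A : Ω → QMatrix (m * κ)},
      (∀ k' ∈ ks, k' ∉ S) → CircuitState P bc m κ d k W B l S R c A →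
      CircuitState P bc m κ d k W B l (S ∪ ks.toFinset) R (ks.foldl (gateCoef bc m κ l) c)
        (fun ω => A ω * (ks.map fun k' => gateOp bc m κ l k' (W (.block l k') ω)).prod) := by
  induction ks with
  | nil =>
    intro S c A _ hA
    simpa using hA
  | cons k' ks ih =>
    intro S c A hS hA
    rw [List.nodup_cons] at hks
    have h1 := hA.step hW hind hd hm hm1 hl hld (hS k' List.mem_cons_self) (hR k')
    have h2 := ih hks.2 (S := insert k' S) (fun k'' hk'' hmem => by
      rcases Finset.mem_insert.mp hmem with rfl | hmem
      · exact hks.1 hk''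
      · exact hS k'' (List.mem_cons_of_mem _ hk'') hmem) h1
    have e : insert k' S ∪ ks.toFinset = S ∪ (k' :: ks).toFinset := by
      ext x
      simp only [Finset.mem_union, Finset.mem_insert, List.mem_toFinset, List.mem_cons]
      tauto
    simpa only [e, List.foldl_cons, List.map_cons, List.prod_cons, mul_assoc] using h2

theorem CircuitState.layer {t : ℕ} (hdl : d = l + (t + 1))
    (hA : CircuitState P bc m κ d k W B (l + 1) Finset.univ (InWindow m κ d k t) c A)
    (hW : ∀ a, Measurable (W a)) (hind : iIndepFun W P)
    (hd : ∀ a ∈ conePieces bc m κ d k, IsUnitaryDesign 2 (P.map (W a)))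
    (hm : m = 1 ∨ Even m) (hm1 : 1 ≤ m) (hl : 1 ≤ l) :
    CircuitState P bc m κ d k W B l Finset.univ (InWindow m κ d k (t + 1))
      ((List.finRange κ).foldl (gateCoef bc m κ l) c)
      (fun ω => A ω * layerOp bc m κ l fun k' => W (.block l k') ω) := by
  -- the window of the previous layer, enlarged by the blocks of layer `l` that meet it
  set R : Fin (m * κ) → Prop := fun q => InWindow m κ d k t q ∨
    ∃ k', q ∈ blockSupport m κ l k' ∧ ∃ p ∈ blockSupport m κ l k', InWindow m κ d k t p with hRdef
  have hsub : donePieces (l + 1) (Finset.univ : Finset (Fin κ)) ⊆ donePieces l ∅ := by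
    rintro a (rfl | ⟨l', k', rfl, h⟩)
    · exact .inl rfl
    · exact .inr ⟨l', k', rfl, .inl (by omega)⟩
  have h0 : CircuitState P bc m κ d k W B l ∅ R c A :=
    ⟨hA.meas.mono (pieceSigma_mono W hsub), hA.mean, hA.second, hA.inv.next fun q hq => .inl hq⟩
  have h1 := CircuitState.steps hW hind hd hm hm1 hl (by omega) (fun k' q hq hRq q' hq' => by
    rcases hRq with h | ⟨k'', hqk, p, hp, hw⟩
    · exact .inr ⟨k', hq', q, hq, h⟩
    · rw [eq_of_mem_blockSupport hqk hq] at hp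
      exact .inr ⟨k', hq', p, hp, hw⟩) (List.finRange κ) (List.nodup_finRange κ)
    (fun k' _ => Finset.notMem_empty k') h0
  rw [Finset.empty_union, List.toFinset_finRange] at h1
  have hop : ∀ ω, layerOp bc m κ l (fun k' => W (.block l k') ω) =
      ((List.finRange κ).map fun k' => gateOp bc m κ l k' (W (.block l k') ω)).prod := fun ω => by
    rw [layerOp, List.ofFn_eq_map]
    rfl
  simp only [hop]
  refine ⟨h1.meas, h1.mean, h1.second, h1.inv.mono fun q hq => ?_⟩
  subst hdl
  rcases hq with hq | ⟨k', hqk, p, hp, hw⟩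
  · exact hq.mono (Nat.le_succ t)
  · exact hw.block hm hp hqk

theorem CircuitState.layers (hW : ∀ a, Measurable (W a)) (hind : iIndepFun W P)
    (hd : ∀ a ∈ conePieces bc m κ d k, IsUnitaryDesign 2 (P.map (W a)))
    (hm : m = 1 ∨ Even m) (hm1 : 1 ≤ m) (l : ℕ) :
    ∀ {t : ℕ} {c : Finset (Fin (m * κ)) → ℝ} {A : Ω → QMatrix (m * κ)}, d = l + 1 + t →
      CircuitState P bc m κ d k W B (l + 1) Finset.univ (InWindow m κ d k t) c A →
      CircuitState P bc m κ d k W B 1 Finset.univ (InWindow m κ d k (d - 1))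
        (layersCoef bc m κ l c) (fun ω => A ω * layersOp bc m κ (fun a => W a ω) l) := by
  induction l with
  | zero =>
    intro t c A hdl hA
    have : t = d - 1 := by omega
    subst this
    simpa only [layersOp, layersCoef, mul_one] using hA
  | succ l ih =>
    intro t c A hdl hA
    have h1 := hA.layer (by omega) hW hind hd hm hm1 (by omega)
    have h2 := ih (by omega) h1
    simpa only [layersOp, layersCoef, mul_assoc] using h2

/-- The swap coefficients of the second moment of the part of the circuit before a parameter in
block `k` of layer `d`. -/
noncomputable def circuitCoef (bc : Boundary) (m κ d : ℕ) (k : Fin κ) :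
    Finset (Fin (m * κ)) → ℝ :=
  layersCoef bc m κ (d - 1)
    (twoCoef (blockSupport m κ d k) (-1 / (4 ^ m - 1)) (2 ^ m / (4 ^ m - 1)))

theorem circuitState_circuitUpTo (hW : ∀ a, Measurable (W a)) (hind : iIndepFun W P)
    (hd : ∀ a ∈ conePieces bc m κ d k, IsUnitaryDesign 2 (P.map (W a)))
    (hm : m = 1 ∨ Even m) (hm1 : 1 ≤ m) (hd1 : 1 ≤ d) (j : Fin m) (σ : Pauli) :
    CircuitState P bc m κ d k W (pauliOn (blockWire m κ d k j) σ) 1 Finset.univ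
      (InWindow m κ d k (d - 1)) (circuitCoef bc m κ d k)
      (fun ω => circuitUpTo bc m κ d k fun a => W a ω) := by
  have hdt := hd .truncated (.inl rfl)
  have h0 : CircuitState P bc m κ d k W (pauliOn (blockWire m κ d k j) σ) d Finset.univ
      (InWindow m κ d k 0)
      (twoCoef (blockSupport m κ d k) (-1 / (4 ^ m - 1)) (2 ^ m / (4 ^ m - 1)))
      (fun ω => localOp (blockWire m κ d k) (W .truncated ω : QMatrix m)) := by
    refine ⟨matBddMeas_localOp _ (measurable_pieceSigma W (.inl rfl)),
      expMat_conj_localOp_pauliOn_eq_zero (blockWire_injective d k) (hW _) hdt j σ, ?_,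
      .start hm hm1⟩
    simp only [conjBy_kronecker]
    rw [expMat_conj_localOp_pauliOn (blockWire_injective d k) (hW _) hdt, swapSum_twoCoef]
    rfl
  obtain ⟨l, rfl⟩ : ∃ l, d = l + 1 := ⟨d - 1, by omega⟩
  exact CircuitState.layers hW hind hd hm hm1 l (by omega) h0

end circuit

/-! ### Lower bounds on the variance -/

/-- If purities are supermultiplicative, the sum that gives the variance is at least its diagonal
term at `h₀`, less the part of this term that belongs to the square `(∑ c_h P_h) ^ 2`. The
coefficient of `∅` may be negative; pairs with `∅` satisfy the inequalities with equality. -/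
theorem le_sum_of_purity_mul_le {n : ℕ} {c p : Finset (Fin n) → ℝ} (hp0 : p ∅ = 1)
    (hp : ∀ h, 0 ≤ p h) (hc : ∀ h : Finset (Fin n), h.Nonempty → 0 ≤ c h)
    (hmul : ∀ h h', c h ≠ 0 → c h' ≠ 0 →
      p h * p h' ≤ p ((h ∪ h') \ (h ∩ h')) ∧ p h * p h' ≤ p (h ∪ h'))
    (h₀ : Finset (Fin n)) :
    c h₀ ^ 2 * (2 ^ h₀.card - 1) * p h₀ ^ 2 ≤
      ∑ h, ∑ h', c h * c h' * (p ((h ∪ h') \ (h ∩ h')) + 2 ^ (h ∩ h').card * p (h ∪ h')) := by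
  have hpow : ∀ r : ℕ, (0 : ℝ) ≤ 2 ^ r - 1 := fun r =>
    sub_nonneg.mpr (one_le_pow₀ (by norm_num))
  have hcc : ∀ h h' : Finset (Fin n), h.Nonempty → h'.Nonempty → 0 ≤ c h * c h' :=
    fun h h' hh hh' => mul_nonneg (hc h hh) (hc h' hh')
  have hterm : ∀ h h', 2 * ((c h * p h) * (c h' * p h')) +
      c h * c h' * (2 ^ (h ∩ h').card - 1) * (p h * p h') ≤
      c h * c h' * (p ((h ∪ h') \ (h ∩ h')) + 2 ^ (h ∩ h').card * p (h ∪ h')) := fun h h' => by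
    rcases h.eq_empty_or_nonempty with rfl | hh
    · simp [hp0]
      linarith
    rcases h'.eq_empty_or_nonempty with rfl | hh'
    · simp [hp0]
      linarith
    by_cases h0 : c h = 0
    · simp [h0]
    by_cases h0' : c h' = 0
    · simp [h0']
    obtain ⟨h1, h2⟩ := hmul h h' h0 h0'
    have h3 : (2 : ℝ) ^ (h ∩ h').card * (p h * p h') ≤ 2 ^ (h ∩ h').card * p (h ∪ h') :=
      mul_le_mul_of_nonneg_left h2 (by positivity)
    have h4 := mul_le_mul_of_nonneg_left (add_le_add h1 h3) (hcc h h' hh hh')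
    linarith
  have hnn : ∀ h h', 0 ≤ c h * c h' * (2 ^ (h ∩ h').card - 1) * (p h * p h') := fun h h' => by
    rcases h.eq_empty_or_nonempty with rfl | hh
    · simp
    rcases h'.eq_empty_or_nonempty with rfl | hh'
    · simp
    exact mul_nonneg (mul_nonneg (hcc h h' hh hh') (hpow _)) (mul_nonneg (hp h) (hp h'))
  have hsq : ∑ h, ∑ h', 2 * ((c h * p h) * (c h' * p h')) = 2 * (∑ h, c h * p h) ^ 2 := by
    rw [sq, Finset.sum_mul_sum, Finset.mul_sum]
    exact Finset.sum_congr rfl fun h _ => by rw [Finset.mul_sum]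
  calc c h₀ ^ 2 * (2 ^ h₀.card - 1) * p h₀ ^ 2
      = c h₀ * c h₀ * (2 ^ (h₀ ∩ h₀).card - 1) * (p h₀ * p h₀) := by
        rw [Finset.inter_self]
        ring
    _ ≤ ∑ h', c h₀ * c h' * (2 ^ (h₀ ∩ h').card - 1) * (p h₀ * p h') :=
        Finset.single_le_sum (f := fun h' => c h₀ * c h' * (2 ^ (h₀ ∩ h').card - 1) *
          (p h₀ * p h')) (fun h' _ => hnn h₀ h') (Finset.mem_univ h₀)
    _ ≤ ∑ h, ∑ h', c h * c h' * (2 ^ (h ∩ h').card - 1) * (p h * p h') :=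
        Finset.single_le_sum (f := fun h => ∑ h', c h * c h' * (2 ^ (h ∩ h').card - 1) *
          (p h * p h')) (fun h _ => Finset.sum_nonneg fun h' _ => hnn h h') (Finset.mem_univ h₀)
    _ ≤ 2 * (∑ h, c h * p h) ^ 2 +
          ∑ h, ∑ h', c h * c h' * (2 ^ (h ∩ h').card - 1) * (p h * p h') :=
        le_add_of_nonneg_left (by positivity)
    _ = ∑ h, ∑ h', (2 * ((c h * p h) * (c h' * p h')) +
          c h * c h' * (2 ^ (h ∩ h').card - 1) * (p h * p h')) := by
        rw [← hsq, ← Finset.sum_add_distrib]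
        exact Finset.sum_congr rfl fun h _ => Finset.sum_add_distrib.symm
    _ ≤ _ := Finset.sum_le_sum fun h _ => Finset.sum_le_sum fun h' _ => hterm h h'

theorem IsProductPureState.purityProduct {bc : Boundary} {m κ d : ℕ} {k : Fin κ}
    {ρ : QMatrix (m * κ)} (hρ : IsProductPureState ρ) : PurityProduct bc m κ d k ρ := by
  intro A A' _ _
  simp [hρ.purity_eq_one]

theorem purityProduct_completelyMixed (bc : Boundary) (m κ d : ℕ) (k : Fin κ) :
    PurityProduct bc m κ d k (completelyMixed (m * κ)) := by
  intro A A' _ _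
  generalize firstLayerRegion m κ A = h
  generalize firstLayerRegion m κ A' = h'
  have key : ∀ s : Finset (Fin (m * κ)), s.card ≤ h.card + h'.card →
      purity (completelyMixed (m * κ)) h * purity (completelyMixed (m * κ)) h' ≤
        purity (completelyMixed (m * κ)) s := fun s hs => by
    rw [purity_completelyMixed, purity_completelyMixed, purity_completelyMixed, ← mul_inv,
      ← pow_add]
    exact inv_anti₀ (by positivity) (pow_le_pow_right₀ (by norm_num) hs)
  exact ⟨key _ ((Finset.card_le_card Finset.sdiff_subset).trans (Finset.card_union_le h h')),
    key _ (Finset.card_union_le h h')⟩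

/-- Enlarging the swapped set by half a block costs more in the coefficient than the factor
`2 ^ r - 1` gains. -/
theorem antitone_halfCoef_pow_mul {m : ℕ} (hm : 1 ≤ m) :
    Antitone fun J : ℕ => halfCoef m ^ (2 * J) * (√(2 ^ m) ^ (J + 2) - 1) := by
  refine antitone_nat_of_succ_le fun J => ?_
  have hD : (2 : ℝ) ≤ 2 ^ m := by
    simpa using pow_le_pow_right₀ (show (1 : ℝ) ≤ 2 by norm_num) hm
  have ht2 : √(2 ^ m) ^ 2 = (2 : ℝ) ^ m := Real.sq_sqrt (by positivity)
  have ht : 1 ≤ √((2 : ℝ) ^ m) := Real.one_le_sqrt.mpr (by linarith)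
  have hy : halfCoef m ^ (2 * (J + 1)) = halfCoef m ^ (2 * J) * halfCoef m ^ 2 := by
    rw [← pow_add]
    ring
  have hy0 : 0 ≤ halfCoef m ^ (2 * J) := by
    rw [pow_mul]
    positivity
  rw [hy, mul_assoc]
  refine mul_le_mul_of_nonneg_left ?_ hy0
  rw [halfCoef, div_pow, ht2, show J + 1 + 2 = (J + 2) + 1 by ring, pow_succ _ (J + 2)]
  have hu : (2 : ℝ) ^ m ≤ √((2 : ℝ) ^ m) ^ (J + 2) := by
    calc (2 : ℝ) ^ m = √((2 : ℝ) ^ m) ^ 2 := ht2.symm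
      _ ≤ _ := pow_le_pow_right₀ ht (by omega)
  generalize √((2 : ℝ) ^ m) ^ (J + 2) = u at *
  generalize √((2 : ℝ) ^ m) = t at *
  generalize (2 : ℝ) ^ m = D at *
  rw [div_mul_eq_mul_div, div_le_iff₀ (by positivity)]
  have h1 : u * t - 1 ≤ (D + 2) * (u - 1) := by
    rw [← ht2] at hD hu ⊢
    nlinarith [sq_nonneg (t - 1), mul_nonneg (show 0 ≤ u - 2 by linarith) (sq_nonneg (t - 1))]
  have h2 := mul_le_mul_of_nonneg_left h1 (show 0 ≤ D by linarith)
  nlinarith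

/-- The set with a large coefficient in `LayerInv.star` is made of `J + 2` half blocks and lies in a
window of `m * d` qubits, so `J ≤ 2 * (d - 1)`; the worst case is `J = 2 * (d - 1)`. -/
theorem LayerInv.exists_large {bc : Boundary} {m κ d : ℕ} {k : Fin κ} {c : Finset (Fin (m * κ)) → ℝ}
    (hm1 : 1 ≤ m) (hd1 : 1 ≤ d)
    (h : LayerInv bc m κ d k 1 Finset.univ (InWindow m κ d k (d - 1)) c) :
    ∃ h₀ : Finset (Fin (m * κ)), h₀.card ≤ m * d ∧
      2 ^ (2 * m * d) * (2 ^ (m * d) - 1) /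
          (2 * (2 ^ (2 * m) - 1) ^ 2 * (2 ^ m + 1) ^ (4 * (d - 1))) ≤
        1 / 2 * (c h₀ ^ 2 * (2 ^ h₀.card - 1)) := by
  obtain ⟨h₀, J, -, hcard, hwin, hc⟩ := h.star
  obtain ⟨e, rfl⟩ : ∃ e, d = e + 1 := ⟨d - 1, by omega⟩
  simp only [Nat.add_sub_cancel] at hwin ⊢
  have hle := card_le_of_inWindow hwin
  have hhalf : 2 * (e * (m / 2)) ≤ m * e := by
    have : 2 * (m / 2) ≤ m := Nat.mul_div_le m 2
    nlinarith
  have hJ : J ≤ 2 * e := by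
    have h1 : m * (J + 2) ≤ m * (2 * e + 2) := by nlinarith
    have := Nat.le_of_mul_le_mul_left h1 hm1
    omega
  refine ⟨h₀, by nlinarith, ?_⟩
  have hD : (2 : ℝ) ≤ 2 ^ m := by
    simpa using pow_le_pow_right₀ (show (1 : ℝ) ≤ 2 by norm_num) hm1
  have ht2 : √(2 ^ m) ^ 2 = (2 : ℝ) ^ m := Real.sq_sqrt (by positivity)
  have hpow : (2 : ℝ) ^ h₀.card = √(2 ^ m) ^ (J + 2) := by
    refine (pow_left_inj₀ (by positivity) (by positivity) two_ne_zero).mp ?_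
    rw [← pow_mul, mul_comm, hcard, ← pow_mul, mul_comm (J + 2) 2, pow_mul, pow_mul, ht2]
  have hb : (0 : ℝ) ≤ 2 ^ m / (4 ^ m - 1) * halfCoef m ^ J := by
    have : (1 : ℝ) ≤ 4 ^ m := one_le_pow₀ (by norm_num)
    exact mul_nonneg (div_nonneg (by positivity) (by linarith)) (by unfold halfCoef; positivity)
  have hanti := antitone_halfCoef_pow_mul hm1 hJ
  have hpow1 : (1 : ℝ) ≤ 2 ^ h₀.card := one_le_pow₀ (by norm_num)
  have h4 : (4 : ℝ) ^ m = 2 ^ (2 * m) := by rw [pow_mul]; norm_num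
  have hval : halfCoef m ^ (2 * (2 * e)) * (√(2 ^ m) ^ (2 * e + 2) - 1) =
      (2 ^ m) ^ (2 * e) / (2 ^ m + 1) ^ (4 * e) * (2 ^ (m * (e + 1)) - 1) := by
    have h1 : (((2 : ℝ) ^ m + 1) ^ 2) ^ (2 * e) = (2 ^ m + 1) ^ (4 * e) := by
      rw [← pow_mul]
      congr 1
      ring
    have h2 : √((2 : ℝ) ^ m) ^ (2 * e + 2) = 2 ^ (m * (e + 1)) := by
      rw [show 2 * e + 2 = 2 * (e + 1) by ring, pow_mul, ht2, ← pow_mul]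
    rw [pow_mul, halfCoef, div_pow, ht2, div_pow, h1, h2]
  calc (2 : ℝ) ^ (2 * m * (e + 1)) * (2 ^ (m * (e + 1)) - 1) /
        (2 * (2 ^ (2 * m) - 1) ^ 2 * (2 ^ m + 1) ^ (4 * e))
      = 1 / 2 * ((2 ^ m / (4 ^ m - 1)) ^ 2 *
          (halfCoef m ^ (2 * (2 * e)) * (√(2 ^ m) ^ (2 * e + 2) - 1))) := by
        rw [hval, h4, div_pow, show 2 * m * (e + 1) = m * 2 + m * (2 * e) by ring, pow_add,
          pow_mul, pow_mul]
        have h1 : (2 : ℝ) ^ (2 * m) - 1 ≠ 0 := by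
          rw [← h4]
          exact four_pow_sub_one_ne_zero hm1
        field_simp
    _ ≤ 1 / 2 * ((2 ^ m / (4 ^ m - 1)) ^ 2 *
          (halfCoef m ^ (2 * J) * (√(2 ^ m) ^ (J + 2) - 1))) := by
        gcongr
    _ = 1 / 2 * ((2 ^ m / (4 ^ m - 1) * halfCoef m ^ J) ^ 2 * (2 ^ h₀.card - 1)) := by
        rw [hpow, mul_pow, ← pow_mul, mul_comm J 2]
        ring
    _ ≤ 1 / 2 * (c h₀ ^ 2 * (2 ^ h₀.card - 1)) := by
        have := pow_le_pow_left₀ hb hc 2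
        have h1 : (0 : ℝ) ≤ 2 ^ h₀.card - 1 := by linarith
        gcongr

/-- The bound is at least `K ^ (-d)` with `K` depending on `m` only, and `K ^ d ≤ n ^ (c * log K)`
at depth `d ≤ c * log n`. -/
theorem exists_inv_pow_le_bound (m : ℕ) (c : ℝ) (hm : 1 ≤ m) :
    ∃ C : ℕ, ∀ n d : ℕ, 2 ≤ n → 1 ≤ d → (d : ℝ) ≤ c * Real.log n →
      1 / (n : ℝ) ^ C ≤
        (2 ^ (m * d) - 1) / (2 * (2 ^ (2 * m) - 1) ^ 2 * (2 ^ m + 1) ^ (4 * (d - 1))) := by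
  set A : ℝ := 2 * (2 ^ (2 * m)) ^ 2 with hA
  set B : ℝ := (2 ^ m + 1) ^ 4 with hB
  have hA1 : 1 ≤ A := by
    have : (1 : ℝ) ≤ (2 ^ (2 * m)) ^ 2 := one_le_pow₀ (one_le_pow₀ (by norm_num))
    linarith
  have hB1 : 1 ≤ B := one_le_pow₀ (by linarith [pow_pos (show (0 : ℝ) < 2 by norm_num) m])
  have hK1 : 1 ≤ A * B := one_le_mul_of_one_le_of_one_le hA1 hB1
  have hlogK : 0 ≤ Real.log (A * B) := Real.log_nonneg hK1
  refine ⟨⌈c * Real.log (A * B)⌉₊, fun n d hn hd hdn => ?_⟩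
  have hn0 : (0 : ℝ) < n := by exact_mod_cast (by omega : 0 < n)
  have hlogn : 0 ≤ Real.log n := Real.log_nonneg (by exact_mod_cast (by omega : 1 ≤ n))
  have hpow : (A * B) ^ d ≤ (n : ℝ) ^ ⌈c * Real.log (A * B)⌉₊ := by
    rw [← Real.log_le_log_iff (by positivity) (by positivity), Real.log_pow, Real.log_pow]
    calc (d : ℝ) * Real.log (A * B) ≤ c * Real.log n * Real.log (A * B) :=
          mul_le_mul_of_nonneg_right hdn hlogK
      _ = c * Real.log (A * B) * Real.log n := by ring
      _ ≤ _ := mul_le_mul_of_nonneg_right (Nat.le_ceil _) hlogn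
  have h4 : (2 : ℝ) ≤ 2 ^ (2 * m) := by
    simpa using pow_le_pow_right₀ (show (1 : ℝ) ≤ 2 by norm_num) (show 1 ≤ 2 * m by omega)
  have hden0 : (0 : ℝ) < 2 * (2 ^ (2 * m) - 1) ^ 2 * (2 ^ m + 1) ^ (4 * (d - 1)) := by
    have : (0 : ℝ) < 2 ^ (2 * m) - 1 := by linarith
    positivity
  have hden : (2 : ℝ) * (2 ^ (2 * m) - 1) ^ 2 * (2 ^ m + 1) ^ (4 * (d - 1)) ≤ (A * B) ^ d := by
    calc (2 : ℝ) * (2 ^ (2 * m) - 1) ^ 2 * (2 ^ m + 1) ^ (4 * (d - 1)) ≤ A * B ^ (d - 1) := by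
          rw [hA, hB, pow_mul _ 4 (d - 1)]
          have : ((2 : ℝ) ^ (2 * m) - 1) ^ 2 ≤ (2 ^ (2 * m)) ^ 2 :=
            pow_le_pow_left₀ (by linarith) (by linarith) 2
          gcongr
      _ ≤ (A * B) * (A * B) ^ (d - 1) := by
          have h1 : A ≤ A * B := le_mul_of_one_le_right (by linarith) hB1
          have h2 : B ≤ A * B := le_mul_of_one_le_left (by linarith) hA1
          gcongr
      _ = (A * B) ^ d := by
          rw [← pow_succ', Nat.sub_add_cancel hd]
  have hnum : (1 : ℝ) ≤ 2 ^ (m * d) - 1 := by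
    have : (2 : ℝ) ≤ 2 ^ (m * d) := by
      simpa using pow_le_pow_right₀ (show (1 : ℝ) ≤ 2 by norm_num) (Nat.mul_pos hm hd)
    linarith
  calc 1 / (n : ℝ) ^ ⌈c * Real.log (A * B)⌉₊
      ≤ 1 / (2 * (2 ^ (2 * m) - 1) ^ 2 * (2 ^ m + 1) ^ (4 * (d - 1))) :=
        one_div_le_one_div_of_le hden0 (hden.trans hpow)
    _ ≤ _ := div_le_div_of_nonneg_right hnum hden0.le

/-! ### The alternating layered ansatz -/

section ansatz

variable {Ω : Type*} [mΩ : MeasurableSpace Ω] {P : Measure Ω} [IsProbabilityMeasure P]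
  {bc : Boundary} {m κ d : ℕ} {k : Fin κ} {ρ : QMatrix (m * κ)} {W W' : Piece κ → Ω → QUnitary m}

omit [IsProbabilityMeasure P] in
theorem indep_pieceSigma_elim (hW : ∀ a, Measurable (W a)) (hW' : ∀ a, Measurable (W' a))
    (hind : iIndepFun (Sum.elim W W') P) :
    Indep (pieceSigma W Set.univ) (pieceSigma W' Set.univ) P := by
  have h := indep_iSup_of_disjoint (μ := P)
    (m := fun i => MeasurableSpace.comap (Sum.elim W W' i) inferInstance)
    (fun i => by rcases i with a | a; exacts [(hW a).comap_le, (hW' a).comap_le]) hind.iIndep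
    (Set.disjoint_range_iff.mpr fun (a a' : Piece κ) => Sum.inl_ne_inr (a := a) (b := a'))
  refine indep_of_indep_of_le_left (indep_of_indep_of_le_right h ?_) ?_
  · exact iSup₂_le fun a _ => le_iSup₂_of_le (Sum.inr a) (Set.mem_range_self a) le_rfl
  · exact iSup₂_le fun a _ => le_iSup₂_of_le (Sum.inl a) (Set.mem_range_self a) le_rfl

/-- Mean and variance of the kernel for the alternating layered ansatz. -/
theorem ansatz_mean_and_variance (hρ : IsDensityMatrix ρ) (hm : m = 1 ∨ Even m) (hm1 : 1 ≤ m)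
    (hd1 : 1 ≤ d) (j : Fin m) (σ : Pauli) (hW : ∀ a, Measurable (W a))
    (hW' : ∀ a, Measurable (W' a)) (hind : iIndepFun (Sum.elim W W') P)
    (hd : ∀ a ∈ conePieces bc m κ d k, IsUnitaryDesign 2 (P.map (W a)))
    (hd' : ∀ a ∈ conePieces bc m κ d k, IsUnitaryDesign 2 (P.map (W' a))) :
    MemLp (fun ω => aldTerm ρ (pauliOn (blockWire m κ d k j) σ)
        (circuitUpTo bc m κ d k fun a => W a ω) (circuitUpTo bc m κ d k fun a => W' a ω)) 2 P ∧
      ∫ ω, aldTerm ρ (pauliOn (blockWire m κ d k j) σ)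
        (circuitUpTo bc m κ d k fun a => W a ω) (circuitUpTo bc m κ d k fun a => W' a ω) ∂P = 0 ∧
      variance (fun ω => aldTerm ρ (pauliOn (blockWire m κ d k j) σ)
        (circuitUpTo bc m κ d k fun a => W a ω) (circuitUpTo bc m κ d k fun a => W' a ω)) P =
        1 / 2 * ∑ h, ∑ h', circuitCoef bc m κ d k h * circuitCoef bc m κ d k h' *
          (purity ρ ((h ∪ h') \ (h ∩ h')) + 2 ^ (h ∩ h').card * purity ρ (h ∪ h')) := by
  have hWi : iIndepFun W P := hind.precomp (g := Sum.inl) Sum.inl_injective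
  have hWi' : iIndepFun W' P := hind.precomp (g := Sum.inr) Sum.inr_injective
  have hs := circuitState_circuitUpTo hW hWi hd hm hm1 hd1 j σ
  have hs' := circuitState_circuitUpTo hW' hWi' hd' hm hm1 hd1 j σ
  have hU := hs.meas.mono (pieceSigma_mono W (Set.subset_univ _))
  have hU' := hs'.meas.mono (pieceSigma_mono W' (Set.subset_univ _))
  have h1 := pieceSigma_le hW Set.univ
  have h2 := pieceSigma_le hW' Set.univ
  have hI := indep_pieceSigma_elim hW hW' hind
  have hH := hρ.1.isHermitian
  have hB := pauliOn_isHermitian (blockWire m κ d k j) σ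
  have hmean := integral_aldTerm_eq_zero h1 h2 hI hU hU' hH hB (.inl hs.mean)
  exact ⟨memLp_aldTerm (hU.mono h1) (hU'.mono h2) _ _, hmean,
    variance_aldTerm h1 h2 hI hU hU' hH hB hmean hs.second hs'.second⟩

end ansatz

/-- The variance is at least the contribution of one set of at most `m * d` qubits, for which the
bound for product states is available up to the square of the purity. -/
theorem LayerInv.exists_le_half_sum {bc : Boundary} {m κ d : ℕ} {k : Fin κ}
    {c : Finset (Fin (m * κ)) → ℝ} {ρ : QMatrix (m * κ)} (hm1 : 1 ≤ m) (hd1 : 1 ≤ d)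
    (h : LayerInv bc m κ d k 1 Finset.univ (InWindow m κ d k (d - 1)) c) (hρ : IsDensityMatrix ρ)
    (hmul : PurityProduct bc m κ d k ρ) :
    ∃ h₀ : Finset (Fin (m * κ)), h₀.card ≤ m * d ∧
      2 ^ (2 * m * d) * (2 ^ (m * d) - 1) /
          (2 * (2 ^ (2 * m) - 1) ^ 2 * (2 ^ m + 1) ^ (4 * (d - 1))) * purity ρ h₀ ^ 2 ≤
        1 / 2 * ∑ h, ∑ h', c h * c h' *
          (purity ρ ((h ∪ h') \ (h ∩ h')) + 2 ^ (h ∩ h').card * purity ρ (h ∪ h')) := by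
  obtain ⟨h₀, hcard, hle⟩ := h.exists_large hm1 hd1
  refine ⟨h₀, hcard, ?_⟩
  have hsum := le_sum_of_purity_mul_le (c := c) (purity_empty hρ.2)
    (purity_nonneg hρ.1.isHermitian) h.nonneg (fun h₁ h₂ hc₁ hc₂ => by
      obtain ⟨A, hA, rfl⟩ := h.exists_eq_firstLayerRegion hc₁
      obtain ⟨A', hA', rfl⟩ := h.exists_eq_firstLayerRegion hc₂
      exact hmul A A' hA hA') h₀
  have := mul_le_mul_of_nonneg_right hle (sq_nonneg (purity ρ h₀))
  linarith

theorem mainTheorem2 {Ω : Type*} [MeasurableSpace Ω] (P : Measure Ω) [IsProbabilityMeasure P] :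
    -- (1) random circuits on all qubits
    (∀ (n : ℕ) (ρ : QMatrix n), IsPureState ρ → ∀ (q : Fin n) (σ : Pauli) (U U' : Ω → QUnitary n),
      Measurable U → Measurable U' → IndepFun U U' P →
      ((IsUnitaryDesign 1 (P.map U) ∨ IsUnitaryDesign 1 (P.map U')) →
        MemLp (fun ω => aldTerm ρ (pauliOn q σ) (U ω) (U' ω)) 2 P ∧
        ∫ ω, aldTerm ρ (pauliOn q σ) (U ω) (U' ω) ∂P = 0) ∧
      (IsUnitaryDesign 2 (P.map U) → IsUnitaryDesign 2 (P.map U') →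
        MemLp (fun ω => aldTerm ρ (pauliOn q σ) (U ω) (U' ω)) 2 P ∧
        ∫ ω, aldTerm ρ (pauliOn q σ) (U ω) (U' ω) ∂P = 0 ∧
        variance (fun ω => aldTerm ρ (pauliOn q σ) (U ω) (U' ω)) P =
          2 ^ n / (2 * (2 ^ (2 * n) - 1)) * (1 + (2 ^ n - 2) / (2 ^ n * (2 ^ n + 1))))) ∧
    ((fun n : ℕ => (2 ^ n / (2 * (2 ^ (2 * n) - 1)) *
        (1 + (2 ^ n - 2) / (2 ^ n * (2 ^ n + 1))) : ℝ)) ~[atTop]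
      fun n : ℕ => 1 / 2 ^ (n + 1)) ∧
    -- (2) the alternating layered ansatz
    (∀ (bc : Boundary) (m κ d : ℕ) (k : Fin κ), 1 ≤ m → (m = 1 ∨ Even m) → 1 ≤ d →
      HasBlock bc m κ d k →
      (∀ ρ : QMatrix (m * κ), IsDensityMatrix ρ → ∀ (j : Fin m) (σ : Pauli)
        (W W' : Piece κ → Ω → QUnitary m), (∀ a, Measurable (W a)) → (∀ a, Measurable (W' a)) →
        iIndepFun (Sum.elim W W') P →
        (∀ a ∈ conePieces bc m κ d k, IsUnitaryDesign 2 (P.map (W a))) →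
        (∀ a ∈ conePieces bc m κ d k, IsUnitaryDesign 2 (P.map (W' a))) →
        MemLp (fun ω => aldTerm ρ (pauliOn (blockWire m κ d k j) σ)
          (circuitUpTo bc m κ d k fun a => W a ω) (circuitUpTo bc m κ d k fun a => W' a ω)) 2 P ∧
        ∫ ω, aldTerm ρ (pauliOn (blockWire m κ d k j) σ)
          (circuitUpTo bc m κ d k fun a => W a ω)
          (circuitUpTo bc m κ d k fun a => W' a ω) ∂P = 0 ∧
        (PurityProduct bc m κ d k ρ →
          (2 ^ (m * d) - 1) / (2 * (2 ^ (2 * m) - 1) ^ 2 * (2 ^ m + 1) ^ (4 * (d - 1))) ≤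
          variance (fun ω => aldTerm ρ (pauliOn (blockWire m κ d k j) σ)
            (circuitUpTo bc m κ d k fun a => W a ω)
            (circuitUpTo bc m κ d k fun a => W' a ω)) P) ∧
        (IsProductPureState ρ →
          2 ^ (2 * m * d) * (2 ^ (m * d) - 1) /
            (2 * (2 ^ (2 * m) - 1) ^ 2 * (2 ^ m + 1) ^ (4 * (d - 1))) ≤
          variance (fun ω => aldTerm ρ (pauliOn (blockWire m κ d k j) σ)
            (circuitUpTo bc m κ d k fun a => W a ω)
            (circuitUpTo bc m κ d k fun a => W' a ω)) P)) ∧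
      (∀ ρ : QMatrix (m * κ), IsProductPureState ρ → PurityProduct bc m κ d k ρ) ∧
      PurityProduct bc m κ d k (completelyMixed (m * κ))) ∧
    -- the bound does not involve the number of qubits; at logarithmic depth it is at least
    -- inverse polynomial in the number of qubits
    (∀ (m : ℕ) (c : ℝ), 1 ≤ m → 0 < c → ∃ C : ℕ, ∀ n d : ℕ, 2 ≤ n → 1 ≤ d →
      (d : ℝ) ≤ c * Real.log n →
      1 / (n : ℝ) ^ C ≤
        (2 ^ (m * d) - 1) / (2 * (2 ^ (2 * m) - 1) ^ 2 * (2 ^ m + 1) ^ (4 * (d - 1)))) := by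
  refine ⟨fun n ρ hρ q σ U U' hU hU' hind =>
    ⟨fun hd => memLp_and_integral_aldTerm_of_one_design hρ q σ hU hU' hind hd,
      fun hd hd' => mean_and_variance_aldTerm_of_two_design hρ q σ hU hU' hind hd hd'⟩,
    isEquivalent_variance_one_div_two_pow, ?_,
    fun m c hm _ => exists_inv_pow_le_bound m c hm⟩
  intro bc m κ d k hm1 hm hd1 _
  refine ⟨fun ρ hρ j σ W W' hW hW' hind hd hd' => ?_,
    fun ρ hρ => hρ.purityProduct, purityProduct_completelyMixed bc m κ d k⟩
  have hinv := (circuitState_circuitUpTo hW (hind.precomp (g := Sum.inl) Sum.inl_injective)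
    hd hm hm1 hd1 j σ).inv
  obtain ⟨hL, hmean, hvar⟩ := ansatz_mean_and_variance hρ hm hm1 hd1 j σ hW hW' hind hd hd'
  refine ⟨hL, hmean, fun hmul => ?_, fun hprod => ?_⟩
  · rw [hvar]
    obtain ⟨h₀, hcard, hle⟩ := hinv.exists_le_half_sum hm1 hd1 hρ hmul
    refine le_trans ?_ hle
    have h4 : (0 : ℝ) ≤ 2 ^ (m * d) - 1 := sub_nonneg.mpr (one_le_pow₀ (by norm_num))
    -- the square of the least possible purity on `m * d` qubits is the quotient of the two bounds
    have hp : ((2 : ℝ) ^ (2 * m * d))⁻¹ ≤ purity ρ h₀ ^ 2 := by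
      calc ((2 : ℝ) ^ (2 * m * d))⁻¹ = ((2 ^ (m * d))⁻¹) ^ 2 := by
            rw [inv_pow, ← pow_mul]
            congr 2
            ring
        _ ≤ ((2 ^ h₀.card)⁻¹) ^ 2 := by gcongr; norm_num
        _ ≤ purity ρ h₀ ^ 2 := pow_le_pow_left₀ (by positivity) (inv_two_pow_le_purity hρ h₀) 2
    calc (2 ^ (m * d) - 1) / (2 * (2 ^ (2 * m) - 1) ^ 2 * (2 ^ m + 1) ^ (4 * (d - 1)))
        = 2 ^ (2 * m * d) * (2 ^ (m * d) - 1) /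
            (2 * (2 ^ (2 * m) - 1) ^ 2 * (2 ^ m + 1) ^ (4 * (d - 1))) *
              ((2 : ℝ) ^ (2 * m * d))⁻¹ := by
          rw [mul_div_assoc, mul_comm ((2 : ℝ) ^ (2 * m * d)),
            mul_inv_cancel_right₀ (by positivity)]
      _ ≤ _ := mul_le_mul_of_nonneg_left hp (by positivity)
  · rw [hvar]
    obtain ⟨h₀, -, hle⟩ := hinv.exists_le_half_sum hm1 hd1 hρ hprod.purityProduct
    rwa [hprod.purity_eq_one, one_pow, mul_one] at hle
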